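/- **Conventions.** Let $p$ be a prime and let $G$ be a finite nil-2 $p$-group of exponent $p$ (that is, $G'=[G,G]\le Z(G)$). It is given by $p,m,d$, elements $x_1,\dots,x_m\in G$ and $z_1,\dots,z_d\in G'$ such that $z_1,\dots,z_d$ generate $G'$ and every $g\in G$ is uniquely of the form $g=x_1^{e_1}\cdots x_m^{e_m}z_1^{f_1}\cdots z_d^{f_d}$ with $0\le e_i,f_k<p$, and the table of the exponents $c_{ijk}$ with $x_i^{-1}x_j^{-1}x_ix_j=\prod_k z_k^{c_{ijk}}$; elements of $G$ are encoded by their exponent words. A function $f$ on $G$ *hides* a subgroup $K$ if it is constant on each left coset of $K$ and takes distinct values on distinct left cosets. A family of vectors $\{|\Psi_g\rangle : g\in G\}$ in a (finite-dimensional) Hilbert space is a *hiding set* for $K$ if all $|\Psi_g\rangle$ are unit vectors, $|\Psi_g\rangle=|\Psi_{g'}\rangle$ whenever $g,g'$ are in the same left coset of $K$, and $|\Psi_g\rangle\perp|\Psi_{g'}\rangle$ whenever they are in different left cosets. A quantum procedure *hides* $K$ if, invoked for $g_1,\dots,g_N\in G$, it maps $|g_1\rangle\cdots|g_N\rangle|0\rangle$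 to $|g_1\rangle\cdots|g_N\rangle|\Psi^1_{g_1}\rangle\cdots|\Psi^N_{g_N}\rangle$ (linearly extended to superpositions), where every $\{|\Psi^i_g\rangle : g\in G\}$ is a hiding set for $K$. The machine model is a classically controlled quantum random access machine with logarithmic cost: classical arithmetic on registers, Hadamard gates, gates $\mathrm{diag}(1,e^{2\pi i/2^k})$ (at cost $k$), reversible arithmetic on $w$-qubit registers (at cost $w$), one-qubit measurements, and oracle queries $|g\rangle|y\rangle\mapsto|g\rangle|y\oplus f(g)\rangle$, each counted as one step (besides the cost of addressing). **Theorem.** There are one quantum algorithm $\mathcal A$ in this model and one polynomial $q$ such that the following holds for every $G$ given as above, every subgroup $H\le G$ with $|H|\in\{1,p\}$, every function $f$ hiding $H$ in $G$, and every quantum procedure hiding the subgroup $HG'$ in $G$ (possibly with different hiding sets at different invocations). Given $G$, and using the oracle $f$ and the hiding procedure as a subroutine, each of whose invocations (on one group element) takes time $\tau$, the algorithm $\mathcal A$ always halts within time $q(\log_2|G|+\tau)$ and with probability at least $2/3$ outputs a generator of $H$. In particular, if the procedure hiding $HG'$ is efficient (polynomial in $\log|G|$), then $H$ is found efficiently.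 -/

import Mathlib

universe u

/-! ## Hiding functions, hiding sets, presentations -/

/-- `f` hides `K` in `G`: it is constant on every left coset of `K` and takes distinct values on
distinct left cosets. -/
def Hides {G : Type*} [Group G] (f : G → ℕ) (K : Subgroup G) : Prop :=
  ∀ g g' : G, f g = f g' ↔ g⁻¹ * g' ∈ K

/-- The vectors `Ψ g` of a Hilbert space form a hiding set for the subgroup `K` of `G`. -/
structure IsHidingSet {G E : Type*} [Group G] [NormedAddCommGroup E] [InnerProductSpace ℂ E]
    (K : Subgroup G) (Ψ : G → E) : Prop where
  norm_eq_one : ∀ g, ‖Ψ g‖ = 1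
  eq_of_mem : ∀ g g', g⁻¹ * g' ∈ K → Ψ g = Ψ g'
  inner_eq_zero : ∀ g g', g⁻¹ * g' ∉ K → inner ℂ (Ψ g) (Ψ g') = 0

/-- The group element `g₁ ^ w₁ * ⋯ * gₙ ^ wₙ`. -/
def normalWord {G : Type*} [Group G] {n : ℕ} (g : Fin n → G) (w : Fin n → ℕ) : G :=
  (List.ofFn fun i => g i ^ w i).prod

/-- The way a nil-2 `p`-group `G` of exponent `p` with parameters `(m, d)` is given: generators
`x₁, …, x_m` of `G` and `z₁, …, z_d` of `G'` such that every element is uniquely a normal word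
`x₁ ^ e₁ ⋯ x_m ^ e_m z₁ ^ f₁ ⋯ z_d ^ f_d` with exponents modulo `p`, together with the table of the
normal words of the commutators `[x_i, x_j] = x_i⁻¹ x_j⁻¹ x_i x_j`. -/
structure Presentation (G : Type*) [Group G] (p m d : ℕ) where
  x : Fin m → G
  z : Fin d → G
  /-- `c i j k` is the exponent of `z k` in the commutator of `x i` and `x j`. -/
  c : Fin m → Fin m → Fin d → Fin p
  closure_z : Subgroup.closure (Set.range z) = commutator G
  comm_eq : ∀ i j, (x i)⁻¹ * (x j)⁻¹ * x i * x j = normalWord z fun k => (c i j k : ℕ)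
  normalForm : Function.Bijective
    fun w : Fin (m + d) → Fin p => normalWord (Fin.append x z) fun i => (w i : ℕ)

namespace Presentation

variable {G : Type*} [Group G] {p m d : ℕ} (B : Presentation G p m d)

open Classical in
/-- The group element encoded by a word of natural numbers; only the words with all entries
smaller than `p` are encodings. -/
noncomputable def decode (w : Fin (m + d) → ℕ) : Option G :=
  if ∀ i, w i < p then some (normalWord (Fin.append B.x B.z) w) else none

/-- The input of an algorithm: the numbers `p`, `m`, `d`, followed by the table of the
`c i j k` in lexicographic order, in consecutive registers; all other registers hold `0`. -/
def input (B : Presentation G p m d) : ℕ → ℕ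
  | 0 => p
  | 1 => m
  | 2 => d
  | a + 3 =>
    if h : a < m * m * d then
      let r := finProdFinEquiv.symm (⟨a, h⟩ : Fin (m * m * d))
      let ij := finProdFinEquiv.symm r.1
      (B.c ij.1 ij.2 r.2 : ℕ)
    else 0

end Presentation

/-! ## The machine model

A random access machine with logarithmic cost that controls a quantum memory.  Classical registers
hold natural numbers.  The quantum memory consists of cells; the content of a cell is a string of
qubits, so that the basis states of a cell are (the binary expansions of) the natural numbers. -/

namespace QRam

/-- Arithmetic operations (`sub` is truncated, `div` and `mod` are quotient and remainder). -/
inductive Arith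
  | add | sub | mul | div | mod

/-- The value of an arithmetic operation. -/
def Arith.eval : Arith → ℕ → ℕ → ℕ
  | .add, a, b => a + b
  | .sub, a, b => a - b
  | .mul, a, b => a * b
  | .div, a, b => a / b
  | .mod, a, b => a % b

/-- Expressions over the classical registers; `reg e` is the content of the register whose
address is the value of `e`. -/
inductive Expr
  | const (n : ℕ)
  | reg (e : Expr)
  | op (o : Arith) (e₁ e₂ : Expr)

/-- The value of an expression. -/
def Expr.val (R : ℕ → ℕ) : Expr → ℕ
  | .const n => n
  | .reg e => R (e.val R)
  | .op o e₁ e₂ => o.eval (e₁.val R) (e₂.val R)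

/-- Logarithmic cost: every number that occurs in the evaluation is charged its binary length,
plus one. -/
def Expr.cost (R : ℕ → ℕ) : Expr → ℕ
  | .const n => 1 + n.size
  | .reg e => 1 + (R (e.val R)).size + e.cost R
  | .op o e₁ e₂ => 1 + (o.eval (e₁.val R) (e₂.val R)).size + e₁.cost R + e₂.cost R

/-- Programs.  All addresses of quantum cells and of qubits in them are values of classical
expressions. -/
inductive Com
  | skip
  | seq (c₁ c₂ : Com)
  | ite (e : Expr) (c₁ c₂ : Com)
  | loop (e : Expr) (c : Com)
  | assign (dst src : Expr)
  /-- Hadamard gate on one qubit of a cell. -/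
  | hadamard (cell bit : Expr)
  /-- The gate `diag (1, exp (2 π i / 2 ^ k))` on one qubit of a cell. -/
  | phase (cell bit k : Expr)
  /-- `|y⟩ ↦ |y ⊕ v⟩` on a cell, where `v` is the value of `src`. -/
  | load (cell src : Expr)
  /-- Reversible arithmetic on `w` bits: `|x⟩|y⟩|t⟩ ↦ |x⟩|y⟩|t ⊕ o (x mod 2^w) (y mod 2^w)⟩`
  on the cells `a`, `b`, `c`. -/
  | arith (o : Arith) (a b c w : Expr)
  /-- Measurement of one qubit of a cell; the outcome is written to the register `dst`. -/
  | measure (cell bit dst : Expr)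
  /-- Query to the hiding function: `|g⟩|y⟩ ↦ |g⟩|y ⊕ f g⟩`, the word of `g` being stored in
  consecutive cells from `a` on, and `y` in the cell `c`. -/
  | query (a c : Expr)
  /-- Invocation of the hiding procedure: `|g⟩|0⟩ ↦ |g⟩|Ψ_g⟩`, the word of `g` being stored in
  consecutive cells from `a` on, and `0` in the cell `c`. -/
  | hide (a c : Expr)

/-- Basis states of the quantum memory. -/
abbrev Basis := ℕ →₀ ℕ

/-- (Unnormalized) states of the quantum memory. -/
abbrev Ket := Basis →₀ ℂ

/-- The squared norm of a state. -/
noncomputable def weight (ψ : Ket) : ℝ := ψ.sum fun _ α => ‖α‖ ^ 2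

/-- Linear extension of a map that is given on basis states. -/
noncomputable def extend (K : Basis → Ket) (ψ : Ket) : Ket := ψ.sum fun b α => α • K b

/-- What a program has access to besides its input.  Group elements are words of length `len`. -/
structure Oracles where
  len : ℕ
  /-- The value of the hiding function at a word, if the word encodes a group element. -/
  label : (Fin len → ℕ) → Option ℕ
  /-- The dimension of the Hilbert space of the `i`-th hiding set. -/
  dim : ℕ → ℕ
  /-- The vector that the hiding procedure produces at its `i`-th invocation. -/
  hidden : (i : ℕ) → (Fin len → ℕ) → Option (EuclideanSpace ℂ (Fin (dim i)))
  /-- The time that one invocation of the hiding procedure takes. -/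
  price : ℕ

/-- `n` consecutive cells from `a` on. -/
def block (n a : ℕ) (b : Basis) : Fin n → ℕ := fun i => b (a + i)

/-- Hadamard gate. -/
noncomputable def hadamardK (c j : ℕ) (b : Basis) : Ket :=
  let b' := b.update c (b c ^^^ 2 ^ j)
  ((1 / Real.sqrt 2 : ℝ) : ℂ) •
    (if (b c).testBit j then Finsupp.single b' 1 - Finsupp.single b 1
      else Finsupp.single b 1 + Finsupp.single b' 1)

/-- Phase gate. -/
noncomputable def phaseK (c j k : ℕ) (b : Basis) : Ket :=
  Finsupp.single b (if (b c).testBit j then Complex.exp (2 * Real.pi * Complex.I / 2 ^ k) else 1)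

/-- Addition modulo 2 of a known number. -/
noncomputable def loadK (c v : ℕ) (b : Basis) : Ket :=
  Finsupp.single (b.update c (b c ^^^ v)) 1

/-- Reversible arithmetic; no effect if the target is one of the two operands. -/
noncomputable def arithK (o : Arith) (x y c w : ℕ) (b : Basis) : Ket :=
  if c = x ∨ c = y then Finsupp.single b 1
  else Finsupp.single (b.update c (b c ^^^ o.eval (b x % 2 ^ w) (b y % 2 ^ w))) 1

/-- Projection to the states in which the qubit `j` of the cell `c` has the value `v`. -/
noncomputable def measureK (c j : ℕ) (v : Bool) (b : Basis) : Ket :=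
  if (b c).testBit j = v then Finsupp.single b 1 else 0

/-- Oracle query.  It is defined only if the word is an encoding of a group element and the target
is outside of the word; any other component of the state is lost. -/
noncomputable def queryK (O : Oracles) (a c : ℕ) (b : Basis) : Ket :=
  match O.label (block O.len a b) with
  | none => 0
  | some v => if a ≤ c ∧ c < a + O.len then 0 else Finsupp.single (b.update c (b c ^^^ v)) 1

/-- The `i`-th invocation of the hiding procedure.  It is defined only if the word is an encoding
of a group element and the target is outside of the word and in the state `0`; any other component
of the state is lost. -/
noncomputable def hideK (O : Oracles) (i a c : ℕ) (b : Basis) : Ket :=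
  match O.hidden i (block O.len a b) with
  | none => 0
  | some Ψ =>
    if (a ≤ c ∧ c < a + O.len) ∨ b c ≠ 0 then 0
    else ∑ y : Fin (O.dim i), Finsupp.single (b.update c (y : ℕ)) (Ψ y)

/-- Configurations: the programs still to be executed, the contents of the classical registers, the
state of the quantum memory (unnormalized: its squared norm is the probability of the measurement
outcomes seen so far), the time elapsed, and the number of invocations of the hiding procedure. -/
structure Config where
  todo : List Com
  reg : ℕ → ℕ
  ket : Ket
  time : ℕ
  calls : ℕ

/-- One step: the list of the possible next configurations (two in the case of a measurement). -/
noncomputable def step (O : Oracles) (σ : Config) : List Config :=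
  let R := σ.reg
  match σ.todo with
  | [] => [σ]
  | .skip :: r => [{ σ with todo := r, time := σ.time + 1 }]
  | .seq c₁ c₂ :: r => [{ σ with todo := c₁ :: c₂ :: r, time := σ.time + 1 }]
  | .ite e c₁ c₂ :: r =>
    [{ σ with todo := (if e.val R ≠ 0 then c₁ else c₂) :: r, time := σ.time + 1 + e.cost R }]
  | .loop e c :: r =>
    [{ σ with
        todo := if e.val R ≠ 0 then c :: .loop e c :: r else r
        time := σ.time + 1 + e.cost R }]
  | .assign dst src :: r =>
    [{ σ with
        todo := r
        reg := Function.update R (dst.val R) (src.val R)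
        time := σ.time + 1 + dst.cost R + src.cost R }]
  | .hadamard e j :: r =>
    [{ σ with
        todo := r
        ket := extend (hadamardK (e.val R) (j.val R)) σ.ket
        time := σ.time + 1 + e.cost R + j.cost R }]
  | .phase e j k :: r =>
    [{ σ with
        todo := r
        ket := extend (phaseK (e.val R) (j.val R) (k.val R)) σ.ket
        time := σ.time + 1 + e.cost R + j.cost R + k.cost R + k.val R }]
  | .load e s :: r =>
    [{ σ with
        todo := r
        ket := extend (loadK (e.val R) (s.val R)) σ.ket
        time := σ.time + 1 + e.cost R + s.cost R }]
  | .arith o x y e w :: r =>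
    [{ σ with
        todo := r
        ket := extend (arithK o (x.val R) (y.val R) (e.val R) (w.val R)) σ.ket
        time := σ.time + 1 + x.cost R + y.cost R + e.cost R + w.cost R + w.val R }]
  | .measure e j dst :: r =>
    [false, true].map fun v =>
      { σ with
        todo := r
        reg := Function.update R (dst.val R) v.toNat
        ket := extend (measureK (e.val R) (j.val R) v) σ.ket
        time := σ.time + 1 + e.cost R + j.cost R + dst.cost R }
  | .query a c :: r =>
    [{ σ with
        todo := r
        ket := extend (queryK O (a.val R) (c.val R)) σ.ket
        time := σ.time + 1 + a.cost R + c.cost R }]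
  | .hide a c :: r =>
    [{ σ with
        todo := r
        ket := extend (hideK O σ.calls (a.val R) (c.val R)) σ.ket
        time := σ.time + 1 + a.cost R + c.cost R + O.price
        calls := σ.calls + 1 }]

/-- The configurations reached after `n` steps, one for each sequence of measurement outcomes. -/
noncomputable def run (O : Oracles) : ℕ → Config → List Config
  | 0, σ => [σ]
  | n + 1, σ => (step O σ).flatMap (run O n)

/-- The configuration in which the program `A` starts on the input `R`: the quantum memory is in
the state `|0⟩`. -/
noncomputable def start (A : Com) (R : ℕ → ℕ) : Config where
  todo := [A]
  reg := R
  ket := Finsupp.single 0 1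
  time := 0
  calls := 0

open Classical in
/-- On the input `R`, whatever the outcomes of the measurements are, the program `A` halts
within time `T`; and with probability at least `2 / 3` the final contents of its registers
satisfy `Good`. -/
def Computes (O : Oracles) (A : Com) (R : ℕ → ℕ) (T : ℕ) (Good : (ℕ → ℕ) → Prop) : Prop :=
  ∃ n : ℕ,
    (∀ σ ∈ run O n (start A R), σ.ket ≠ 0 → σ.todo = [] ∧ σ.time ≤ T) ∧
    2 / 3 ≤ ((run O n (start A R)).map fun σ =>
      if σ.todo = [] ∧ Good σ.reg then weight σ.ket else 0).sum

end QRam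

/-- The oracles for a presented group `G`: the function `f`, and the quantum procedure that uses the
vectors `Ψ i g` at its `i`-th invocation and takes time `τ` for each.  Invoked for `g₁, …, g_N` one
after the other it turns `|g₁⟩ ⋯ |g_N⟩|0⟩` into `|g₁⟩ ⋯ |g_N⟩|Ψ¹_{g₁}⟩ ⋯ |Ψᴺ_{g_N}⟩`. -/
noncomputable def Presentation.oracles {G : Type*} [Group G] {p m d : ℕ}
    (B : Presentation G p m d) (f : G → ℕ) (D : ℕ → ℕ)
    (Ψ : (i : ℕ) → G → EuclideanSpace ℂ (Fin (D i))) (τ : ℕ) : QRam.Oracles where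
  len := m + d
  label w := (B.decode w).map f
  dim := D
  hidden i w := (B.decode w).map (Ψ i)
  price := τ

/-- The first `m + d` registers hold the encoding of a generator of `H`. -/
def Presentation.OutputsGenerator {G : Type*} [Group G] {p m d : ℕ}
    (B : Presentation G p m d) (H : Subgroup G) (R : ℕ → ℕ) : Prop :=
  ∃ h : G, B.decode (fun i => R i) = some h ∧ Subgroup.zpowers h = H

/-! Fourier sampling finds a subspace that is hidden in a vector space over `ZMod p`, and the
problem in `G` reduces to two problems of this kind.

The map sending an exponent vector `x` in `(ZMod p)^m` to the product of the `x_i ^ e_i` is a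
homomorphism modulo `G'`, so the procedure for `HG'` hides the preimage of `HG'` under it
(`homMod_abelianElem`). As `H` has order 1 or `p`, the quotient `HG'/G'` is trivial or cyclic of
order `p`. Hence any nonzero vector `v` of the preimage, or `v = 0` if there is none, satisfies `H ≤
⟨x^v⟩ G'` (`le_zpowers_sup`).

On the abelian group `⟨x^v⟩ G'` the function `f` hides `H`, but a homomorphism from `(ZMod p)^(d+1)`
onto this group is needed to query it. The obvious candidate, `t` mapped to the product of the `x_i
^ (t v_i)`, fails: at `(t, s)` its defect is the central element with exponents `t s Q_l(v)`, where
`Q` is `squareForm` (`powProd_mul_powProd`). Correcting the exponents of the `z_l` by `t² w_l` with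
`2 w_l = Q_l(v)` repairs it, because `(t + s)² - t² - s² = 2 t s` (`homMod_quadraticElem`). Halving
is possible for odd `p`, and for `p = 2` the group is abelian with `d = 0` (`d_eq_zero`). Now `f`
hides the preimage of `H`. Any spanning vector of the preimage with nontrivial image gives a
generator of `H`, and if there is none then `H` is trivial (`zpowers_eq`).

The gates at hand provide the Fourier transform over `ZMod (2 ^ n)` and not over `ZMod p`. With `2 ^
n` large compared with `p²`, rounding the outcomes yields nearly uniform elements of the orthogonal
complement of the hidden space (`normSq_outcome`, `norm_fejer_le`, `le_sum_normSq_outcome`). The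
transform is measured bit by bit, with phase gates controlled by earlier outcomes, so that one-qubit
gates are enough (`measOp_succ_true`). Starting from the whole space `X`, each sample cuts `X` with
a hyperplane, which divides the expected excess of `Nat.card X` over the size of the hidden space by
`p` (`sum_card_inf_hyperplane`, `potential_succ_le`). After `k + 5` rounds the space is found with
probability at least `9/10`, and both searches succeed with probability at least `81/100`.

The remainder verifies a concrete program. The judgement `Frame.Ends` bounds the number of steps
and, from below, the expected score. States are unnormalized, so that the two branches of a
measurement simply add up. The time is polynomial because one number, linear in the logarithm of the
order of `G`, bounds the iterations of all loops and the lengths of all registers. -/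

namespace QRam

/-! ## Static bounds for the running time -/

/-- The values of `e` have at most `e.leaves` times as many digits as the registers. -/
def Expr.leaves : Expr → ℕ
  | .const n => n.size + 1
  | .reg _ => 1
  | .op _ e₁ e₂ => e₁.leaves + e₂.leaves

/-- The cost of evaluating `e` is at most `e.rate` times the length of the registers. -/
def Expr.rate : Expr → ℕ
  | .const n => n.size + 1
  | .reg e => 1 + e.rate
  | .op _ e₁ e₂ => 1 + e₁.leaves + e₂.leaves + e₁.rate + e₂.rate

theorem Expr.leaves_pos (e : Expr) : 1 ≤ e.leaves := by
  induction e with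
  | const n => simp [leaves]
  | reg e => simp [leaves]
  | op o e₁ e₂ h₁ h₂ => simp only [leaves]; omega

/-- Multiplication is the worst of the five operations, and there lengths add. As both lengths are
positive, `2 ^ x + 2 ^ y ≤ 2 ^ (x + y)`, so sums fit too; the other three operations never exceed
`a`. -/
theorem Arith.eval_lt_two_pow (o : Arith) {a b x y : ℕ} (ha : a < 2 ^ x) (hb : b < 2 ^ y)
    (hx : 1 ≤ x) (hy : 1 ≤ y) : o.eval a b < 2 ^ (x + y) := by
  have hx2 : 2 ≤ 2 ^ x := by simpa using Nat.pow_le_pow_right (n := 2) (by omega) hx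
  have hy2 : 2 ≤ 2 ^ y := by simpa using Nat.pow_le_pow_right (n := 2) (by omega) hy
  have hxy : 2 ^ x ≤ 2 ^ x * 2 ^ y := Nat.le_mul_of_pos_right _ (by omega)
  rw [pow_add]
  cases o with
  | add => simp only [eval]; nlinarith
  | sub => simp only [eval]; omega
  | mul => exact Nat.mul_lt_mul'' ha hb
  | div => exact lt_of_le_of_lt (Nat.div_le_self _ _) (by omega)
  | mod => exact lt_of_le_of_lt (Nat.mod_le _ _) (by omega)

/-- Indirect addressing does not enlarge values, since whatever is fetched is again below `2 ^ L`.
Only arithmetic makes lengths add, which is what `leaves` counts. -/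
theorem Expr.val_lt {R : ℕ → ℕ} {L : ℕ} (hR : ∀ a, R a < 2 ^ L) (e : Expr) :
    e.val R < 2 ^ (e.leaves * (L + 1)) := by
  induction e with
  | const n =>
    exact (Nat.lt_size_self n).trans_le (Nat.pow_le_pow_right (by omega) (by
      simp only [leaves]; nlinarith))
  | reg e => exact (hR _).trans_le (Nat.pow_le_pow_right (by omega) (by simp [leaves]))
  | op o e₁ e₂ h₁ h₂ =>
    have := o.eval_lt_two_pow h₁ h₂ (by nlinarith [e₁.leaves_pos]) (by nlinarith [e₂.leaves_pos])
    simpa [leaves, add_mul, val] using this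

theorem Expr.cost_le {R : ℕ → ℕ} {L : ℕ} (hR : ∀ a, R a < 2 ^ L) (e : Expr) :
    e.cost R ≤ e.rate * (L + 1) := by
  induction e with
  | const n => simp only [cost, rate]; nlinarith
  | reg e h =>
    have : (R (e.val R)).size ≤ L := Nat.size_le.2 (hR _)
    simp only [cost, rate]; nlinarith
  | op o e₁ e₂ h₁ h₂ =>
    have : (o.eval (e₁.val R) (e₂.val R)).size ≤ (e₁.leaves + e₂.leaves) * (L + 1) :=
      Nat.size_le.2 (by simpa [leaves, val] using (Expr.op o e₁ e₂).val_lt hR)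
    simp only [cost, rate]; nlinarith

/-- The sum of the rates of all expressions in a program. -/
def Com.rate : Com → ℕ
  | .skip => 0
  | .seq c₁ c₂ => c₁.rate + c₂.rate
  | .ite e c₁ c₂ => e.rate + c₁.rate + c₂.rate
  | .loop e c => e.rate + c.rate
  | .assign e₁ e₂ => e₁.rate + e₂.rate
  | .hadamard e₁ e₂ => e₁.rate + e₂.rate
  | .phase e₁ e₂ e₃ => e₁.rate + e₂.rate + e₃.rate
  | .load e₁ e₂ => e₁.rate + e₂.rate
  | .arith _ e₁ e₂ e₃ e₄ => e₁.rate + e₂.rate + e₃.rate + e₄.rate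
  | .measure e₁ e₂ e₃ => e₁.rate + e₂.rate + e₃.rate
  | .query e₁ e₂ => e₁.rate + e₂.rate
  | .hide e₁ e₂ => e₁.rate + e₂.rate

open Polynomial in
/-- The number of steps of a program all of whose loops are iterated at most `X` times. -/
noncomputable def Com.steps : Com → ℕ[X]
  | .seq c₁ c₂ => 1 + c₁.steps + c₂.steps
  | .ite _ c₁ c₂ => 1 + c₁.steps + c₂.steps
  | .loop _ c => (X + 1) * (c.steps + 1)
  | _ => 1

/-! ## A program logic

The judgement `F.Ends r s T v`: if the programs in the list `r` are executed from the state `s` on,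
then they halt after at most `T` steps, and the expected score at the end is at least `v`. -/

/-- The state of the machine. -/
structure State where
  reg : ℕ → ℕ
  ket : Ket
  calls : ℕ

/-- The data that are fixed during the analysis of a program: the oracles, a bound for the rates of
programs, a bound for the numbers of digits in the registers, and for the numbers of iterations of
loops, a score for final states, and the layout of the memory: the address `org` of the working
memory, and the contents `tbl` of the registers below it. -/
structure Frame where
  oracles : Oracles
  rate : ℕ
  bound : ℕ
  score : (ℕ → ℕ) → Ket → ℝ
  org : ℕ
  tbl : ℕ → ℕ

/-- The configuration with given list of programs, state, and time. -/
def State.config (s : State) (r : List Com) (t : ℕ) : Config := ⟨r, s.reg, s.ket, t, s.calls⟩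

theorem run_succ_of_todo_eq_nil {O : Oracles} : ∀ (n : ℕ) (σ : Config),
    (∀ σ' ∈ run O n σ, σ'.todo = []) → run O (n + 1) σ = run O n σ
  | 0, σ, h => by
    have : σ.todo = [] := h σ (by simp [run])
    simp [run, step, this]
  | n + 1, σ, h => by
    rw [run, run, List.flatMap_congr]
    intro τ hτ
    refine run_succ_of_todo_eq_nil n τ fun σ' hσ' => h σ' ?_
    rw [run, List.mem_flatMap]
    exact ⟨τ, hτ, hσ'⟩

/-- Halted configurations step to themselves. This makes it possible to wait for the slower of the
two branches of a measurement. -/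
theorem run_eq_of_le {O : Oracles} {n n' : ℕ} {σ : Config}
    (h : ∀ σ' ∈ run O n σ, σ'.todo = []) (hn : n ≤ n') : run O n' σ = run O n σ := by
  induction n', hn using Nat.le_induction with
  | base => rfl
  | succ k hk ih => rw [run_succ_of_todo_eq_nil k σ (by rw [ih]; exact h), ih]

/-! ### Rules for single commands -/

namespace Frame

variable {F : Frame}

/-- A bound for the time of one step. -/
def unit (F : Frame) : ℕ := 1 + F.rate * (F.bound + 1) + F.bound + F.oracles.price

/-- If the programs in `r` are executed from the state `s` on, then they halt after at most `T` steps,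
and the expected score at the end is at least `v`. -/
def Ends (F : Frame) (r : List Com) (s : State) (T : ℕ) (v : ℝ) : Prop :=
  (∀ c ∈ r, c.rate ≤ F.rate) → (∀ a, s.reg a < 2 ^ F.bound) → ∀ t, ∃ n,
    (∀ σ ∈ run F.oracles n (s.config r t), σ.todo = [] ∧ σ.time ≤ t + T * F.unit) ∧
    v ≤ ((run F.oracles n (s.config r t)).map fun σ => F.score σ.reg σ.ket).sum

theorem Ends.mono {r : List Com} {s : State} {T T' : ℕ} {v v' : ℝ} (h : F.Ends r s T v)
    (hT : T ≤ T') (hv : v' ≤ v) : F.Ends r s T' v' := fun h₁ h₂ t => by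
  obtain ⟨n, hn, hv'⟩ := h h₁ h₂ t
  exact ⟨n, fun σ hσ => ⟨(hn σ hσ).1, (hn σ hσ).2.trans (by gcongr)⟩, hv.trans hv'⟩

theorem Ends.nil {s : State} {T : ℕ} : F.Ends [] s T (F.score s.reg s.ket) := fun _ _ t =>
  ⟨0, by simp [run, State.config]⟩

/-- Deterministic steps. -/
theorem Ends.of_step {c : Com} {r r' : List Com} {s s' : State} {T : ℕ} {v : ℝ}
    (h : F.Ends r' s' T v)
    (hstep : c.rate ≤ F.rate → (∀ a, s.reg a < 2 ^ F.bound) → ∃ u ≤ F.unit,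
      ∀ t, step F.oracles (s.config (c :: r) t) = [s'.config r' (t + u)])
    (hr : c.rate ≤ F.rate → (∀ c ∈ r, c.rate ≤ F.rate) → ∀ c ∈ r', c.rate ≤ F.rate)
    (hs : (∀ a, s.reg a < 2 ^ F.bound) → ∀ a, s'.reg a < 2 ^ F.bound) :
    F.Ends (c :: r) s (T + 1) v := fun h₁ h₂ t => by
  obtain ⟨u, hu, hstep⟩ := hstep (h₁ c (by simp)) h₂
  obtain ⟨n, hn, hv⟩ := h (hr (h₁ c (by simp)) fun c hc => h₁ c (by simp [hc])) (hs h₂) (t + u)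
  have : run F.oracles (n + 1) (s.config (c :: r) t) = run F.oracles n (s'.config r' (t + u)) := by
    simp [run, hstep]
  refine ⟨n + 1, ?_, ?_⟩
  · rw [this]
    refine fun σ hσ => ⟨(hn σ hσ).1, (hn σ hσ).2.trans ?_⟩
    rw [add_mul]; omega
  · rw [this]; exact hv

/-- The summand `k` stands for the price of a gate beyond its expressions: the precision of a phase
gate, the width of an arithmetic gate, and zero for most other commands. -/
theorem cost_le_unit {c r k : ℕ} (hr : r ≤ F.rate)
    (hc : c ≤ r * (F.bound + 1)) (hk : k ≤ F.bound) : 1 + c + k ≤ F.unit := by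
  have : r * (F.bound + 1) ≤ F.rate * (F.bound + 1) := Nat.mul_le_mul_right _ hr
  unfold unit; omega

theorem Ends.skip {r : List Com} {s : State} {T : ℕ} {v : ℝ} (h : F.Ends r s T v) :
    F.Ends (.skip :: r) s (T + 1) v := by
  refine Ends.of_step h (fun _ _ => ⟨1, by unfold unit; omega, fun t => rfl⟩) ?_ ?_
  · exact fun _ h => h
  · exact fun h => h

theorem Ends.seq {c₁ c₂ : Com} {r : List Com} {s : State} {T : ℕ} {v : ℝ}
    (h : F.Ends (c₁ :: c₂ :: r) s T v) : F.Ends (.seq c₁ c₂ :: r) s (T + 1) v := by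
  refine Ends.of_step h (fun _ _ => ⟨1, by unfold unit; omega, fun t => rfl⟩) ?_ ?_
  · simp only [Com.rate, List.mem_cons, forall_eq_or_imp]
    exact fun h₁ h₂ => ⟨by omega, by omega, h₂⟩
  · exact fun h => h

theorem Ends.ite {e : Expr} {c₁ c₂ : Com} {r : List Com} {s : State} {T : ℕ} {v : ℝ}
    (h : F.Ends ((if e.val s.reg ≠ 0 then c₁ else c₂) :: r) s T v) :
    F.Ends (.ite e c₁ c₂ :: r) s (T + 1) v := by
  refine Ends.of_step h (fun h₁ h₂ => ⟨1 + e.cost s.reg + 0, cost_le_unit h₁ ?_ (by omega),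
    fun t => by by_cases he : e.val s.reg = 0 <;> simp [step, State.config, add_assoc, he]⟩) ?_ ?_
  · have := e.cost_le h₂
    simp only [Com.rate]; nlinarith
  · simp only [Com.rate, List.mem_cons, forall_eq_or_imp]
    exact fun h₁ h₂ => ⟨by split_ifs <;> omega, h₂⟩
  · exact fun h => h

theorem Ends.loop {e : Expr} {c : Com} {r : List Com} {s : State} {T : ℕ} {v : ℝ}
    (h : F.Ends (if e.val s.reg ≠ 0 then c :: .loop e c :: r else r) s T v) :
    F.Ends (.loop e c :: r) s (T + 1) v := by
  refine Ends.of_step h (fun h₁ h₂ => ⟨1 + e.cost s.reg + 0, cost_le_unit h₁ ?_ (by omega),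
    fun t => by by_cases he : e.val s.reg = 0 <;> simp [step, State.config, add_assoc, he]⟩) ?_ ?_
  · have := e.cost_le h₂
    simp only [Com.rate]; nlinarith
  · intro h₁ h₂
    split_ifs
    · simp only [List.mem_cons, forall_eq_or_imp]
      refine ⟨?_, h₁, h₂⟩
      simp only [Com.rate] at h₁; omega
    · exact h₂
  · exact fun h => h

theorem Ends.assign {e₁ e₂ : Expr} {r : List Com} {s : State} {T : ℕ} {v : ℝ}
    (hb : e₂.val s.reg < 2 ^ F.bound)
    (h : F.Ends r ⟨Function.update s.reg (e₁.val s.reg) (e₂.val s.reg), s.ket, s.calls⟩ T v) :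
    F.Ends (.assign e₁ e₂ :: r) s (T + 1) v := by
  refine Ends.of_step h (fun h₁ h₂ => ⟨1 + (e₁.cost s.reg + e₂.cost s.reg) + 0,
    cost_le_unit h₁ ?_ (by omega), fun t => ?_⟩) ?_ ?_
  · have h₁ := e₁.cost_le h₂
    have h₂ := e₂.cost_le h₂
    simp only [Com.rate]; nlinarith
  · simp [step, State.config, add_assoc]
  · exact fun _ h => h
  · intro h a
    by_cases ha : a = e₁.val s.reg
    · simp [ha, hb]
    · simp [ha, h]

theorem Ends.hadamard {e₁ e₂ : Expr} {r : List Com} {s : State} {T : ℕ} {v : ℝ}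
    (h : F.Ends r ⟨s.reg, extend (hadamardK (e₁.val s.reg) (e₂.val s.reg)) s.ket, s.calls⟩ T v) :
    F.Ends (.hadamard e₁ e₂ :: r) s (T + 1) v := by
  refine Ends.of_step h (fun h₁ h₂ => ⟨1 + (e₁.cost s.reg + e₂.cost s.reg) + 0,
    cost_le_unit h₁ ?_ (by omega), fun t => ?_⟩) (fun _ h => h) (fun h => h)
  · have h₁ := e₁.cost_le h₂
    have h₂ := e₂.cost_le h₂
    simp only [Com.rate]; nlinarith
  · simp [step, State.config, add_assoc]

theorem Ends.phase {e₁ e₂ e₃ : Expr} {r : List Com} {s : State} {T : ℕ} {v : ℝ}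
    (hb : e₃.val s.reg ≤ F.bound)
    (h : F.Ends r ⟨s.reg, extend (phaseK (e₁.val s.reg) (e₂.val s.reg) (e₃.val s.reg)) s.ket,
      s.calls⟩ T v) :
    F.Ends (.phase e₁ e₂ e₃ :: r) s (T + 1) v := by
  refine Ends.of_step h (fun h₁ h₂ => ⟨1 + (e₁.cost s.reg + e₂.cost s.reg + e₃.cost s.reg) +
    e₃.val s.reg, cost_le_unit h₁ ?_ hb, fun t => ?_⟩) (fun _ h => h) (fun h => h)
  · have h₁ := e₁.cost_le h₂
    have h₃ := e₃.cost_le h₂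
    have h₂ := e₂.cost_le h₂
    simp only [Com.rate]; nlinarith
  · simp [step, State.config, add_assoc]

theorem Ends.load {e₁ e₂ : Expr} {r : List Com} {s : State} {T : ℕ} {v : ℝ}
    (h : F.Ends r ⟨s.reg, extend (loadK (e₁.val s.reg) (e₂.val s.reg)) s.ket, s.calls⟩ T v) :
    F.Ends (.load e₁ e₂ :: r) s (T + 1) v := by
  refine Ends.of_step h (fun h₁ h₂ => ⟨1 + (e₁.cost s.reg + e₂.cost s.reg) + 0,
    cost_le_unit h₁ ?_ (by omega), fun t => ?_⟩) (fun _ h => h) (fun h => h)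
  · have h₁ := e₁.cost_le h₂
    have h₂ := e₂.cost_le h₂
    simp only [Com.rate]; nlinarith
  · simp [step, State.config, add_assoc]

theorem Ends.arith {o : Arith} {e₁ e₂ e₃ e₄ : Expr} {r : List Com} {s : State} {T : ℕ} {v : ℝ}
    (hb : e₄.val s.reg ≤ F.bound)
    (h : F.Ends r ⟨s.reg, extend (arithK o (e₁.val s.reg) (e₂.val s.reg) (e₃.val s.reg)
      (e₄.val s.reg)) s.ket, s.calls⟩ T v) :
    F.Ends (.arith o e₁ e₂ e₃ e₄ :: r) s (T + 1) v := by
  refine Ends.of_step h (fun h₁ h₂ => ⟨1 + (e₁.cost s.reg + e₂.cost s.reg + e₃.cost s.reg +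
    e₄.cost s.reg) + e₄.val s.reg, cost_le_unit h₁ ?_ hb, fun t => ?_⟩)
    (fun _ h => h) (fun h => h)
  · have h₁ := e₁.cost_le h₂
    have h₃ := e₃.cost_le h₂
    have h₄ := e₄.cost_le h₂
    have h₂ := e₂.cost_le h₂
    simp only [Com.rate]; nlinarith
  · simp [step, State.config, add_assoc]

theorem Ends.query {e₁ e₂ : Expr} {r : List Com} {s : State} {T : ℕ} {v : ℝ}
    (h : F.Ends r ⟨s.reg, extend (queryK F.oracles (e₁.val s.reg) (e₂.val s.reg)) s.ket,
      s.calls⟩ T v) :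
    F.Ends (.query e₁ e₂ :: r) s (T + 1) v := by
  refine Ends.of_step h (fun h₁ h₂ => ⟨1 + (e₁.cost s.reg + e₂.cost s.reg) + 0,
    cost_le_unit h₁ ?_ (by omega), fun t => ?_⟩) (fun _ h => h) (fun h => h)
  · have h₁ := e₁.cost_le h₂
    have h₂ := e₂.cost_le h₂
    simp only [Com.rate]; nlinarith
  · simp [step, State.config, add_assoc]

theorem Ends.hide {e₁ e₂ : Expr} {r : List Com} {s : State} {T : ℕ} {v : ℝ}
    (h : F.Ends r ⟨s.reg, extend (hideK F.oracles s.calls (e₁.val s.reg) (e₂.val s.reg)) s.ket,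
      s.calls + 1⟩ T v) :
    F.Ends (.hide e₁ e₂ :: r) s (T + 1) v := by
  refine Ends.of_step h (fun h₁ h₂ => ⟨1 + (e₁.cost s.reg + e₂.cost s.reg) + F.oracles.price,
    ?_, fun t => ?_⟩) (fun _ h => h) (fun h => h)
  · have h₁' := e₁.cost_le h₂
    have h₂' := e₂.cost_le h₂
    have := Nat.mul_le_mul_right (F.bound + 1) h₁
    simp only [Com.rate, add_mul] at this
    unfold unit; omega
  · simp [step, State.config, add_assoc]

/-- The projected states are not renormalized, so their norms already contain the probabilities of
the outcomes and the scores of the branches are added without weights. -/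
theorem Ends.measure {e₁ e₂ e₃ : Expr} {r : List Com} {s : State} {T : ℕ} {v : Bool → ℝ}
    (hb : 1 ≤ F.bound)
    (h : ∀ x : Bool, F.Ends r ⟨Function.update s.reg (e₃.val s.reg) x.toNat,
      extend (measureK (e₁.val s.reg) (e₂.val s.reg) x) s.ket, s.calls⟩ T (v x)) :
    F.Ends (.measure e₁ e₂ e₃ :: r) s (T + 1) (v false + v true) := fun h₁ h₂ t => by
  set u := 1 + (e₁.cost s.reg + e₂.cost s.reg + e₃.cost s.reg)
  have hu : u ≤ F.unit := by
    have h₁ := h₁ _ List.mem_cons_self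
    refine cost_le_unit h₁ (k := 0) ?_ (by omega)
    have h₁ := e₁.cost_le h₂
    have h₃ := e₃.cost_le h₂
    have h₂ := e₂.cost_le h₂
    simp only [Com.rate]; nlinarith
  have hs (x : Bool) : ∀ a, Function.update s.reg (e₃.val s.reg) x.toNat a < 2 ^ F.bound := by
    intro a
    by_cases ha : a = e₃.val s.reg
    · rw [ha, Function.update_self]
      have : 2 ^ 1 ≤ 2 ^ F.bound := Nat.pow_le_pow_right (by omega) hb
      have := Bool.toNat_le x
      omega
    · simp [ha, h₂]
  have h' (x : Bool) := h x (fun c hc => h₁ c (by simp [hc])) (hs x) (t + u)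
  obtain ⟨n₀, hn₀, hv₀⟩ := h' false
  obtain ⟨n₁, hn₁, hv₁⟩ := h' true
  have e₀ := run_eq_of_le (fun σ hσ => (hn₀ σ hσ).1) (le_max_left n₀ n₁)
  have e₁ := run_eq_of_le (fun σ hσ => (hn₁ σ hσ).1) (le_max_right n₀ n₁)
  rw [← e₀] at hn₀ hv₀
  rw [← e₁] at hn₁ hv₁
  refine ⟨max n₀ n₁ + 1, ?_⟩
  simp only [run, step, State.config, List.map_cons, List.map_nil, List.flatMap_cons,
    List.flatMap_nil, List.append_nil, List.mem_append, List.map_append, List.sum_append]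
  constructor
  · have key (σ : Config) (hT : σ.todo = [] ∧ σ.time ≤ t + u + T * F.unit) :
        σ.todo = [] ∧ σ.time ≤ t + (T + 1) * F.unit :=
      ⟨hT.1, hT.2.trans (by rw [add_mul]; omega)⟩
    rintro σ (hσ | hσ)
    · refine key σ (hn₀ σ ?_)
      simpa [State.config, u, add_assoc] using hσ
    · refine key σ (hn₁ σ ?_)
      simpa [State.config, u, add_assoc] using hσ
  · refine add_le_add ?_ ?_
    · simpa [State.config, u, add_assoc] using hv₀
    · simpa [State.config, u, add_assoc] using hv₁

end Frame
end QRam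

namespace QRam

/-! ## The working memory: named arrays -/

instance (n : ℕ) : OfNat Expr n := ⟨.const n⟩
instance : Add Expr := ⟨.op .add⟩
instance : Sub Expr := ⟨.op .sub⟩
instance : Mul Expr := ⟨.op .mul⟩
instance : Div Expr := ⟨.op .div⟩
instance : Mod Expr := ⟨.op .mod⟩

@[simp] theorem Expr.val_ofNat (R : ℕ → ℕ) (n : ℕ) :
    (ofNat(n) : Expr).val R = ofNat(n) := rfl
@[simp] theorem Expr.val_const (R : ℕ → ℕ) (n : ℕ) : (Expr.const n).val R = n := rfl
@[simp] theorem Expr.val_reg (R : ℕ → ℕ) (e : Expr) : (Expr.reg e).val R = R (e.val R) := rfl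
@[simp] theorem Expr.val_add (R : ℕ → ℕ) (a b : Expr) : (a + b).val R = a.val R + b.val R := rfl
@[simp] theorem Expr.val_sub (R : ℕ → ℕ) (a b : Expr) : (a - b).val R = a.val R - b.val R := rfl
@[simp] theorem Expr.val_mul (R : ℕ → ℕ) (a b : Expr) : (a * b).val R = a.val R * b.val R := rfl
@[simp] theorem Expr.val_div (R : ℕ → ℕ) (a b : Expr) : (a / b).val R = a.val R / b.val R := rfl
@[simp] theorem Expr.val_mod (R : ℕ → ℕ) (a b : Expr) : (a % b).val R = a.val R % b.val R := rfl

/-- The names of the arrays in the working memory. -/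
inductive Name
  | p | m | d | n | N | base | r | i | j | l | y | e | bit | k | t | piv
  | U | B | S | row | V | tmp | out

/-- The number of a name. -/
def Name.code : Name → ℕ
  | p => 0 | m => 1 | d => 2 | n => 3 | N => 4 | base => 5 | r => 6 | i => 7 | j => 8 | l => 9
  | y => 10 | e => 11 | bit => 12 | k => 13 | t => 14 | piv => 15 | U => 16 | B => 17 | S => 18
  | row => 19 | V => 20 | tmp => 21 | out => 22

/-- The name with a given number. -/
def Name.ofCode : ℕ → Name
  | 0 => p | 1 => m | 2 => d | 3 => n | 4 => N | 5 => base | 6 => r | 7 => i | 8 => j | 9 => l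
  | 10 => y | 11 => e | 12 => bit | 13 => k | 14 => t | 15 => piv | 16 => U | 17 => B | 18 => S
  | 19 => row | 20 => V | 21 => tmp | _ => out

theorem Name.ofCode_code (x : Name) : ofCode x.code = x := by cases x <;> rfl

theorem Name.code_lt (x : Name) : x.code < 23 := by cases x <;> decide

theorem Name.code_ofCode {i : ℕ} (h : i < 23) : (ofCode i).code = i := by
  interval_cases i <;> rfl

instance : DecidableEq Name := fun a b =>
  decidable_of_iff (a.code = b.code)
    ⟨fun h => by rw [← a.ofCode_code, h, b.ofCode_code], fun h => by rw [h]⟩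

/-- Contents of the working memory. -/
abbrev Mem := Name → ℕ → ℕ

/-- Write `v` to the entry `i` of the array `x`. -/
def Mem.set (M : Mem) (x : Name) (i v : ℕ) : Mem := Function.update M x (Function.update (M x) i v)

@[simp] theorem Mem.set_same (M : Mem) (x : Name) (i v : ℕ) :
    M.set x i v x = Function.update (M x) i v := by simp [set]

@[simp] theorem Mem.set_ne (M : Mem) {x x' : Name} (i v : ℕ) (h : x' ≠ x) :
    M.set x i v x' = M x' := by
  simp [set, h]

theorem Mem.set_apply (M : Mem) (x x' : Name) (i j v : ℕ) :
    M.set x i v x' j = if x' = x ∧ j = i then v else M x' j := by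
  by_cases h : x' = x
  · subst h; simp [Function.update_apply]
  · simp [h]

/-- `M'` differs from `M` at most in the arrays in `l`. -/
def Mem.Agree (l : List Name) (M M' : Mem) : Prop := ∀ x ∉ l, M' x = M x

theorem Mem.Agree.refl (l : List Name) (M : Mem) : Agree l M M := fun _ _ => rfl

theorem Mem.Agree.trans {l l' : List Name} {M M' M'' : Mem} (h : Agree l M M')
    (h' : Agree l' M' M'') (hl : l' ⊆ l) : Agree l M M'' := fun x hx => by
  rw [h' x fun h => hx (hl h), h x hx]

theorem Mem.Agree.set {l : List Name} {M M' : Mem} (h : Agree l M M') {x : Name} (hx : x ∈ l)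
    (i v : ℕ) : Agree l M (M'.set x i v) := fun x' hx' => by
  rw [set_ne _ _ _ (by rintro rfl; exact hx' hx), h x' hx']

/-- The address of an entry of an array in the working memory. -/
def adr (x : Name) (e : Expr) : Expr := .reg 0 + (23 * e + .const x.code)

/-- The entry of an array in the working memory. -/
def ix (x : Name) (e : Expr) : Expr := .reg (adr x e)

/-- A variable: the entry `0` of an array. -/
def var (x : Name) : Expr := ix x 0

/-- Write to the entry of an array in the working memory. -/
def put (x : Name) (e src : Expr) : Com := .assign (adr x e) src

/-- Execute `c` once for each value of the variable `x` from `e - 1` down to `0`. -/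
def forDown (x : Name) (e : Expr) (c : Com) : Com :=
  .seq (put x 0 e) (.loop (var x) (.seq (put x 0 (var x - 1)) c))

namespace Frame

variable {F : Frame}

/-- The contents of the registers that represent given contents of the working memory. -/
def enc (F : Frame) (M : Mem) : ℕ → ℕ := fun a =>
  if a = 0 then F.org else if a < F.org then F.tbl a else
    M (.ofCode ((a - F.org) % 23)) ((a - F.org) / 23)

/-- The state with given contents of the working memory. -/
def st (F : Frame) (M : Mem) (ψ : Ket) (k : ℕ) : State := ⟨F.enc M, ψ, k⟩

theorem enc_zero (M : Mem) : F.enc M 0 = F.org := by simp [enc]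

theorem enc_tbl (M : Mem) {a : ℕ} (h : 0 < a) (h' : a < F.org) : F.enc M a = F.tbl a := by
  simp [enc, h.ne', h']

theorem val_adr (M : Mem) (x : Name) (e : Expr) :
    (adr x e).val (F.enc M) = F.org + (23 * e.val (F.enc M) + x.code) := by
  simp [adr, enc_zero]

/-- The 23 arrays are interleaved with stride 23 above `F.org`. No array needs a length, and
division with remainder recovers name and index from an address. -/
theorem enc_adr (M : Mem) (x : Name) (i : ℕ) (h : 0 < F.org) :
    F.enc M (F.org + (23 * i + x.code)) = M x i := by
  have h1 : (F.org + (23 * i + x.code) - F.org) % 23 = x.code := by have := x.code_lt; omega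
  have h2 : (F.org + (23 * i + x.code) - F.org) / 23 = i := by have := x.code_lt; omega
  rw [enc, if_neg (by omega), if_neg (by omega), h1, h2, Name.ofCode_code]

theorem enc_set (M : Mem) (x : Name) (i v : ℕ) (h : 0 < F.org) :
    Function.update (F.enc M) (F.org + (23 * i + x.code)) v = F.enc (M.set x i v) := by
  funext a
  by_cases ha : a = F.org + (23 * i + x.code)
  · rw [ha, Function.update_self, enc_adr _ _ _ h, Mem.set_same, Function.update_self]
  · rw [Function.update_of_ne ha]
    unfold enc
    split_ifs with h1 h2
    · rfl
    · rfl
    · rw [Mem.set_apply, if_neg]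
      rintro ⟨h3, h4⟩
      apply ha
      have := Name.code_ofCode (i := (a - F.org) % 23) (by omega)
      rw [h3] at this
      omega

/-- Frames whose working memory does not contain the register `0`, and that allow for at least one
digit in the registers. -/
class Valid (F : Frame) : Prop where
  org_pos : 0 < F.org
  bound_pos : 1 ≤ F.bound

variable [F.Valid]

@[simp] theorem val_ix (M : Mem) (x : Name) (e : Expr) :
    (ix x e).val (F.enc M) = M x (e.val (F.enc M)) := by
  rw [ix, Expr.val_reg, val_adr, enc_adr _ _ _ Valid.org_pos]

@[simp] theorem val_var (M : Mem) (x : Name) : (var x).val (F.enc M) = M x 0 := by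
  simp [var]

omit [F.Valid] in
/-- From the given state on, the program `c` leads to states with the property `Q` only; if `g` is a
lower bound for the expected score from these states on, then `v` is a lower bound for the expected
score from the given state on. -/
def Tr (F : Frame) (c : Com) (M : Mem) (ψ : Ket) (k : ℕ) (Q : Mem → Ket → ℕ → Prop)
    (g : Mem → Ket → ℕ → ℝ) (v : ℝ) : Prop :=
  ∀ r T, (∀ M' ψ' k', Q M' ψ' k' → F.Ends r (F.st M' ψ' k') T (g M' ψ' k')) →
    F.Ends (c :: r) (F.st M ψ k) (T + c.steps.eval F.bound) v

omit [F.Valid] in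
/-- The program `c` leads to a state with the property `Q`. -/
def Det (F : Frame) (c : Com) (M : Mem) (ψ : Ket) (k : ℕ) (Q : Mem → Ket → ℕ → Prop) : Prop :=
  ∀ v, F.Tr c M ψ k Q (fun _ _ _ => v) v

omit [F.Valid] in
/-- The program `c` changes only the working memory, and leads to contents with the
property `Q`. -/
def Cl (F : Frame) (c : Com) (M : Mem) (Q : Mem → Prop) : Prop :=
  ∀ ψ k, F.Det c M ψ k fun M' ψ' k' => Q M' ∧ ψ' = ψ ∧ k' = k

/-! ### Rules for programs on the working memory -/

section rules

variable {c c₁ c₂ : Com} {M : Mem} {ψ : Ket} {k : ℕ} {Q Q' Q₁ Q₂ : Mem → Ket → ℕ → Prop}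
  {g g' g₁ g₂ : Mem → Ket → ℕ → ℝ} {v v' : ℝ} {P P' P₁ P₂ : Mem → Prop}

omit [F.Valid]

theorem Tr.mono (h : F.Tr c M ψ k Q g v)
    (hg : ∀ M' ψ' k', Q M' ψ' k' → Q' M' ψ' k' ∧ g M' ψ' k' ≤ g' M' ψ' k') (hv : v' ≤ v) :
    F.Tr c M ψ k Q' g' v' := fun r T hr =>
  (h r T fun M' ψ' k' hQ =>
    (hr M' ψ' k' (hg _ _ _ hQ).1).mono le_rfl (hg _ _ _ hQ).2).mono le_rfl hv

theorem Det.tr (h : F.Det c M ψ k Q)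
    (hg : ∀ M' ψ' k', Q M' ψ' k' → Q' M' ψ' k' ∧ v ≤ g M' ψ' k') : F.Tr c M ψ k Q' g v :=
  (h v).mono hg le_rfl

theorem Det.mono (h : F.Det c M ψ k Q) (hQ : ∀ M' ψ' k', Q M' ψ' k' → Q' M' ψ' k') :
    F.Det c M ψ k Q' := fun v => (h v).mono (fun _ _ _ h => ⟨hQ _ _ _ h, le_rfl⟩) le_rfl

theorem Cl.mono (h : F.Cl c M P) (hP : ∀ M', P M' → P' M') : F.Cl c M P' := fun ψ k =>
  (h ψ k).mono fun _ _ _ h => ⟨hP _ h.1, h.2⟩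

/-- `Tr` is stated for all continuations `r`, so sequencing is substitution: `g₁` is guaranteed by
the second program and consumed by the first. -/
theorem Tr.seq (h₁ : F.Tr c₁ M ψ k Q₁ g₁ v)
    (h₂ : ∀ M' ψ' k', Q₁ M' ψ' k' → F.Tr c₂ M' ψ' k' Q g (g₁ M' ψ' k')) :
    F.Tr (.seq c₁ c₂) M ψ k Q g v := fun r T hr =>
  (Ends.seq (h₁ _ _ fun M' ψ' k' h => h₂ M' ψ' k' h r T hr)).mono
    (by simp only [Com.steps, Polynomial.eval_add, Polynomial.eval_one]; omega) le_rfl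

theorem Det.seq (h₁ : F.Det c₁ M ψ k Q₁) (h₂ : ∀ M' ψ' k', Q₁ M' ψ' k' → F.Det c₂ M' ψ' k' Q) :
    F.Det (.seq c₁ c₂) M ψ k Q := fun v => (h₁ v).seq fun M' ψ' k' h => h₂ M' ψ' k' h v

theorem Cl.seq (h₁ : F.Cl c₁ M P₁) (h₂ : ∀ M', P₁ M' → F.Cl c₂ M' P) :
    F.Cl (.seq c₁ c₂) M P := fun ψ k => (h₁ ψ k).seq fun M' ψ' k' ⟨h, h', h''⟩ => by
  subst h' h''; exact h₂ M' h _ _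

theorem Det.skip (h : Q M ψ k) : F.Det .skip M ψ k Q := fun _ r T hr =>
  (Ends.skip (hr _ _ _ h)).mono (by simp [Com.steps]) le_rfl

theorem Cl.skip (h : P M) : F.Cl .skip M P := fun _ _ => Det.skip ⟨h, rfl, rfl⟩

theorem Tr.ite {e : Expr} (h₁ : e.val (F.enc M) ≠ 0 → F.Tr c₁ M ψ k Q g v)
    (h₂ : e.val (F.enc M) = 0 → F.Tr c₂ M ψ k Q g v) : F.Tr (.ite e c₁ c₂) M ψ k Q g v :=
  fun r T hr => by
  by_cases h : e.val (F.enc M) = 0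
  · refine (Ends.ite (T := T + c₂.steps.eval F.bound) ?_).mono (by
      simp only [Com.steps, Polynomial.eval_add, Polynomial.eval_one]; omega) le_rfl
    simpa [st, h] using h₂ h r T hr
  · refine (Ends.ite (T := T + c₁.steps.eval F.bound) ?_).mono (by
      simp only [Com.steps, Polynomial.eval_add, Polynomial.eval_one]; omega) le_rfl
    simpa [st, h] using h₁ h r T hr

theorem Det.ite {e : Expr} (h₁ : e.val (F.enc M) ≠ 0 → F.Det c₁ M ψ k Q)
    (h₂ : e.val (F.enc M) = 0 → F.Det c₂ M ψ k Q) : F.Det (.ite e c₁ c₂) M ψ k Q :=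
  fun v => Tr.ite (fun h => h₁ h v) fun h => h₂ h v

theorem Cl.ite {e : Expr} (h₁ : e.val (F.enc M) ≠ 0 → F.Cl c₁ M P)
    (h₂ : e.val (F.enc M) = 0 → F.Cl c₂ M P) : F.Cl (.ite e c₁ c₂) M P :=
  fun ψ k => Det.ite (fun h => h₁ h ψ k) fun h => h₂ h ψ k

theorem Det.hadamard {e₁ e₂ : Expr}
    (h : Q M (extend (hadamardK (e₁.val (F.enc M)) (e₂.val (F.enc M))) ψ) k) :
    F.Det (.hadamard e₁ e₂) M ψ k Q := fun _ r T hr =>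
  (Ends.hadamard (hr _ _ _ h)).mono (by simp [Com.steps]) le_rfl

theorem Det.phase {e₁ e₂ e₃ : Expr} (hb : e₃.val (F.enc M) ≤ F.bound)
    (h : Q M (extend (phaseK (e₁.val (F.enc M)) (e₂.val (F.enc M)) (e₃.val (F.enc M))) ψ) k) :
    F.Det (.phase e₁ e₂ e₃) M ψ k Q := fun _ r T hr =>
  (Ends.phase hb (hr _ _ _ h)).mono (by simp [Com.steps]) le_rfl

theorem Det.load {e₁ e₂ : Expr}
    (h : Q M (extend (loadK (e₁.val (F.enc M)) (e₂.val (F.enc M))) ψ) k) :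
    F.Det (.load e₁ e₂) M ψ k Q := fun _ r T hr =>
  (Ends.load (hr _ _ _ h)).mono (by simp [Com.steps]) le_rfl

theorem Det.arith {o : Arith} {e₁ e₂ e₃ e₄ : Expr} (hb : e₄.val (F.enc M) ≤ F.bound)
    (h : Q M (extend (arithK o (e₁.val (F.enc M)) (e₂.val (F.enc M)) (e₃.val (F.enc M))
      (e₄.val (F.enc M))) ψ) k) :
    F.Det (.arith o e₁ e₂ e₃ e₄) M ψ k Q := fun _ r T hr =>
  (Ends.arith hb (hr _ _ _ h)).mono (by simp [Com.steps]) le_rfl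

theorem Det.query {e₁ e₂ : Expr}
    (h : Q M (extend (queryK F.oracles (e₁.val (F.enc M)) (e₂.val (F.enc M))) ψ) k) :
    F.Det (.query e₁ e₂) M ψ k Q := fun _ r T hr =>
  (Ends.query (hr _ _ _ h)).mono (by simp [Com.steps]) le_rfl

theorem Det.hide {e₁ e₂ : Expr}
    (h : Q M (extend (hideK F.oracles k (e₁.val (F.enc M)) (e₂.val (F.enc M))) ψ) (k + 1)) :
    F.Det (.hide e₁ e₂) M ψ k Q := fun _ r T hr =>
  (Ends.hide (hr _ _ _ h)).mono (by simp [Com.steps]) le_rfl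

/-- Here `i` is the number of iterations still to come, which the invariant must determine. The
functions `g i` play the role of a submartingale: one pass through the body has to turn the
guarantee `g i` into `g (i + 1)`. -/
theorem Tr.loop {e : Expr} (I : ℕ → Mem → Ket → ℕ → Prop) (g : ℕ → Mem → Ket → ℕ → ℝ)
    (he : ∀ i M ψ k, I i M ψ k → (e.val (F.enc M) = 0 ↔ i = 0))
    (hc : ∀ i M ψ k, I (i + 1) M ψ k → F.Tr c M ψ k (I i) (g i) (g (i + 1) M ψ k))
    {n : ℕ} (hn : n ≤ F.bound) (h : I n M ψ k) :
    F.Tr (.loop e c) M ψ k (I 0) (g 0) (g n M ψ k) := fun r T hr => by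
  have key : ∀ n M ψ k, I n M ψ k →
      F.Ends (.loop e c :: r) (F.st M ψ k) (T + (n * (c.steps.eval F.bound + 1) + 1))
        (g n M ψ k) := by
    intro n
    induction n with
    | zero =>
      intro M ψ k h
      refine (Ends.loop (T := T) ?_).mono (by omega) le_rfl
      simpa [st, (he _ _ _ _ h).2 rfl] using hr M ψ k h
    | succ n ih =>
      intro M ψ k h
      refine (Ends.loop (T := (T + (n * (c.steps.eval F.bound + 1) + 1)) + c.steps.eval F.bound)
        ?_).mono (by rw [add_mul]; omega) le_rfl
      have hne : e.val (F.enc M) ≠ 0 := fun h' => by simpa using (he _ _ _ _ h).1 h'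
      rw [if_pos (by exact hne)]
      exact hc n M ψ k h _ _ fun M' ψ' k' h' => ih M' ψ' k' h'
  refine (key n M ψ k h).mono ?_ le_rfl
  have := Nat.mul_le_mul_right (c.steps.eval F.bound + 1) hn
  simp only [Com.steps, Polynomial.eval_mul, Polynomial.eval_add, Polynomial.eval_X,
    Polynomial.eval_one]
  rw [add_mul]; omega

end rules

section rules

variable {c c₁ c₂ : Com} {M : Mem} {ψ : Ket} {k : ℕ} {Q Q₁ Q₂ : Mem → Ket → ℕ → Prop}
  {g g₁ g₂ : Mem → Ket → ℕ → ℝ} {v : ℝ} {P : Mem → Prop}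

theorem Cl.put {x : Name} {e src : Expr} (hb : src.val (F.enc M) < 2 ^ F.bound)
    (h : P (M.set x (e.val (F.enc M)) (src.val (F.enc M)))) : F.Cl (put x e src) M P :=
  fun ψ k v r T hr =>
  (Ends.assign hb (by
    have := hr _ ψ k ⟨h, rfl, rfl⟩
    simpa only [st, val_adr, enc_set _ _ _ _ (Valid.org_pos (F := F))] using this)).mono
    (by simp [QRam.put, Com.steps]) le_rfl

/-- Symbolic execution of an assignment. -/
theorem Cl.put_seq {x : Name} {e src : Expr} (hb : src.val (F.enc M) < 2 ^ F.bound)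
    (h : F.Cl c (M.set x (e.val (F.enc M)) (src.val (F.enc M))) P) :
    F.Cl (.seq (QRam.put x e src) c) M P :=
  (Cl.put (P := fun M' => M' = M.set x (e.val (F.enc M)) (src.val (F.enc M)))
    hb rfl).seq fun M' h' => by rw [h']; exact h

/-- Symbolic execution of an assignment. -/
theorem Tr.put_seq {x : Name} {e src : Expr} (hb : src.val (F.enc M) < 2 ^ F.bound)
    (h : F.Tr c (M.set x (e.val (F.enc M)) (src.val (F.enc M))) ψ k Q g v) :
    F.Tr (.seq (put x e src) c) M ψ k Q g v :=
  (Cl.put (P := fun M' => M' = M.set x (e.val (F.enc M)) (src.val (F.enc M)))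
    hb rfl ψ k v).seq fun M' ψ' k' ⟨h₁, h₂, h₃⟩ => by
    subst h₁ h₂ h₃; exact h

theorem Tr.measure {e₁ e₂ : Expr} {x : Name}
    (h : ∀ b : Bool, Q (M.set x 0 b.toNat)
      (extend (measureK (e₁.val (F.enc M)) (e₂.val (F.enc M)) b) ψ) k) :
    F.Tr (.measure e₁ e₂ (adr x 0)) M ψ k Q g
      (g (M.set x 0 0) (extend (measureK (e₁.val (F.enc M)) (e₂.val (F.enc M)) false) ψ) k +
        g (M.set x 0 1) (extend (measureK (e₁.val (F.enc M)) (e₂.val (F.enc M)) true) ψ) k) :=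
  fun r T hr =>
  (Ends.measure (v := fun b => g (M.set x 0 b.toNat)
    (extend (measureK (e₁.val (F.enc M)) (e₂.val (F.enc M)) b) ψ) k) Valid.bound_pos fun b => by
    have := hr _ _ _ (h b)
    simpa only [st, val_adr, enc_set _ _ _ _ (Valid.org_pos (F := F)), Expr.val_ofNat] using
      this).mono (by simp [Com.steps]) (by simp)

theorem Tr.forDown {x : Name} {e : Expr} (I : ℕ → Mem → Ket → ℕ → Prop)
    (g : ℕ → Mem → Ket → ℕ → ℝ) {n : ℕ} (hn : e.val (F.enc M) = n) (hb : n ≤ F.bound)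
    (h : I n (M.set x 0 n) ψ k)
    (hc : ∀ i < n, ∀ M ψ k, M x 0 = i + 1 → I (i + 1) M ψ k →
      F.Tr c (M.set x 0 i) ψ k (fun M' ψ' k' => M' x 0 = i ∧ I i M' ψ' k') (g i)
        (g (i + 1) M ψ k)) :
    F.Tr (forDown x e c) M ψ k (fun M' ψ' k' => M' x 0 = 0 ∧ I 0 M' ψ' k') (g 0)
      (g n (M.set x 0 n) ψ k) := by
  have hlt : n < 2 ^ F.bound := hb.trans_lt Nat.lt_two_pow_self
  refine Tr.put_seq (by rwa [hn]) ?_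
  rw [hn]
  refine (Tr.loop (n := n) (I := fun i M ψ k => M x 0 = i ∧ i ≤ n ∧ I i M ψ k) g ?_ ?_ hb ?_).mono
    (fun M' ψ' k' h => ⟨⟨h.1, h.2.2⟩, le_rfl⟩) le_rfl
  · rintro i M ψ k ⟨h, -⟩
    simp [h]
  · rintro i M ψ k ⟨h₁, h₂, h₃⟩
    have : (var x - 1).val (F.enc M) = i := by simp [h₁]
    refine Tr.put_seq ?_ ?_
    · rw [this]; omega
    · rw [this]
      exact (hc i h₂ M ψ k h₁ h₃).mono (fun M' ψ' k' h => ⟨⟨h.1, by omega, h.2⟩, le_rfl⟩) le_rfl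
  · simp [h]

theorem Det.forDown {x : Name} {e : Expr} (I : ℕ → Mem → Ket → ℕ → Prop) {n : ℕ}
    (hn : e.val (F.enc M) = n) (hb : n ≤ F.bound) (h : I n (M.set x 0 n) ψ k)
    (hc : ∀ i < n, ∀ M ψ k, M x 0 = i + 1 → I (i + 1) M ψ k →
      F.Det c (M.set x 0 i) ψ k (fun M' ψ' k' => M' x 0 = i ∧ I i M' ψ' k')) :
    F.Det (forDown x e c) M ψ k (fun M' ψ' k' => M' x 0 = 0 ∧ I 0 M' ψ' k') := fun v =>
  Tr.forDown I (fun _ _ _ _ => v) hn hb h fun i hi M ψ k h₁ h₂ => hc i hi M ψ k h₁ h₂ v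

theorem Cl.forDown {x : Name} {e : Expr} (I : ℕ → Mem → Prop) {n : ℕ}
    (hn : e.val (F.enc M) = n) (hb : n ≤ F.bound) (h : I n (M.set x 0 n))
    (hc : ∀ i < n, ∀ M, M x 0 = i + 1 → I (i + 1) M →
      F.Cl c (M.set x 0 i) (fun M' => M' x 0 = i ∧ I i M')) :
    F.Cl (forDown x e c) M (fun M' => M' x 0 = 0 ∧ I 0 M') := fun ψ k => by
  refine (Det.forDown (fun i M' ψ' k' => I i M' ∧ ψ' = ψ ∧ k' = k) hn hb ⟨h, rfl, rfl⟩ ?_).mono ?_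
  · rintro i hi M ψ k h₁ ⟨h₂, h₃, h₄⟩
    subst h₃ h₄
    exact (hc i hi M h₁ h₂ ψ k).mono (by tauto)
  · tauto

end rules

end Frame
end QRam

namespace QRam

/-! ## States of the quantum memory -/

theorem extend_eq (K : Basis → Ket) (ψ : Ket) : extend K ψ = Finsupp.linearCombination ℂ K ψ := rfl

theorem extend_single (K : Basis → Ket) (b : Basis) (α : ℂ) :
    extend K (Finsupp.single b α) = α • K b := by simp [extend_eq]

theorem extend_smul (K : Basis → Ket) (α : ℂ) (ψ : Ket) : extend K (α • ψ) = α • extend K ψ := by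
  simp [extend_eq]

theorem extend_add (K : Basis → Ket) (ψ φ : Ket) :
    extend K (ψ + φ) = extend K ψ + extend K φ := by
  simp [extend_eq]

theorem extend_sub (K : Basis → Ket) (ψ φ : Ket) :
    extend K (ψ - φ) = extend K ψ - extend K φ := by
  simp [extend_eq]

theorem extend_sum {ι : Type*} (K : Basis → Ket) (s : Finset ι) (ψ : ι → Ket) :
    extend K (∑ i ∈ s, ψ i) = ∑ i ∈ s, extend K (ψ i) := by
  simp [extend_eq, map_sum]

theorem extend_extend (K K' : Basis → Ket) (ψ : Ket) :
    extend K' (extend K ψ) = extend (fun b => extend K' (K b)) ψ := by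
  change extend K' (∑ b ∈ ψ.support, ψ b • K b) = ∑ b ∈ ψ.support, ψ b • extend K' (K b)
  rw [extend_sum]
  exact Finset.sum_congr rfl fun b _ => extend_smul _ _ _

theorem extend_self (ψ : Ket) : extend (fun b => Finsupp.single b 1) ψ = ψ := by
  simp [extend_eq, Finsupp.linearCombination_apply]

/-- All basis states that occur in `ψ` have the property `X`. -/
def Within (X : Basis → Prop) (ψ : Ket) : Prop := ∀ b ∈ ψ.support, X b

theorem extend_congr {X : Basis → Prop} {K K' : Basis → Ket} {ψ : Ket} (hψ : Within X ψ)
    (h : ∀ b, X b → K b = K' b) : extend K ψ = extend K' ψ :=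
  Finset.sum_congr rfl fun b hb => by simp only [h b (hψ b hb)]

theorem Within.mono {X Y : Basis → Prop} {ψ : Ket} (hψ : Within X ψ) (h : ∀ b, X b → Y b) :
    Within Y ψ := fun b hb => h b (hψ b hb)

theorem Within.single {X : Basis → Prop} {b : Basis} (h : X b) (α : ℂ) :
    Within X (Finsupp.single b α) := fun b' hb' => by
  have := Finsupp.support_single_subset hb'
  rw [Finset.mem_singleton] at this
  rwa [this]

theorem Within.smul {X : Basis → Prop} {ψ : Ket} (h : Within X ψ) (α : ℂ) : Within X (α • ψ) :=
  fun b hb => h b (Finsupp.support_smul hb)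

theorem Within.sum {X : Basis → Prop} {ι : Type*} {s : Finset ι} {ψ : ι → Ket}
    (h : ∀ i ∈ s, Within X (ψ i)) : Within X (∑ i ∈ s, ψ i) := fun b hb => by
  classical
  obtain ⟨i, hi, hb⟩ := Finset.mem_biUnion.1 (Finsupp.support_finsetSum hb)
  exact h i hi b hb

theorem Within.extend {X Y : Basis → Prop} {K : Basis → Ket} {ψ : Ket} (hψ : Within X ψ)
    (h : ∀ b, X b → Within Y (K b)) : Within Y (extend K ψ) :=
  Within.sum fun b hb => (h b (hψ b hb)).smul _

theorem update_update (b : Basis) (c x y : ℕ) : (b.update c x).update c y = b.update c y := by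
  ext a; simp

theorem update_self (b : Basis) (c : ℕ) : b.update c (b c) = b := by
  ext a; simp

/-! ## Bits -/

theorem xor_two_pow_of_lt {x j : ℕ} (h : x < 2 ^ j) : x ^^^ 2 ^ j = x + 2 ^ j := by
  rw [← Nat.or_two_pow_eq_add_of_lt h]
  refine Nat.eq_of_testBit_eq fun i => ?_
  simp only [Nat.testBit_xor, Nat.testBit_or, Nat.testBit_two_pow]
  by_cases hi : j = i
  · subst hi; simp [Nat.testBit_lt_two_pow h]
  · simp [hi]

theorem add_two_pow_xor {x j : ℕ} (h : x < 2 ^ j) : (x + 2 ^ j) ^^^ 2 ^ j = x := by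
  rw [← xor_two_pow_of_lt h, Nat.xor_assoc, Nat.xor_self, Nat.xor_zero]

theorem testBit_add_two_pow {x j : ℕ} (h : x < 2 ^ j) : (x + 2 ^ j).testBit j = true := by
  rw [add_comm, Nat.testBit_two_pow_add_eq, Nat.testBit_lt_two_pow h]; rfl

/-! ## Phases -/

/-- `exp (2 π i t)`. -/
noncomputable def cis (t : ℝ) : ℂ := Complex.exp (2 * Real.pi * Complex.I * t)

theorem cis_add (s t : ℝ) : cis (s + t) = cis s * cis t := by
  simp [cis, ← Complex.exp_add, mul_add]

theorem cis_zero : cis 0 = 1 := by simp [cis]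

theorem cis_int (n : ℤ) : cis n = 1 := by
  rw [cis, Complex.exp_eq_one_iff]
  exact ⟨n, by push_cast; ring⟩

theorem cis_nat (n : ℕ) : cis n = 1 := cis_int n

theorem cis_nat_mul (n : ℕ) (t : ℝ) : cis (n * t) = cis t ^ n := by
  rw [cis, cis, ← Complex.exp_nat_mul]
  push_cast; ring_nf

theorem norm_cis (t : ℝ) : ‖cis t‖ = 1 := by
  have : cis t = Complex.exp ((2 * Real.pi * t : ℝ) * Complex.I) := by
    rw [cis]; push_cast; ring_nf
  rw [this, Complex.norm_exp_ofReal_mul_I]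

theorem conj_cis (t : ℝ) : (starRingEnd ℂ) (cis t) = cis (-t) := by
  rw [cis, cis, ← Complex.exp_conj]
  have : (starRingEnd ℂ) 2 = 2 := Complex.conj_ofNat 2
  simp [this]

theorem cis_half : cis (1 / 2) = -1 := by
  rw [cis, ← Complex.exp_pi_mul_I]
  push_cast; ring_nf

theorem phaseK_eq (c j k : ℕ) (b : Basis) :
    phaseK c j k b = Finsupp.single b (if (b c).testBit j then cis (1 / 2 ^ k) else 1) := by
  rw [phaseK, cis]
  congr 2
  push_cast; ring_nf

/-! ## Superposition and Fourier measurement of one cell -/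

/-- The amplitude `1 / √2`. -/
noncomputable def half : ℂ := ((1 / Real.sqrt 2 : ℝ) : ℂ)

theorem half_mul_half : half * half = 1 / 2 := by
  rw [half, ← Complex.ofReal_mul]
  have : (1 / Real.sqrt 2) * (1 / Real.sqrt 2) = 1 / 2 := by
    rw [div_mul_div_comm, Real.mul_self_sqrt (by norm_num)]; norm_num
  rw [this]; norm_num

/-- The uniform superposition of the numbers below `2 ^ a` in the cell `c`. -/
noncomputable def hadOp (c a : ℕ) (b : Basis) : Ket :=
  half ^ a • ∑ x ∈ Finset.range (2 ^ a), Finsupp.single (b.update c x) 1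

theorem hadOp_zero {c : ℕ} {b : Basis} (h : b c = 0) : hadOp c 0 b = Finsupp.single b 1 := by
  have := update_self b c
  rw [h] at this
  simp [hadOp, this]

theorem hadamardK_update {c a x : ℕ} (b : Basis) (h : x < 2 ^ a) :
    hadamardK c a (b.update c x) =
      half • (Finsupp.single (b.update c x) 1 + Finsupp.single (b.update c (x + 2 ^ a)) 1) := by
  simp only [hadamardK, update_update]
  simp [xor_two_pow_of_lt h, Nat.testBit_lt_two_pow h, half]

theorem extend_hadamardK_hadOp (c a : ℕ) (b : Basis) :
    extend (hadamardK c a) (hadOp c a b) = hadOp c (a + 1) b := by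
  rw [hadOp, hadOp, extend_smul, extend_sum, pow_succ, mul_smul, pow_succ 2 a, mul_two,
    Finset.sum_range_add, ← Finset.sum_add_distrib, Finset.smul_sum (r := half)]
  congr 1
  refine Finset.sum_congr rfl fun x hx => ?_
  rw [extend_single, one_smul, hadamardK_update _ (Finset.mem_range.1 hx), add_comm x]

/-- The effect of measuring `l` bits of the Fourier transform of the number below `2 ^ n` in the
cell `c`, if the bits of `y` are the outcome. -/
noncomputable def measOp (n c l y : ℕ) (b : Basis) : Ket :=
  Finsupp.single (b.update c (b c % 2 ^ (n - l))) (half ^ l * cis (b c * y / 2 ^ n))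

theorem measOp_zero {n c : ℕ} {b : Basis} (h : b c < 2 ^ n) :
    measOp n c 0 0 b = Finsupp.single b 1 := by
  simp [measOp, Nat.mod_eq_of_lt h, cis_zero]

theorem measureK_eq_of_testBit {c j : ℕ} {v : Bool} {b : Basis} (h : (b c).testBit j = v) :
    measureK c j v b = Finsupp.single b 1 := by simp [measureK, h]

theorem measureK_eq_zero {c j : ℕ} {v : Bool} {b : Basis} (h : (b c).testBit j ≠ v) :
    measureK c j v b = 0 := by simp [measureK, h]

/-- Bit `j` is the top bit of `x`. The Hadamard gate spreads it over both values with the sign `-1`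
only from 1 to 1, and the measurement keeps one of them; the lower bits are untouched. -/
theorem extend_measureK_hadamardK {c j x : ℕ} (b : Basis) (h : b c = x) (hx : x < 2 ^ (j + 1))
    (v : Bool) :
    extend (measureK c j v) (hadamardK c j b) =
      Finsupp.single (b.update c (x % 2 ^ j + v.toNat * 2 ^ j))
        (half * (if v && x.testBit j then -1 else 1)) := by
  have hpos : 0 < 2 ^ j := by positivity
  have hlt := Nat.mod_lt x hpos
  have hb : b = b.update c x := by rw [← h, update_self]
  have hx' : x = x % 2 ^ j ∨ x = x % 2 ^ j + 2 ^ j := by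
    have h1 := Nat.div_add_mod x (2 ^ j)
    have h2 : x / 2 ^ j < 2 := by rw [Nat.div_lt_iff_lt_mul hpos]; rw [pow_succ] at hx; omega
    interval_cases hq : x / 2 ^ j <;> omega
  generalize x % 2 ^ j = r at hx' hlt
  have e0 : ∀ v, measureK c j v (b.update c r) = if v then 0 else Finsupp.single (b.update c r) 1 := by
    intro v
    cases v
    · rw [measureK_eq_of_testBit (by simp [Nat.testBit_lt_two_pow hlt])]; simp
    · rw [measureK_eq_zero (by simp [Nat.testBit_lt_two_pow hlt])]; simp
  have e1 : ∀ v, measureK c j v (b.update c (r + 2 ^ j)) =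
      if v then Finsupp.single (b.update c (r + 2 ^ j)) 1 else 0 := by
    intro v
    cases v
    · rw [measureK_eq_zero (by simp [testBit_add_two_pow hlt])]; simp
    · rw [measureK_eq_of_testBit (by simp [testBit_add_two_pow hlt])]; simp
  rcases hx' with hx' | hx'
  · rw [hb, hx', hadamardK_update _ hlt, extend_smul, extend_add, extend_single, extend_single,
      one_smul, one_smul, e0, e1, update_update]
    cases v <;> simp [Nat.testBit_lt_two_pow hlt]
  · have : hadamardK c j (b.update c (r + 2 ^ j)) = half •
        (Finsupp.single (b.update c r) 1 - Finsupp.single (b.update c (r + 2 ^ j)) 1) := by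
      simp only [hadamardK, update_update]
      simp [add_two_pow_xor hlt, testBit_add_two_pow hlt, half]
    rw [hb, hx', this, extend_smul, extend_sub, extend_single, extend_single,
      one_smul, one_smul, e0, e1, update_update]
    cases v <;> simp [testBit_add_two_pow hlt]

/-- The effect of the phase gates on the bits from `i` to `j - 1`. -/
noncomputable def phaseOp (c j i : ℕ) (b : Basis) : Ket :=
  Finsupp.single b (cis ((b c - b c % 2 ^ i : ℕ) / 2 ^ (j + 1)))

theorem phaseOp_self {c j : ℕ} {b : Basis} (h : b c < 2 ^ j) :
    phaseOp c j j b = Finsupp.single b 1 := by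
  simp [phaseOp, Nat.mod_eq_of_lt h, cis_zero]

theorem mod_two_pow_succ_eq (x i : ℕ) :
    x % 2 ^ (i + 1) = x % 2 ^ i + if x.testBit i then 2 ^ i else 0 := by
  rw [Nat.mod_pow_succ, Nat.testBit_eq_decide_div_mod_eq]
  rcases Nat.mod_two_eq_zero_or_one (x / 2 ^ i) with h | h <;> simp [h]

/-- A gate with parameter `j - i + 1` contributes the angle `2 ^ i / 2 ^ (j + 1)`, which is the
share of bit `i` in the quotient of the content by `2 ^ (j + 1)`. -/
theorem extend_phaseK_phaseOp {c j i : ℕ} (b : Basis) (hi : i < j) :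
    extend (phaseK c i (j - i + 1)) (phaseOp c j (i + 1) b) = phaseOp c j i b := by
  rw [phaseOp, extend_single, phaseK_eq, Finsupp.smul_single, phaseOp, smul_eq_mul]
  congr 1
  have h1 := mod_two_pow_succ_eq (b c) i
  have h2 : b c % 2 ^ (i + 1) ≤ b c := Nat.mod_le _ _
  have h3 : b c - b c % 2 ^ i = b c - b c % 2 ^ (i + 1) + if (b c).testBit i then 2 ^ i else 0 := by
    omega
  rw [h3]
  split_ifs with h
  · rw [← cis_add]
    congr 1
    have : (2 : ℝ) ^ (j + 1) = 2 ^ (j - i + 1) * 2 ^ i := by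
      rw [← pow_add]; congr 1; omega
    push_cast
    rw [add_div, this]
    congr 1
    field_simp
  · simp

/-- One step of the Fourier measurement. -/
theorem measOp_succ_false {n c l j y : ℕ} (b : Basis) (hj : l + j + 1 = n) :
    extend (fun b => extend (measureK c j false) (hadamardK c j b)) (measOp n c l y b) =
      measOp n c (l + 1) y b := by
  have e1 : n - l = j + 1 := by omega
  have e2 : n - (l + 1) = j := by omega
  rw [measOp, extend_single, extend_measureK_hadamardK _ (by simp; rfl)
    (by rw [e1]; exact Nat.mod_lt _ (by positivity)), update_update, measOp, e1, e2,
    Nat.mod_mod_of_dvd _ (pow_dvd_pow 2 (by omega)), Finsupp.smul_single]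
  simp only [Bool.toNat_false, zero_mul, add_zero, Bool.false_and]
  congr 1
  simp; ring

/-- This is the semiclassical Fourier transform. Adding `2 ^ l` to `y` has to multiply the amplitude
of `x` by `cis (x / 2 ^ (j + 1))`. The bits of `x` above `j` contribute integers to this angle, bit
`j` contributes the sign coming from the Hadamard gate, and the lower bits are supplied by the phase
gates. The `load` resets the measured bit, so that the cell is zero in the end. -/
theorem measOp_succ_true {n c l j y : ℕ} (b : Basis) (hj : l + j + 1 = n) :
    extend (phaseOp c j 0) (extend (loadK c (2 ^ j))
      (extend (fun b => extend (measureK c j true) (hadamardK c j b)) (measOp n c l y b))) =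
      measOp n c (l + 1) (y + 2 ^ l) b := by
  have e1 : n - l = j + 1 := by omega
  have e2 : n - (l + 1) = j := by omega
  rw [measOp, extend_single, extend_measureK_hadamardK _ (by simp; rfl)
    (by rw [e1]; exact Nat.mod_lt _ (by positivity)), update_update, measOp, e1, e2,
    Nat.mod_mod_of_dvd _ (pow_dvd_pow 2 (by omega)), Finsupp.smul_single, extend_single,
    loadK, Finsupp.smul_single, extend_single, phaseOp, Finsupp.smul_single, update_update]
  have hlt : b c % 2 ^ j < 2 ^ j := Nat.mod_lt _ (by positivity)
  have e3 : (Finsupp.update b c (b c % 2 ^ j + Bool.toNat true * 2 ^ j)) c = b c % 2 ^ j + 2 ^ j := by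
    simp
  rw [e3, add_two_pow_xor hlt]
  congr 1
  simp only [Finsupp.coe_update, Function.update_self, pow_zero, Nat.mod_one, Nat.sub_zero,
    smul_eq_mul, mul_one, Bool.true_and]
  have e4 : (if (b c % 2 ^ (j + 1)).testBit j then (-1 : ℂ) else 1) * cis ((b c % 2 ^ j : ℕ) / 2 ^ (j + 1))
      = cis ((b c : ℝ) / 2 ^ (j + 1)) := by
    have h1 : b c = 2 ^ (j + 1) * (b c / 2 ^ (j + 1)) + b c % 2 ^ (j + 1) :=
      (Nat.div_add_mod _ _).symm
    have h2 := mod_two_pow_succ_eq (b c) j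
    have h3 : (b c % 2 ^ (j + 1)).testBit j = (b c).testBit j := by
      rw [Nat.testBit_mod_two_pow]; simp
    rw [h3]
    have h4 : (b c : ℝ) / 2 ^ (j + 1) = (b c / 2 ^ (j + 1) : ℕ) +
        ((b c % 2 ^ j : ℕ) / 2 ^ (j + 1) + if (b c).testBit j then 1 / 2 else 0) := by
      conv_lhs => rw [h1, h2]
      push_cast
      split_ifs <;> field_simp <;> ring
    rw [h4, cis_add, cis_nat, one_mul, cis_add]
    split_ifs
    · rw [cis_half]; ring
    · rw [cis_zero]; ring
  have e5 : (b c : ℝ) * (y + 2 ^ l : ℕ) / 2 ^ n = b c * y / 2 ^ n + b c / 2 ^ (j + 1) := by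
    have : (2 : ℝ) ^ n = 2 ^ l * 2 ^ (j + 1) := by rw [← pow_add]; congr 1; omega
    rw [this]
    push_cast
    field_simp
  rw [e5, cis_add, ← e4]
  ring

end QRam

namespace QRam

/-! ## Several cells -/

/-- The squared norm. -/
noncomputable def normSq {α : Type*} (f : α →₀ ℂ) : ℝ := f.sum fun _ z => ‖z‖ ^ 2

theorem weight_eq_normSq (ψ : Ket) : weight ψ = normSq ψ := rfl

theorem normSq_nonneg {α : Type*} (f : α →₀ ℂ) : 0 ≤ normSq f :=
  Finset.sum_nonneg fun _ _ => by positivity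

theorem weight_nonneg (ψ : Ket) : 0 ≤ weight ψ := normSq_nonneg ψ

theorem normSq_sum_single {α ι : Type*} [DecidableEq α] {s : Finset ι} {f : ι → α}
    (hf : Set.InjOn f s) (c : ι → ℂ) :
    normSq (∑ i ∈ s, Finsupp.single (f i) (c i)) = ∑ i ∈ s, ‖c i‖ ^ 2 := by
  set h := ∑ i ∈ s, Finsupp.single (f i) (c i)
  have happ : ∀ i ∈ s, h (f i) = c i := by
    intro i hi
    simp only [h, Finsupp.finsetSum_apply]
    rw [Finset.sum_eq_single i]
    · simp
    · intro j hj hne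
      rw [Finsupp.single_apply, if_neg]
      exact fun he => hne (hf hj hi he)
    · exact fun h => (h hi).elim
  have hsupp : h.support ⊆ s.image f := by
    intro a ha
    obtain ⟨i, hi, ha⟩ := Finset.mem_biUnion.1 (Finsupp.support_finsetSum ha)
    have := Finsupp.support_single_subset ha
    rw [Finset.mem_singleton] at this
    exact Finset.mem_image.2 ⟨i, hi, this.symm⟩
  rw [normSq, Finsupp.sum_of_support_subset _ hsupp _ (by simp), Finset.sum_image hf]
  exact Finset.sum_congr rfl fun i hi => by rw [happ i hi]

/-- The cells from `c` on are zero. -/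
def Fresh (c : ℕ) (b : Basis) : Prop := ∀ a, c ≤ a → b a = 0

/-- Writing `χ` into an empty cell is a tensor product. Since the cell `β` is known to be zero
beforehand, the pair of old basis state and new content can be read off the new basis state. -/
theorem weight_extend_mapDomain {β : ℕ} {ψ : Ket} (hψ : Within (Fresh β) ψ) (χ : ℕ →₀ ℂ) :
    weight (extend (fun b => χ.mapDomain (b.update β)) ψ) = weight ψ * normSq χ := by
  classical
  have h1 : extend (fun b => χ.mapDomain (b.update β)) ψ =
      ∑ x ∈ ψ.support ×ˢ χ.support, Finsupp.single (x.1.update β x.2) (ψ x.1 * χ x.2) := by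
    simp only [extend, Finsupp.sum, Finsupp.mapDomain, Finset.sum_product, Finset.smul_sum,
      Finsupp.smul_single, smul_eq_mul]
  rw [h1, weight_eq_normSq, normSq_sum_single]
  · rw [weight_eq_normSq, normSq, normSq, Finsupp.sum, Finsupp.sum, Finset.sum_mul_sum,
      Finset.sum_product]
    simp only [norm_mul, mul_pow]
  · rintro ⟨b, w⟩ h ⟨b', w'⟩ h' he
    simp only [Finset.coe_product, Set.mem_prod, Finset.mem_coe] at h h' he
    have hb := hψ b h.1 β le_rfl
    have hb' := hψ b' h'.1 β le_rfl
    have hw : w = w' := by simpa using DFunLike.congr_fun he β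
    have hbb : b = b' := by
      ext a
      by_cases ha : a = β
      · rw [ha, hb, hb']
      · simpa [ha] using DFunLike.congr_fun he a
    rw [hw, hbb]

/-- Write the first `a` entries of `x` into the cells from `c` on. -/
noncomputable def setCells (c : ℕ) : ℕ → (ℕ → ℕ) → Basis → Basis
  | 0, _, b => b
  | a + 1, x, b => (setCells c a x b).update (c + a) (x a)

theorem setCells_apply (c a : ℕ) (x : ℕ → ℕ) (b : Basis) (i : ℕ) :
    setCells c a x b i = if c ≤ i ∧ i < c + a then x (i - c) else b i := by
  induction a with
  | zero => simp only [setCells]; rw [if_neg (by omega)]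
  | succ a ih =>
    simp only [setCells, Finsupp.coe_update, Function.update_apply, ih]
    by_cases h : i = c + a
    · simp [h]
    · rw [if_neg h]
      congr 1
      simp only [eq_iff_iff]; omega

theorem setCells_congr {c a : ℕ} {x x' : ℕ → ℕ} (b : Basis) (h : ∀ i < a, x i = x' i) :
    setCells c a x b = setCells c a x' b := by
  ext i
  simp only [setCells_apply]
  split_ifs
  · exact h _ (by omega)
  · rfl

/-- Extend a tuple by zeros. -/
def padded {a N : ℕ} (x : Fin a → Fin N) (i : ℕ) : ℕ := if h : i < a then x ⟨i, h⟩ else 0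

theorem padded_val {a N : ℕ} (x : Fin a → Fin N) (i : Fin a) : padded x i = x i := by
  simp [padded]

theorem padded_snoc {a N : ℕ} (x : Fin a → Fin N) (v : Fin N) :
    padded (Fin.snoc x v : Fin (a + 1) → Fin N) = Function.update (padded x) a v := by
  funext i
  unfold padded
  by_cases h : i = a
  · subst h
    have : (⟨i, by omega⟩ : Fin (i + 1)) = Fin.last i := rfl
    rw [dif_pos (by omega), this, Fin.snoc_last, Function.update_self]
  · by_cases h' : i < a
    · have : (⟨i, by omega⟩ : Fin (a + 1)) = Fin.castSucc ⟨i, h'⟩ := rfl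
      rw [dif_pos (by omega), this, Fin.snoc_castSucc, Function.update_of_ne h, dif_pos h']
    · rw [dif_neg (by omega), Function.update_of_ne h, dif_neg h']

theorem sum_padded_succ {E : Type*} [AddCommMonoid E] (a N : ℕ) (f : (ℕ → ℕ) → E) :
    ∑ x : Fin (a + 1) → Fin N, f (padded x) =
      ∑ x : Fin a → Fin N, ∑ v ∈ Finset.range N, f (Function.update (padded x) a v) := by
  rw [← (Fin.snocEquiv fun _ => Fin N).sum_comp, Fintype.sum_prod_type, Finset.sum_comm]
  refine Finset.sum_congr rfl fun x _ => ?_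
  rw [Finset.sum_range]
  exact Finset.sum_congr rfl fun v _ => by rw [← padded_snoc]; rfl

/-- The uniform superposition of the numbers below `2 ^ n` in each of `a` cells. -/
noncomputable def hadCells (c n a : ℕ) (b : Basis) : Ket :=
  half ^ (n * a) • ∑ x : Fin a → Fin (2 ^ n), Finsupp.single (setCells c a (padded x) b) 1

theorem hadCells_zero (c n : ℕ) (b : Basis) : hadCells c n 0 b = Finsupp.single b 1 := by
  simp [hadCells, setCells]

theorem extend_hadOp_hadCells (c n a : ℕ) (b : Basis) :
    extend (hadOp (c + a) n) (hadCells c n a b) = hadCells c n (a + 1) b := by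
  rw [hadCells, hadCells, extend_smul, extend_sum, mul_add, mul_one, pow_add, mul_smul,
    sum_padded_succ (f := fun x => Finsupp.single (setCells c (a + 1) x b) (1 : ℂ)),
    Finset.smul_sum (r := half ^ n)]
  congr 1
  refine Finset.sum_congr rfl fun x _ => ?_
  rw [extend_single, one_smul, hadOp]
  congr 1
  refine Finset.sum_congr rfl fun v _ => ?_
  rw [setCells, Function.update_self, setCells_congr (x' := padded x) (x := Function.update _ _ _)]
  intro i hi
  rw [Function.update_of_ne (by omega)]

/-- The effect of the Fourier measurement of the cells `c + i`, …, `c + k - 1` with outcome `y`. -/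
noncomputable def measCells (c n k i : ℕ) (y : ℕ → ℕ) (b : Basis) : Ket :=
  Finsupp.single (setCells (c + i) (k - i) 0 b)
    (half ^ (n * (k - i)) * cis (∑ t ∈ Finset.Ico i k, (b (c + t) * y t / 2 ^ n : ℝ)))

theorem measCells_self (c n k : ℕ) (y : ℕ → ℕ) (b : Basis) :
    measCells c n k k y b = Finsupp.single b 1 := by
  simp [measCells, setCells, cis_zero]

theorem extend_measOp_measCells (c n k i v : ℕ) (y : ℕ → ℕ) (b : Basis) (hi : i < k) :
    extend (measOp n (c + i) n v) (measCells c n k (i + 1) y b) =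
      measCells c n k i (Function.update y i v) b := by
  rw [measCells, extend_single, measOp, measCells, Finsupp.smul_single]
  have h1 : setCells (c + (i + 1)) (k - (i + 1)) 0 b (c + i) = b (c + i) := by
    rw [setCells_apply, if_neg (by omega)]
  rw [h1, Nat.sub_self, pow_zero, Nat.mod_one]
  congr 1
  · ext a
    simp only [Finsupp.coe_update, Function.update_apply, setCells_apply, Pi.zero_apply]
    by_cases h : a = c + i
    · rw [if_pos h, if_pos (by omega)]
    · rw [if_neg h]
      congr 1
      simp only [eq_iff_iff]; omega
  · rw [Finset.sum_eq_sum_Ico_succ_bot hi, Function.update_self, cis_add,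
      show n * (k - i) = n * (k - (i + 1)) + n by
        rw [← Nat.mul_succ]; congr 1; omega, pow_add, smul_eq_mul]
    have : ∑ t ∈ Finset.Ico (i + 1) k, (b (c + t) * Function.update y i v t / 2 ^ n : ℝ) =
        ∑ t ∈ Finset.Ico (i + 1) k, (b (c + t) * y t / 2 ^ n : ℝ) := by
      refine Finset.sum_congr rfl fun t ht => ?_
      rw [Function.update_of_ne (by have := Finset.mem_Ico.1 ht; omega)]
    rw [this]
    ring

/-- The effect of an oracle that turns the numbers `x` in the cells from `β + 1` on into the
vector `Φ x` in the cell `β`. -/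
noncomputable def oracleOp (β k : ℕ) (Φ : (Fin k → ℕ) → ℕ →₀ ℂ) (b : Basis) : Ket :=
  (Φ fun i => b (β + 1 + i)).mapDomain (b.update β)

/-- The vector that remains after a Fourier measurement with outcome `y`. -/
noncomputable def outcome (n k : ℕ) (Φ : (Fin k → ℕ) → ℕ →₀ ℂ) (y : ℕ → ℕ) : ℕ →₀ ℂ :=
  ∑ x : Fin k → Fin (2 ^ n),
    ((1 / 2) ^ (n * k) * cis (∑ t : Fin k, (x t * y t / 2 ^ n : ℝ))) • Φ fun i => x i

theorem extend_mapDomain (K : Basis → Ket) (f : ℕ → Basis) (χ : ℕ →₀ ℂ) :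
    extend K (χ.mapDomain f) = χ.sum fun w α => α • K (f w) := by
  rw [extend_eq, Finsupp.linearCombination_mapDomain]; rfl

/-- Measuring also erases the coordinates, so the contributions of all `x` end in basis states that
differ from `b` only in the cell `β`, where they interfere. The factor `(1/2) ^ (n k)` collects
`half ^ (n k)` once from the superposition and once from the measurement. -/
theorem measCells_oracleOp_hadCells {β n k : ℕ} (Φ : (Fin k → ℕ) → ℕ →₀ ℂ) (y : ℕ → ℕ)
    {b : Basis} (hb : Fresh β b) :
    extend (measCells (β + 1) n k 0 y) (extend (oracleOp β k Φ) (hadCells (β + 1) n k b)) =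
      (outcome n k Φ y).mapDomain (b.update β) := by
  rw [hadCells, extend_smul, extend_smul, extend_sum, extend_sum, outcome,
    Finsupp.mapDomain_finsetSum, Finset.smul_sum]
  refine Finset.sum_congr rfl fun x _ => ?_
  have hx : (fun i : Fin k => setCells (β + 1) k (padded x) b (β + 1 + i)) = fun i => (x i : ℕ) := by
    funext i
    rw [setCells_apply, if_pos (by omega), Nat.add_sub_cancel_left, padded_val]
  rw [extend_single, one_smul, oracleOp, hx, extend_mapDomain, Finsupp.mapDomain_smul,
    Finsupp.mapDomain, Finsupp.sum, Finsupp.sum, Finset.smul_sum, Finset.smul_sum]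
  refine Finset.sum_congr rfl fun w _ => ?_
  rw [measCells]
  have h1 : setCells (β + 1 + 0) (k - 0) 0
      ((setCells (β + 1) k (padded x) b).update β w) = b.update β w := by
    ext a
    simp only [Finsupp.coe_update, Function.update_apply, setCells_apply, Pi.zero_apply]
    by_cases h : a = β
    · rw [if_pos h, if_pos h, if_neg (by omega)]
    · rw [if_neg h, if_neg h]
      by_cases h' : β < a
      · by_cases h'' : a < β + 1 + k
        · rw [if_pos (by omega), hb a h'.le]
        · rw [if_neg (by omega), if_neg (by omega)]
      · rw [if_neg (by omega), if_neg (by omega)]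
  have h2 : ∑ t ∈ Finset.Ico 0 k, ((((setCells (β + 1) k (padded x) b).update β w)
      (β + 1 + t) : ℕ) * y t / 2 ^ n : ℝ) = ∑ t : Fin k, (x t * y t / 2 ^ n : ℝ) := by
    rw [← Finset.range_eq_Ico, Finset.sum_range]
    refine Finset.sum_congr rfl fun t _ => ?_
    congr 3
    rw [Finsupp.coe_update, Function.update_of_ne (by omega), ← congrFun hx t]
  rw [h1, h2, Nat.sub_zero, Finsupp.smul_single, Finsupp.smul_single, Finsupp.smul_single]
  congr 1
  have h3 : ((1 : ℂ) / 2) ^ (n * k) = half ^ (n * k) * half ^ (n * k) := by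
    rw [← mul_pow, half_mul_half]
  rw [h3, smul_eq_mul, smul_eq_mul, smul_eq_mul]
  ring

/-- The probability of the outcome `y`. -/
theorem weight_round {β n k : ℕ} (Φ : (Fin k → ℕ) → ℕ →₀ ℂ) (y : ℕ → ℕ) {ψ : Ket}
    (hψ : Within (Fresh β) ψ) :
    weight (extend (measCells (β + 1) n k 0 y)
      (extend (oracleOp β k Φ) (extend (hadCells (β + 1) n k) ψ))) =
      weight ψ * normSq (outcome n k Φ y) := by
  rw [extend_extend, extend_extend, ← weight_extend_mapDomain hψ]
  congr 1
  refine extend_congr hψ fun b hb => ?_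
  rw [← measCells_oracleOp_hadCells Φ y hb, extend_extend]

/-- The vector left in the cell `β` is never cleaned up. Everything behind it is zero again, so the
next round uses `β + 1` in its place. -/
theorem within_round {β n k : ℕ} (Φ : (Fin k → ℕ) → ℕ →₀ ℂ) (y : ℕ → ℕ) {ψ : Ket}
    (hψ : Within (Fresh β) ψ) :
    Within (Fresh (β + 1)) (extend (measCells (β + 1) n k 0 y)
      (extend (oracleOp β k Φ) (extend (hadCells (β + 1) n k) ψ))) := by
  rw [extend_extend, extend_extend]
  refine hψ.extend fun b hb => ?_
  rw [← extend_extend, measCells_oracleOp_hadCells Φ y hb]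
  refine Within.sum fun w _ => Within.single (fun a ha => ?_) _
  rw [Finsupp.coe_update, Function.update_of_ne (by omega), hb a (by omega)]

end QRam

namespace QRam

/-! ## Fourier sampling -/

theorem norm_cis_sub_one (t : ℝ) : ‖cis t - 1‖ = 2 * |Real.sin (Real.pi * t)| := by
  have : cis t = Complex.exp (Complex.I * (2 * Real.pi * t : ℝ)) := by
    rw [cis]; push_cast; ring_nf
  rw [this, Complex.norm_exp_I_mul_ofReal_sub_one, norm_mul, Real.norm_eq_abs, Real.norm_eq_abs,
    abs_of_pos (by norm_num : (0 : ℝ) < 2)]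
  ring_nf

/-- After subtracting the nearest integer, Jordan's inequality `sin (π s) ≥ 2 s` on `[0, 1/2]`
applies. -/
theorem le_norm_cis_sub_one {t ε : ℝ} (h : ∀ m : ℤ, ε ≤ |t - m|) : 4 * ε ≤ ‖cis t - 1‖ := by
  set s := t - round t with hs
  have h1 : |s| ≤ 1 / 2 := abs_sub_round t
  have h2 : cis t = cis s := by
    have : t = s + (round t : ℤ) := by rw [hs]; ring
    rw [this, cis_add, cis_int, mul_one]
  have h3 : ‖cis t - 1‖ = 2 * Real.sin (Real.pi * |s|) := by
    rw [h2, norm_cis_sub_one]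
    congr 1
    rcases abs_cases s with ⟨h, -⟩ | ⟨h, -⟩
    · rw [h, abs_of_nonneg]
      refine Real.sin_nonneg_of_nonneg_of_le_pi ?_ ?_
      · rw [← h]; positivity
      · rw [← h]; nlinarith [Real.pi_pos]
    · rw [h, ← abs_neg, ← Real.sin_neg, ← mul_neg, abs_of_nonneg]
      refine Real.sin_nonneg_of_nonneg_of_le_pi ?_ ?_
      · rw [← h]; positivity
      · rw [← h]; nlinarith [Real.pi_pos]
  have h4 := Real.mul_le_sin (x := Real.pi * |s|) (by positivity) (by nlinarith [Real.pi_pos])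
  have h5 : 2 / Real.pi * (Real.pi * |s|) = 2 * |s| := by field_simp
  have h6 := h (round t)
  rw [h3]
  rw [h5] at h4
  linarith

/-- The number obtained by rounding `p y / N`. -/
def rounded (p N y : ℕ) : ℕ := (2 * p * y + N) / (2 * N)

/-- The amplitude of `y` in the Fourier transform over `ℤ / N` of the character of `ℤ / p` that
belongs to `u`. -/
noncomputable def fejer (p N y u : ℕ) : ℂ :=
  (1 / N : ℂ) * ∑ x ∈ Finset.range N, cis (x * (y / N + u / p))

/-- The amplitude is a geometric sum with ratio `cis θ`, hence of norm at most `2 / (N ‖cis θ -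
1‖)`. If `y` rounds to a residue other than `-u`, then `p θ` is a nonzero residue up to an error of
at most `1/2`, so `θ` is at distance at least `1 / (2 p)` from all integers. -/
theorem norm_fejer_le {p N y u : ℕ} (hp : 0 < p) (hN : 0 < N)
    (h : ((rounded p N y : ℕ) + u : ZMod p) ≠ 0) : ‖fejer p N y u‖ ^ 2 ≤ (p : ℝ) ^ 2 / N ^ 2 := by
  have hp' : (0 : ℝ) < p := by exact_mod_cast hp
  have hN' : (0 : ℝ) < N := by exact_mod_cast hN
  set θ : ℝ := y / N + u / p with hθ
  have hdist : ∀ m : ℤ, 1 / (2 * p : ℝ) ≤ |θ - m| := by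
    intro m
    set r := rounded p N y with hr
    have hne : (r + u - m * p : ℤ) ≠ 0 := by
      intro h0
      apply h
      have : ((r + u - m * p : ℤ) : ZMod p) = 0 := by rw [h0]; simp
      simpa using this
    have h1 : (1 : ℝ) ≤ |(r + u - m * p : ℝ)| := by
      have := Int.one_le_abs hne
      exact_mod_cast this
    have h2 : |(p * y / N - r : ℝ)| ≤ 1 / 2 := by
      have e1 : 2 * N * r ≤ 2 * p * y + N := Nat.mul_div_le _ _
      have e2 : 2 * p * y + N < 2 * N * r + 2 * N := by
        have := Nat.lt_mul_div_succ (2 * p * y + N) (show 0 < 2 * N by omega)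
        rw [hr, rounded]; linarith
      have e1' : (2 * N * r : ℝ) ≤ 2 * p * y + N := by exact_mod_cast e1
      have e2' : (2 * p * y + N : ℝ) < 2 * N * r + 2 * N := by exact_mod_cast e2
      have e3 : (p * y / N - r : ℝ) = (p * y - N * r) / N := by field_simp
      rw [e3, abs_le]
      constructor
      · rw [le_div_iff₀ hN']; linarith
      · rw [div_le_iff₀ hN']; linarith
    have h3 : θ - m = ((r + u - m * p : ℝ) + (p * y / N - r)) / p := by
      rw [hθ]; field_simp; ring
    have h4 : (1 : ℝ) / 2 ≤ |(r + u - m * p : ℝ) + (p * y / N - r)| := by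
      have := abs_sub_abs_le_abs_sub (r + u - m * p : ℝ) (-(p * y / N - r : ℝ))
      rw [abs_neg, sub_neg_eq_add] at this
      linarith
    rw [h3, abs_div, abs_of_pos hp', le_div_iff₀ hp']
    calc 1 / (2 * p : ℝ) * p = 1 / 2 := by field_simp
      _ ≤ _ := h4
  have h1 := le_norm_cis_sub_one hdist
  have h2 : fejer p N y u * (cis θ - 1) = (1 / N : ℂ) * (cis (N * θ) - 1) := by
    -- Telescoping instead of dividing: no case distinction on `cis θ = 1` is necessary.
    rw [fejer, mul_assoc, cis_nat_mul, ← geom_sum_mul]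
    simp only [cis_nat_mul, hθ]
  have h3 : ‖fejer p N y u‖ * ‖cis θ - 1‖ ≤ 2 / N := by
    rw [← norm_mul, h2, norm_mul]
    have : ‖cis (N * θ) - 1‖ ≤ 2 := (norm_sub_le _ _).trans (by rw [norm_cis]; norm_num)
    rw [norm_div, norm_one, Complex.norm_natCast]
    calc 1 / (N : ℝ) * ‖cis (N * θ) - 1‖ ≤ 1 / N * 2 := by gcongr
      _ = 2 / N := by ring
  have h4 : ‖fejer p N y u‖ * (2 / p) ≤ 2 / N :=
    (mul_le_mul_of_nonneg_left (by
      calc (2 / p : ℝ) = 4 * (1 / (2 * p)) := by field_simp; norm_num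
        _ ≤ _ := h1) (norm_nonneg _)).trans h3
  have h5 : ‖fejer p N y u‖ ≤ p / N := by
    rw [mul_div_assoc', div_le_div_iff₀ hp' hN'] at h4
    rw [le_div_iff₀ hN']
    linarith
  calc ‖fejer p N y u‖ ^ 2 ≤ (p / N : ℝ) ^ 2 := by gcongr
    _ = _ := by rw [div_pow]

theorem sum_cis_eq_zero {N x x' : ℕ} (hx : x < N) (hx' : x' < N) (h : x ≠ x') :
    ∑ y ∈ Finset.range N, cis (y * ((x - x' : ℝ) / N)) = 0 := by
  have hN : (N : ℝ) ≠ 0 := by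
    have : N ≠ 0 := by omega
    exact_mod_cast this
  have h1 : cis ((x - x' : ℝ) / N) - 1 ≠ 0 := by
    intro h0
    have hd : ∀ m : ℤ, (1 / N : ℝ) ≤ |(x - x' : ℝ) / N - m| := by
      intro m
      have e : (x - x' : ℝ) / N - m = ((x - x' - m * N : ℤ) : ℝ) / N := by
        push_cast; field_simp
      have hne : (x - x' - m * N : ℤ) ≠ 0 := by
        intro h1
        have h2 : (N : ℤ) ∣ (x : ℤ) - x' := ⟨m, by linarith⟩
        have h3 := Int.eq_zero_of_abs_lt_dvd h2 (by rw [abs_lt]; constructor <;> omega)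
        omega
      rw [e, abs_div, Nat.abs_cast, ← Int.cast_abs]
      gcongr
      exact_mod_cast Int.one_le_abs hne
    have := le_norm_cis_sub_one hd
    rw [h0, norm_zero] at this
    have : (0 : ℝ) < 1 / N := by
      have : 0 < N := by omega
      positivity
    linarith
  have h2 : (∑ y ∈ Finset.range N, cis (y * ((x - x' : ℝ) / N))) * (cis ((x - x' : ℝ) / N) - 1) = 0 := by
    simp only [cis_nat_mul]
    rw [geom_sum_mul, ← cis_nat_mul, mul_div_cancel₀ _ hN]
    have : (x - x' : ℝ) = ((x - x' : ℤ) : ℝ) := by push_cast; ring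
    rw [this, cis_int, sub_self]
  exact (mul_eq_zero.1 h2).resolve_right h1

/-- Parseval's identity: after expanding the square, the sum over `y` removes all pairs `x ≠ x'`. -/
theorem sum_norm_fejer {p N u : ℕ} (hN : 0 < N) :
    ∑ y ∈ Finset.range N, ‖fejer p N y u‖ ^ 2 = 1 := by
  have hN' : (N : ℂ) ≠ 0 := by exact_mod_cast hN.ne'
  apply Complex.ofReal_injective
  push_cast
  have h1 (y : ℕ) : ((‖fejer p N y u‖ : ℂ)) ^ 2 = (1 / N ^ 2 : ℂ) *
      ∑ x ∈ Finset.range N, ∑ x' ∈ Finset.range N,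
        cis ((x - x') * (u / p)) * cis (y * ((x - x') / N)) := by
    rw [← Complex.mul_conj', fejer, map_mul, map_sum, mul_mul_mul_comm, Finset.sum_mul_sum]
    congr 1
    · simp; ring
    · refine Finset.sum_congr rfl fun x _ => Finset.sum_congr rfl fun x' _ => ?_
      rw [conj_cis, ← cis_add, ← cis_add]
      ring_nf
  simp only [h1]
  rw [← Finset.mul_sum, Finset.sum_comm]
  have h2 : ∀ x ∈ Finset.range N, ∑ y ∈ Finset.range N, ∑ x' ∈ Finset.range N,
      cis ((x - x') * (u / p)) * cis (y * ((x - x') / N)) = N := by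
    intro x hx
    rw [Finset.sum_comm, Finset.sum_eq_single x]
    · simp [cis_zero]
    · intro x' hx' hne
      rw [← Finset.mul_sum, sum_cis_eq_zero (Finset.mem_range.1 hx) (Finset.mem_range.1 hx') hne.symm,
        mul_zero]
    · exact fun h => (h hx).elim
  rw [Finset.sum_congr rfl h2]
  simp
  field_simp

/-! ### Hidden subspaces of `Fin k → ZMod p` and characters -/

section hidden

variable {p k : ℕ} [Fact p.Prime] (K : Submodule (ZMod p) (Fin k → ZMod p))

/-- The orthogonal complement with respect to the standard bilinear form. -/
def perp : Submodule (ZMod p) (Fin k → ZMod p) where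
  carrier := {u | ∀ w ∈ K, u ⬝ᵥ w = 0}
  add_mem' := fun ha hb w hw => by rw [add_dotProduct, ha w hw, hb w hw, add_zero]
  zero_mem' := fun w _ => zero_dotProduct w
  smul_mem' := fun c u hu w hw => by rw [smul_dotProduct, hu w hw, smul_zero]

variable {K}

theorem exists_perp_of_notMem {z : Fin k → ZMod p} (hz : z ∉ K) : ∃ u ∈ perp K, u ⬝ᵥ z ≠ 0 := by
  obtain ⟨f, hf, hK⟩ := Submodule.exists_le_ker_of_notMem hz
  have key (w : Fin k → ZMod p) : (fun i => f fun j => if i = j then 1 else 0) ⬝ᵥ w = f w := by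
    rw [LinearMap.pi_apply_eq_sum_univ f w, dotProduct]
    exact Finset.sum_congr rfl fun i _ => mul_comm _ _
  exact ⟨_, fun w hw => by rw [key]; exact hK hw, by rwa [key]⟩

noncomputable instance : Fintype (perp K) := Fintype.ofFinite _

/-- Orthogonality of characters: for `z ∉ K` the pairing with `z` is a nontrivial character of `perp
K`, because some element of `perp K` separates `z` from `K`. -/
theorem sum_char_perp (z : Fin k → ZMod p) [Decidable (z ∈ K)] :
    ∑ u : perp K, (ZMod.stdAddChar ((u : Fin k → ZMod p) ⬝ᵥ z) : ℂ) =
      if z ∈ K then (Fintype.card (perp K) : ℂ) else 0 := by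
  split_ifs with hz
  · rw [Finset.sum_congr rfl fun u _ => by rw [u.2 z hz, AddChar.map_zero_eq_one]]
    simp
  · let ψ : AddChar (perp K) ℂ :=
      { toFun := fun u => ZMod.stdAddChar ((u : Fin k → ZMod p) ⬝ᵥ z)
        map_zero_eq_one' := by simp
        map_add_eq_mul' := fun u v => by simp [add_dotProduct, AddChar.map_add_eq_mul] }
    have hψ : ψ ≠ 1 := by
      obtain ⟨u, hu, hne⟩ := exists_perp_of_notMem hz
      intro h
      apply hne
      apply ZMod.injective_stdAddChar
      rw [AddChar.map_zero_eq_one]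
      exact DFunLike.congr_fun h (⟨u, hu⟩ : perp K)
    exact AddChar.sum_eq_zero_of_ne_one hψ

theorem stdAddChar_natCast (x : ℕ) : (ZMod.stdAddChar (x : ZMod p) : ℂ) = cis (x / p) := by
  have := ZMod.stdAddChar_coe (N := p) x
  rw [Int.cast_natCast] at this
  rw [this, cis]
  push_cast; ring_nf

/-- The inner product. -/
noncomputable def dot {α : Type*} (f g : α →₀ ℂ) : ℂ := f.sum fun a z => (starRingEnd ℂ) z * g a

theorem normSq_sum_smul {α ι : Type*} [Fintype ι] (c : ι → ℂ) (f : ι → α →₀ ℂ) :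
    (normSq (∑ i, c i • f i) : ℂ) = ∑ i, ∑ j, (starRingEnd ℂ) (c i) * c j * dot (f i) (f j) := by
  classical
  set T := Finset.univ.biUnion fun i => (f i).support
  have hT (i : ι) : (f i).support ⊆ T := Finset.subset_biUnion_of_mem (fun i => (f i).support)
    (Finset.mem_univ i)
  have hs : (∑ i, c i • f i).support ⊆ T := by
    refine Finsupp.support_finsetSum.trans (Finset.biUnion_subset.2 fun i _ => ?_)
    exact Finsupp.support_smul.trans (hT i)
  have hd (i j : ι) : dot (f i) (f j) = ∑ a ∈ T, (starRingEnd ℂ) (f i a) * f j a :=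
    Finsupp.sum_of_support_subset _ (hT i) _ (by simp)
  rw [normSq, Finsupp.sum_of_support_subset _ hs _ (by simp)]
  simp only [hd, Finset.mul_sum, Complex.ofReal_sum, Complex.ofReal_pow]
  have h1 (a : α) : ((‖(∑ i, c i • f i) a‖ : ℂ)) ^ 2 = ∑ i, ∑ j,
      (starRingEnd ℂ) (c i) * c j * ((starRingEnd ℂ) (f i a) * f j a) := by
    rw [← Complex.conj_mul', Finsupp.finsetSum_apply, map_sum, Finset.sum_mul_sum]
    refine Finset.sum_congr rfl fun i _ => Finset.sum_congr rfl fun j _ => ?_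
    simp; ring
  simp only [h1]
  rw [Finset.sum_comm]
  exact Finset.sum_congr rfl fun i _ => Finset.sum_comm

/-- The reduction of a tuple of natural numbers. -/
def reduce (p : ℕ) {k : ℕ} (x : Fin k → ℕ) : Fin k → ZMod p := fun i => x i

/-- The vectors `Φ x` hide the subspace `K`. -/
def HidesSpace (K : Submodule (ZMod p) (Fin k → ZMod p)) (Φ : (Fin k → ℕ) → ℕ →₀ ℂ) : Prop :=
  ∀ x x', (reduce p x' - reduce p x ∈ K → dot (Φ x) (Φ x') = 1) ∧
    (reduce p x' - reduce p x ∉ K → dot (Φ x) (Φ x') = 0)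

/-- The outcomes of a Fourier measurement of a random coset of `K` are distributed like random
elements of the orthogonal complement, up to rounding. -/
theorem normSq_outcome {Φ : (Fin k → ℕ) → ℕ →₀ ℂ} (hΦ : HidesSpace K Φ) (n : ℕ) (y : ℕ → ℕ) :
    normSq (outcome n k Φ y) = (1 / Fintype.card (perp K) : ℝ) *
      ∑ u : perp K, ∏ i : Fin k, ‖fejer p (2 ^ n) (y i) (u.1 i).val‖ ^ 2 := by
  classical
  set c : (Fin k → Fin (2 ^ n)) → ℂ := fun x =>
    (1 / 2) ^ (n * k) * cis (∑ t : Fin k, (x t * y t / 2 ^ n : ℝ)) with hc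
  have hcard : (Fintype.card (perp K) : ℂ) ≠ 0 := by
    exact_mod_cast Fintype.card_ne_zero
  -- Hiding says that the Gram matrix of the vectors is the indicator of `x' - x ∈ K`. Writing it as
  -- an average of characters over `perp K` diagonalizes the quadratic form.
  have h1 (x x' : Fin k → Fin (2 ^ n)) : dot (Φ fun i => x i) (Φ fun i => x' i) =
      (1 / Fintype.card (perp K) : ℂ) * ∑ u : perp K,
        (starRingEnd ℂ) (ZMod.stdAddChar (u.1 ⬝ᵥ reduce p fun i => (x i : ℕ)) : ℂ) *
          ZMod.stdAddChar (u.1 ⬝ᵥ reduce p fun i => (x' i : ℕ)) := by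
    have h2 (u : perp K) :
        (starRingEnd ℂ) (ZMod.stdAddChar (u.1 ⬝ᵥ reduce p fun i => (x i : ℕ)) : ℂ) *
          ZMod.stdAddChar (u.1 ⬝ᵥ reduce p fun i => (x' i : ℕ)) =
        ZMod.stdAddChar (u.1 ⬝ᵥ ((reduce p fun i => (x' i : ℕ)) - reduce p fun i => (x i : ℕ))) := by
      rw [dotProduct_sub, sub_eq_add_neg, AddChar.map_add_eq_mul, AddChar.map_neg_eq_conj, mul_comm]
    simp only [h2, sum_char_perp]
    split_ifs with h
    · rw [(hΦ _ _).1 h]; field_simp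
    · rw [(hΦ _ _).2 h, mul_zero]
  -- Characters and Fourier phases both factor over the coordinates, and the sum runs over a full
  -- box.
  have h3 (u : perp K) : ∑ x, c x * ZMod.stdAddChar (u.1 ⬝ᵥ reduce p fun i => (x i : ℕ)) =
      ∏ i : Fin k, fejer p (2 ^ n) (y i) (u.1 i).val := by
    have h4 (i : Fin k) : fejer p (2 ^ n) (y i) (u.1 i).val = ∑ x : Fin (2 ^ n),
        (1 / 2) ^ n * cis (x * (y i / 2 ^ n + (u.1 i).val / p)) := by
      rw [fejer, Finset.sum_range, Finset.mul_sum]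
      simp [one_div]
    simp only [h4]
    rw [Fintype.prod_sum]
    refine Finset.sum_congr rfl fun x _ => ?_
    have h5 : u.1 ⬝ᵥ (reduce p fun i => (x i : ℕ)) =
        ((∑ i : Fin k, (u.1 i).val * (x i : ℕ) : ℕ) : ZMod p) := by
      simp [dotProduct, reduce]
    have h6 (s : Finset (Fin k)) (f : Fin k → ℝ) : cis (∑ i ∈ s, f i) = ∏ i ∈ s, cis (f i) := by
      induction s using Finset.induction_on with
      | empty => simp [cis_zero]
      | insert a s ha ih => rw [Finset.sum_insert ha, Finset.prod_insert ha, cis_add, ih]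
    rw [h5, stdAddChar_natCast, Finset.prod_mul_distrib, Finset.prod_const, Finset.card_univ,
      Fintype.card_fin, ← pow_mul, hc, mul_assoc, ← cis_add, ← h6]
    congr 2
    push_cast
    rw [Finset.sum_div, ← Finset.sum_add_distrib]
    refine Finset.sum_congr rfl fun i _ => ?_
    ring
  apply Complex.ofReal_injective
  rw [outcome, normSq_sum_smul]
  simp only [h1, Finset.mul_sum]
  push_cast
  have h4 (u : perp K) : ((∏ i : Fin k, (‖fejer p (2 ^ n) (y i) (u.1 i).val‖ : ℂ) ^ 2)) =
      ∑ x, ∑ x', (starRingEnd ℂ) (c x * ZMod.stdAddChar (u.1 ⬝ᵥ reduce p fun i => (x i : ℕ))) *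
        (c x' * ZMod.stdAddChar (u.1 ⬝ᵥ reduce p fun i => (x' i : ℕ))) := by
    rw [← Finset.sum_mul_sum, ← map_sum, h3, Complex.conj_mul', Finset.prod_pow, norm_prod]
    push_cast
    rfl
  simp only [h4, Finset.mul_sum]
  rw [Finset.sum_comm]
  conv_rhs => rw [Finset.sum_comm]
  rw [Finset.sum_comm]
  refine Finset.sum_congr rfl fun x _ => ?_
  rw [Finset.sum_comm (s := (Finset.univ : Finset (perp K)))]
  refine Finset.sum_congr rfl fun x' _ => Finset.sum_congr rfl fun u _ => ?_
  simp only [hc, map_mul]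
  ring

/-- A lower bound for the expected value of a nonnegative function of the rounded outcomes of a
Fourier measurement. -/
theorem le_sum_normSq_outcome {Φ : (Fin k → ℕ) → ℕ →₀ ℂ} (hΦ : HidesSpace K Φ) {n : ℕ}
    (hn : p ^ 2 ≤ 2 ^ n) (V : (Fin k → ZMod p) → ℝ) (hV : ∀ u, 0 ≤ V u) :
    (1 - k * ((p : ℝ) ^ 2 / 2 ^ n)) *
        ((1 / Fintype.card (perp K) : ℝ) * ∑ u : perp K, V u) ≤
      ∑ y : Fin k → Fin (2 ^ n), normSq (outcome n k Φ (padded y)) *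
        V (reduce p fun i => rounded p (2 ^ n) (y i)) := by
  classical
  have hp : 0 < p := (Fact.out : p.Prime).pos
  set ε : ℝ := (p : ℝ) ^ 2 / 2 ^ n with hε
  have hε1 : ε ≤ 1 := by
    rw [hε, div_le_one (by positivity)]
    exact_mod_cast hn
  -- The total probability is 1. Of the outcomes that round to a wrong residue there are at most `2
  -- ^ n`, each of probability at most `p² / 4 ^ n`.
  have hgood (u : ZMod p) : 1 - ε ≤ ∑ y : Fin (2 ^ n),
      if ((rounded p (2 ^ n) y : ℕ) : ZMod p) = -u then ‖fejer p (2 ^ n) y u.val‖ ^ 2 else 0 := by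
    have h1 := sum_norm_fejer (p := p) (N := 2 ^ n) (u := u.val) (by positivity)
    rw [Finset.sum_range] at h1
    rw [← h1, sub_le_iff_le_add, ← sub_le_iff_le_add', ← Finset.sum_sub_distrib]
    calc _ ≤ ∑ y : Fin (2 ^ n), (p : ℝ) ^ 2 / ((2 ^ n : ℕ) : ℝ) ^ 2 := by
          refine Finset.sum_le_sum fun y _ => ?_
          split_ifs with h
          · rw [sub_self]; positivity
          · rw [sub_zero]
            refine norm_fejer_le hp (by positivity) ?_
            rw [ZMod.natCast_zmod_val]
            exact fun h' => h (eq_neg_of_add_eq_zero_left h')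
      _ = ε := by
          rw [Finset.sum_const, Finset.card_univ, Fintype.card_fin, nsmul_eq_mul, hε]
          push_cast
          field_simp
  have h1 (u : perp K) : (1 - ε) ^ k * V (-u.1) ≤ ∑ y : Fin k → Fin (2 ^ n),
      (∏ i : Fin k, ‖fejer p (2 ^ n) (y i) (u.1 i).val‖ ^ 2) *
        V (reduce p fun i => rounded p (2 ^ n) (y i)) := by
    calc (1 - ε) ^ k * V (-u.1) ≤ (∏ i : Fin k, ∑ y : Fin (2 ^ n),
          if ((rounded p (2 ^ n) y : ℕ) : ZMod p) = -u.1 i then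
            ‖fejer p (2 ^ n) y (u.1 i).val‖ ^ 2 else 0) * V (-u.1) := by
          refine mul_le_mul_of_nonneg_right ?_ (hV _)
          have := Finset.prod_le_prod (s := (Finset.univ : Finset (Fin k))) (f := fun _ => 1 - ε)
            (fun _ _ => by linarith) fun i _ => hgood (u.1 i)
          simpa using this
      _ ≤ _ := by
          rw [Fintype.prod_sum, Finset.sum_mul]
          refine Finset.sum_le_sum fun y _ => ?_
          by_cases hy : ∀ i, ((rounded p (2 ^ n) (y i) : ℕ) : ZMod p) = -u.1 i
          · have : (reduce p fun i => rounded p (2 ^ n) (y i)) = -u.1 := funext hy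
            rw [this]
            exact le_of_eq (congrArg (· * _) (Finset.prod_congr rfl fun i _ => if_pos (hy i)))
          · push Not at hy
            obtain ⟨i, hi⟩ := hy
            rw [Finset.prod_eq_zero (Finset.mem_univ i) (if_neg hi), zero_mul]
            exact mul_nonneg (Finset.prod_nonneg fun _ _ => by positivity) (hV _)
  -- Bernoulli's inequality; it needs only `ε ≤ 1`, which is what `hn` provides.
  have h2 : (1 - k * ε) ≤ (1 - ε) ^ k := by
    have := one_add_mul_sub_le_pow (a := 1 - ε) (by linarith) k
    linarith
  -- The rounded outcome is `-u`, which is as uniform on `perp K` as `u` itself.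
  have h3 : ∑ u : perp K, V (-u.1) = ∑ u : perp K, V u :=
    Fintype.sum_equiv (Equiv.neg _) _ _ fun u => rfl
  have hsum : 0 ≤ ∑ u : perp K, V u := Finset.sum_nonneg fun _ _ => hV _
  calc _ ≤ (1 - ε) ^ k * ((1 / Fintype.card (perp K) : ℝ) * ∑ u : perp K, V u) := by
        gcongr
    _ = (1 / Fintype.card (perp K) : ℝ) * ∑ u : perp K, (1 - ε) ^ k * V (-u.1) := by
        rw [← Finset.mul_sum, h3]; ring
    _ ≤ (1 / Fintype.card (perp K) : ℝ) * ∑ u : perp K, ∑ y : Fin k → Fin (2 ^ n),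
      (∏ i : Fin k, ‖fejer p (2 ^ n) (y i) (u.1 i).val‖ ^ 2) *
        V (reduce p fun i => rounded p (2 ^ n) (y i)) := by
        gcongr with u
        exact h1 u
    _ = _ := by
        rw [Finset.sum_comm, Finset.mul_sum]
        refine Finset.sum_congr rfl fun y _ => ?_
        rw [normSq_outcome hΦ, ← Finset.sum_mul]
        simp only [padded_val]
        ring

end hidden
end QRam

namespace QRam

/-! ## Reversible computation of words -/

/-- The effect of `load` on basis states. -/
noncomputable def loadF (c v : ℕ) (b : Basis) : Basis := b.update c (b c ^^^ v)

/-- The effect of `arith` on basis states. -/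
noncomputable def arithF (o : Arith) (x y c w : ℕ) (b : Basis) : Basis :=
  b.update c (b c ^^^ o.eval (b x % 2 ^ w) (b y % 2 ^ w))

theorem extend_loadK (c v : ℕ) (b : Basis) (α : ℂ) :
    extend (loadK c v) (Finsupp.single b α) = Finsupp.single (loadF c v b) α := by
  simp [extend_single, loadK, loadF]

theorem extend_arithK {o : Arith} {x y c w : ℕ} (hx : c ≠ x) (hy : c ≠ y) (b : Basis) (α : ℂ) :
    extend (arithK o x y c w) (Finsupp.single b α) = Finsupp.single (arithF o x y c w b) α := by
  simp [extend_single, arithK, arithF, hx, hy]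

theorem extend_loadK_extend (c v : ℕ) (g : Basis → Basis) (ψ : Ket) :
    extend (loadK c v) (extend (fun b => Finsupp.single (g b) 1) ψ) =
      extend (fun b => Finsupp.single (loadF c v (g b)) 1) ψ := by
  simp only [extend_extend, extend_loadK]

theorem extend_arithK_extend {o : Arith} {x y c w : ℕ} (hx : c ≠ x) (hy : c ≠ y)
    (g : Basis → Basis) (ψ : Ket) :
    extend (arithK o x y c w) (extend (fun b => Finsupp.single (g b) 1) ψ) =
      extend (fun b => Finsupp.single (arithF o x y c w (g b)) 1) ψ := by
  simp only [extend_extend, extend_arithK hx hy]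

theorem loadF_loadF (c v : ℕ) (b : Basis) : loadF c v (loadF c v b) = b := by
  ext a
  by_cases h : a = c
  · subst h; simp [loadF]
  · simp [loadF]

theorem arithF_arithF {o : Arith} {x y c w : ℕ} (hx : c ≠ x) (hy : c ≠ y) (b : Basis) :
    arithF o x y c w (arithF o x y c w b) = b := by
  ext a
  by_cases h : a = c
  · subst h; simp [arithF, hx.symm, hy.symm]
  · simp [arithF, h]

theorem update_comm (b : Basis) {c c' : ℕ} (h : c ≠ c') (x y : ℕ) :
    (b.update c x).update c' y = (b.update c' y).update c x := by
  ext a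
  simp only [Finsupp.coe_update]
  rw [Function.update_comm h]

theorem loadF_update {c v a z : ℕ} (h : a ≠ c) (b : Basis) :
    loadF c v (b.update a z) = (loadF c v b).update a z := by
  rw [loadF, loadF, Finsupp.coe_update, Function.update_of_ne h.symm, update_comm _ h]

theorem arithF_update {o : Arith} {x y c w a z : ℕ} (h : a ≠ c) (hx : a ≠ x) (hy : a ≠ y)
    (b : Basis) : arithF o x y c w (b.update a z) = (arithF o x y c w b).update a z := by
  rw [arithF, arithF, Finsupp.coe_update, Function.update_of_ne h.symm,
    Function.update_of_ne hx.symm, Function.update_of_ne hy.symm, update_comm _ h]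

theorem loadF_same (c v : ℕ) (b : Basis) : loadF c v b c = b c ^^^ v := by simp [loadF]

theorem loadF_ne {c v a : ℕ} (b : Basis) (h : a ≠ c) : loadF c v b a = b a := by simp [loadF, h]

theorem arithF_same (o : Arith) (x y c w : ℕ) (b : Basis) :
    arithF o x y c w b c = b c ^^^ o.eval (b x % 2 ^ w) (b y % 2 ^ w) := by simp [arithF]

theorem arithF_ne {o : Arith} {x y c w a : ℕ} (b : Basis) (h : a ≠ c) :
    arithF o x y c w b a = b a := by simp [arithF, h]

/-- The cell of the `i`-th coordinate. -/
def cellX (e : Expr) : Expr := var .base + 1 + e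

/-- A scratch cell. -/
def cellAux (c : ℕ) : Expr := var .base + 1 + var .k + .const c

/-- The cell of the `i`-th letter of a word. -/
def cellW (e : Expr) : Expr := var .base + 1 + var .k + 7 + e

/-- Compute `a₁ a₂ q + f` and the numbers needed for that in scratch cells. -/
def prepare (a₁ a₂ f q : Expr) : List Com :=
  [.load (cellAux 0) (var .p), .load (cellAux 1) 1, .load (cellAux 2) q,
    .arith .mul a₁ a₂ (cellAux 3) (4 * var .n),
    .arith .mul (cellAux 3) (cellAux 2) (cellAux 4) (4 * var .n),
    .arith .add (cellAux 4) f (cellAux 5) (4 * var .n)]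

/-- Sequential composition. -/
def seqList : List Com → Com
  | [] => .skip
  | c :: l => .seq c (seqList l)

/-- Add `(a₁ a₂ q + f) mod p` to the cell `w`, where `a₁`, `a₂`, `f` are cells. -/
def wordStep (a₁ a₂ f q w : Expr) : Com :=
  seqList (prepare a₁ a₂ f q ++ .arith .mod (cellAux 5) (cellAux 0) w (4 * var .n) ::
    (prepare a₁ a₂ f q).reverse)

/-- The effect of `prepare`. -/
noncomputable def prepareF (σ a₁ a₂ f p q w : ℕ) (b : Basis) : Basis :=
  arithF .add (σ + 4) f (σ + 5) w (arithF .mul (σ + 3) (σ + 2) (σ + 4) w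
    (arithF .mul a₁ a₂ (σ + 3) w (loadF (σ + 2) q (loadF (σ + 1) 1 (loadF σ p b)))))

/-- The effect of undoing `prepare`. -/
noncomputable def unprepareF (σ a₁ a₂ f p q w : ℕ) (b : Basis) : Basis :=
  loadF σ p (loadF (σ + 1) 1 (loadF (σ + 2) q (arithF .mul a₁ a₂ (σ + 3) w
    (arithF .mul (σ + 3) (σ + 2) (σ + 4) w (arithF .add (σ + 4) f (σ + 5) w b)))))

/-- The operands are not scratch cells; the second one may also be the constant `1`. -/
structure Operands (σ a₁ a₂ f t : ℕ) : Prop where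
  a₁ : a₁ < σ
  a₂ : a₂ < σ ∨ a₂ = σ + 1
  f : f < σ ∨ f = σ + 6
  t : σ + 7 ≤ t

/-- Every gate adds modulo 2 to a cell that is not among its operands, so it is its own inverse and
the reversed list undoes the list. Scratch cell 1 is loaded with the constant 1 and may serve as a
factor; scratch cell 6 is never written and may serve as the summand 0. The size conditions ensure
that truncation to `w` bits has no effect. -/
theorem wordStepF {σ a₁ a₂ f p q w t : ℕ} (b : Basis) (h : Operands σ a₁ a₂ f t)
    (hb : ∀ i < 6, b (σ + i) = 0) (hp : p < 2 ^ w) (hq : q < 2 ^ w) (h₁ : b a₁ < 2 ^ w)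
    (h₂ : b a₂ < 2 ^ w) (h₁₂ : b a₁ * (if a₂ = σ + 1 then 1 else b a₂) < 2 ^ w)
    (hmul : b a₁ * (if a₂ = σ + 1 then 1 else b a₂) * q + b f < 2 ^ w) (hw : 1 < 2 ^ w) :
    unprepareF σ a₁ a₂ f p q w (arithF .mod (σ + 5) σ t w (prepareF σ a₁ a₂ f p q w b)) =
      b.update t (b t ^^^ (b a₁ * (if a₂ = σ + 1 then 1 else b a₂) * q + b f) % p) := by
  obtain ⟨h1, h2, h3, h4⟩ := h
  have hun : unprepareF σ a₁ a₂ f p q w (prepareF σ a₁ a₂ f p q w b) = b := by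
    rw [unprepareF, prepareF, arithF_arithF (by omega) (by omega),
      arithF_arithF (by omega) (by omega), arithF_arithF (by omega) (by omega), loadF_loadF,
      loadF_loadF, loadF_loadF]
  -- The target cell is neither operand nor target of the gates being undone, so the cleaning does
  -- not notice the result.
  have hcomm (b : Basis) (z : ℕ) : unprepareF σ a₁ a₂ f p q w (b.update t z) =
      (unprepareF σ a₁ a₂ f p q w b).update t z := by
    rw [unprepareF, arithF_update (by omega) (by omega) (by omega),
      arithF_update (by omega) (by omega) (by omega),
      arithF_update (by omega) (by omega) (by omega), loadF_update (by omega),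
      loadF_update (by omega), loadF_update (by omega), unprepareF]
  have hne (a : ℕ) (ha : a < σ ∨ σ + 6 ≤ a) : prepareF σ a₁ a₂ f p q w b a = b a := by
    rw [prepareF, arithF_ne _ (by omega), arithF_ne _ (by omega), arithF_ne _ (by omega),
      loadF_ne _ (by omega), loadF_ne _ (by omega), loadF_ne _ (by omega)]
  set b₁ := loadF σ p b with hb₁
  set b₂ := loadF (σ + 1) 1 b₁ with hb₂
  set b₃ := loadF (σ + 2) q b₂ with hb₃
  set b₄ := arithF .mul a₁ a₂ (σ + 3) w b₃ with hb₄
  set b₅ := arithF .mul (σ + 3) (σ + 2) (σ + 4) w b₄ with hb₅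
  have e1 (i : ℕ) (hi : 1 ≤ i) : b₁ (σ + i) = b (σ + i) := loadF_ne _ (by omega)
  have e3 : b₃ a₁ = b a₁ := by
    rw [hb₃, loadF_ne _ (by omega), hb₂, loadF_ne _ (by omega), hb₁, loadF_ne _ (by omega)]
  have e3' : b₃ a₂ = if a₂ = σ + 1 then 1 else b a₂ := by
    rw [hb₃, loadF_ne _ (by omega), hb₂]
    split_ifs with h
    · rw [h, loadF_same, e1 _ le_rfl, hb 1 (by omega), Nat.zero_xor]
    · rw [loadF_ne _ (by omega), hb₁, loadF_ne _ (by omega)]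
  have e4 : b₄ (σ + 3) = b a₁ * (if a₂ = σ + 1 then 1 else b a₂) := by
    rw [hb₄, arithF_same, e3, e3', hb₃, loadF_ne _ (by omega), hb₂, loadF_ne _ (by omega),
      e1 _ (by omega), hb 3 (by omega), Nat.zero_xor, Nat.mod_eq_of_lt h₁, Nat.mod_eq_of_lt]
    · rfl
    · split_ifs
      · exact hw
      · exact h₂
  have e4' : b₄ (σ + 2) = q := by
    rw [hb₄, arithF_ne _ (by omega), hb₃, loadF_same, hb₂, loadF_ne _ (by omega), e1 _ (by omega),
      hb 2 (by omega), Nat.zero_xor]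
  have e5 : b₅ (σ + 4) = b a₁ * (if a₂ = σ + 1 then 1 else b a₂) * q := by
    rw [hb₅, arithF_same, e4, e4', hb₄, arithF_ne _ (by omega), hb₃, loadF_ne _ (by omega), hb₂,
      loadF_ne _ (by omega), e1 _ (by omega), hb 4 (by omega), Nat.zero_xor,
      Nat.mod_eq_of_lt h₁₂, Nat.mod_eq_of_lt hq]
    rfl
  have e5' : b₅ f = b f := by
    rw [hb₅, arithF_ne _ (by omega), hb₄, arithF_ne _ (by omega), hb₃, loadF_ne _ (by omega), hb₂,
      loadF_ne _ (by omega), hb₁, loadF_ne _ (by omega)]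
  have e6 : prepareF σ a₁ a₂ f p q w b (σ + 5) =
      b a₁ * (if a₂ = σ + 1 then 1 else b a₂) * q + b f := by
    change arithF .add (σ + 4) f (σ + 5) w b₅ (σ + 5) = _
    rw [arithF_same, e5, e5', hb₅, arithF_ne _ (by omega), hb₄, arithF_ne _ (by omega), hb₃,
      loadF_ne _ (by omega), hb₂, loadF_ne _ (by omega), e1 _ (by omega), hb 5 (by omega),
      Nat.zero_xor, Nat.mod_eq_of_lt, Nat.mod_eq_of_lt]
    · rfl
    · exact lt_of_le_of_lt (Nat.le_add_left _ _) hmul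
    · exact lt_of_le_of_lt (Nat.le_add_right _ _) hmul
  have e7 : prepareF σ a₁ a₂ f p q w b σ = p := by
    change arithF .add (σ + 4) f (σ + 5) w b₅ σ = _
    rw [arithF_ne _ (by omega), hb₅, arithF_ne _ (by omega), hb₄, arithF_ne _ (by omega), hb₃,
      loadF_ne _ (by omega), hb₂, loadF_ne _ (by omega), hb₁, loadF_same]
    have := hb 0 (by omega)
    rw [add_zero] at this
    rw [this, Nat.zero_xor]
  rw [arithF, hcomm, hun, e6, e7, hne t (by omega), Nat.mod_eq_of_lt hmul, Nat.mod_eq_of_lt hp]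
  rfl

namespace Frame

variable {F : Frame} [F.Valid]

omit [F.Valid] in
theorem Det.seqList_cons {c : Com} {l : List Com} {M : Mem} {ψ : Ket} {k : ℕ}
    {Q : Mem → Ket → ℕ → Prop} {ψ' : Ket}
    (h : F.Det c M ψ k (fun M' φ k' => M' = M ∧ φ = ψ' ∧ k' = k))
    (h' : F.Det (seqList l) M ψ' k Q) : F.Det (seqList (c :: l)) M ψ k Q :=
  h.seq fun M' φ k' ⟨h₁, h₂, h₃⟩ => by subst h₁ h₂ h₃; exact h'

omit [F.Valid] in
theorem Det.seqList_load {e₁ e₂ : Expr} {l : List Com} {M : Mem} {ψ : Ket} {k c v : ℕ}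
    {Q : Mem → Ket → ℕ → Prop} (h₁ : e₁.val (F.enc M) = c) (h₂ : e₂.val (F.enc M) = v)
    (h : F.Det (seqList l) M (extend (loadK c v) ψ) k Q) :
    F.Det (seqList (.load e₁ e₂ :: l)) M ψ k Q :=
  Det.seqList_cons (Det.load ⟨rfl, rfl, rfl⟩) (by rw [h₁, h₂]; exact h)

omit [F.Valid] in
theorem Det.seqList_arith {o : Arith} {e₁ e₂ e₃ e₄ : Expr} {l : List Com} {M : Mem} {ψ : Ket}
    {k x y c w : ℕ} {Q : Mem → Ket → ℕ → Prop} (h₁ : e₁.val (F.enc M) = x)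
    (h₂ : e₂.val (F.enc M) = y) (h₃ : e₃.val (F.enc M) = c) (h₄ : e₄.val (F.enc M) = w)
    (hw : w ≤ F.bound) (h : F.Det (seqList l) M (extend (arithK o x y c w) ψ) k Q) :
    F.Det (seqList (.arith o e₁ e₂ e₃ e₄ :: l)) M ψ k Q :=
  Det.seqList_cons (Det.arith (by rwa [h₄]) ⟨rfl, rfl, rfl⟩) (by rw [h₁, h₂, h₃, h₄]; exact h)

@[simp] theorem val_cellX (M : Mem) (e : Expr) :
    (cellX e).val (F.enc M) = M .base 0 + 1 + e.val (F.enc M) := by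
  simp [cellX]

@[simp] theorem val_cellAux (M : Mem) (c : ℕ) :
    (cellAux c).val (F.enc M) = M .base 0 + 1 + M .k 0 + c := by
  simp [cellAux]

@[simp] theorem val_cellW (M : Mem) (e : Expr) :
    (cellW e).val (F.enc M) = M .base 0 + 1 + M .k 0 + 7 + e.val (F.enc M) := by
  simp [cellW]

theorem Det.wordStep {e₁ e₂ ef eq ew : Expr} {M : Mem} {ψ : Ket} {k σ a₁ a₂ f q t w : ℕ}
    (hσ : M .base 0 + 1 + M .k 0 = σ) (hw : 4 * M .n 0 = w)
    (h₁ : e₁.val (F.enc M) = a₁) (h₂ : e₂.val (F.enc M) = a₂) (hf : ef.val (F.enc M) = f)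
    (hq : eq.val (F.enc M) = q) (ht : ew.val (F.enc M) = t) (hO : Operands σ a₁ a₂ f t)
    (hbd : w ≤ F.bound) {X : Basis → Prop} (hψ : Within X ψ)
    (hX : ∀ b, X b → (∀ i < 6, b (σ + i) = 0) ∧ b a₁ < 2 ^ w ∧ b a₂ < 2 ^ w ∧
      b a₁ * (if a₂ = σ + 1 then 1 else b a₂) < 2 ^ w ∧
      b a₁ * (if a₂ = σ + 1 then 1 else b a₂) * q + b f < 2 ^ w)
    (hp : M .p 0 < 2 ^ w) (hqw : q < 2 ^ w) (hw1 : 1 < 2 ^ w) :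
    F.Det (wordStep e₁ e₂ ef eq ew) M ψ k fun M' ψ' k' => M' = M ∧ k' = k ∧
      ψ' = extend (fun b => Finsupp.single (b.update t
        (b t ^^^ (b a₁ * (if a₂ = σ + 1 then 1 else b a₂) * q + b f) % M .p 0)) 1) ψ := by
  have hc (i : ℕ) : (cellAux i).val (F.enc M) = σ + i := by rw [val_cellAux, hσ]
  have hw' : (4 * var .n).val (F.enc M) = w := by simp [hw]
  have hpv : (var .p).val (F.enc M) = M .p 0 := by simp
  have h1v : (1 : Expr).val (F.enc M) = 1 := rfl
  obtain ⟨o1, o2, o3, o4⟩ := hO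
  unfold QRam.wordStep prepare
  simp only [List.cons_append, List.nil_append, List.reverse_cons, List.reverse_nil]
  refine Det.seqList_load (hc _) hpv ?_
  refine Det.seqList_load (hc _) h1v ?_
  refine Det.seqList_load (hc _) hq ?_
  refine Det.seqList_arith h₁ h₂ (hc _) hw' hbd ?_
  refine Det.seqList_arith (hc _) (hc _) (hc _) hw' hbd ?_
  refine Det.seqList_arith (hc _) hf (hc _) hw' hbd ?_
  refine Det.seqList_arith (hc _) (hc _) ht hw' hbd ?_
  refine Det.seqList_arith (hc _) hf (hc _) hw' hbd ?_
  refine Det.seqList_arith (hc _) (hc _) (hc _) hw' hbd ?_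
  refine Det.seqList_arith h₁ h₂ (hc _) hw' hbd ?_
  refine Det.seqList_load (hc _) hq ?_
  refine Det.seqList_load (hc _) h1v ?_
  refine Det.seqList_load (hc _) hpv ?_
  refine Det.skip ⟨rfl, rfl, ?_⟩
  conv_lhs => rw [← extend_self ψ]
  rw [extend_loadK_extend, extend_loadK_extend, extend_loadK_extend,
    extend_arithK_extend (by omega) (by omega), extend_arithK_extend (by omega) (by omega),
    extend_arithK_extend (by omega) (by omega), extend_arithK_extend (by omega) (by omega),
    extend_arithK_extend (by omega) (by omega), extend_arithK_extend (by omega) (by omega),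
    extend_arithK_extend (by omega) (by omega), extend_loadK_extend, extend_loadK_extend,
    extend_loadK_extend]
  refine extend_congr hψ fun b hb => ?_
  obtain ⟨x1, x2, x3, x4, x5⟩ := hX b hb
  rw [← wordStepF b ⟨o1, o2, o3, o4⟩ x1 hp hqw x2 x3 x4 x5 hw1]
  rfl

end Frame
end QRam

namespace QRam

/-! ## The oracle on superpositions of words -/

/-- Add the first `len` entries of `h` to the cells from `t` on. -/
noncomputable def xorWords (t len : ℕ) (h : ℕ → ℕ) (b : Basis) : Basis :=
  setCells t len (fun j => b (t + j) ^^^ h j) b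

theorem xorWords_apply (t len : ℕ) (h : ℕ → ℕ) (b : Basis) (a : ℕ) :
    xorWords t len h b a = if t ≤ a ∧ a < t + len then b a ^^^ h (a - t) else b a := by
  rw [xorWords, setCells_apply]
  split_ifs with h
  · rw [Nat.add_sub_cancel' h.1]
  · rfl

theorem xorWords_zero (t : ℕ) (h : ℕ → ℕ) (b : Basis) : xorWords t 0 h b = b := rfl

/-- The contents of the cells of the coordinates. -/
def coords (β k : ℕ) (b : Basis) (i : Fin k) : ℕ := b (β + 1 + i)

/-- The coordinates are smaller than `2 ^ n`, and the scratch cells are zero. -/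
structure Ready (β k n : ℕ) (b : Basis) : Prop where
  lt : ∀ i < k, b (β + 1 + i) < 2 ^ n
  zero : ∀ i < 7, b (β + 1 + k + i) = 0

/-- The coordinates are smaller than `2 ^ n`, and the cells behind are zero. -/
structure Prepared (β k n : ℕ) (b : Basis) : Prop where
  lt : ∀ i < k, b (β + 1 + i) < 2 ^ n
  base : b β = 0
  zero : ∀ a, β + 1 + k ≤ a → b a = 0

theorem Prepared.ready {β k n : ℕ} {b : Basis} (h : Prepared β k n b) : Ready β k n b :=
  ⟨h.lt, fun _ _ => h.zero _ (by omega)⟩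

theorem Ready.congr {β k n : ℕ} {b b' : Basis} (h : Ready β k n b)
    (hb : ∀ a, β < a → a < β + 1 + k + 7 → b' a = b a) : Ready β k n b' :=
  ⟨fun i hi => by rw [hb _ (by omega) (by omega)]; exact h.lt i hi,
    fun i hi => by rw [hb _ (by omega) (by omega)]; exact h.zero i hi⟩

theorem coords_congr {β k : ℕ} {b b' : Basis} (hb : ∀ a, β < a → a < β + 1 + k + 7 → b' a = b a) :
    coords β k b' = coords β k b := funext fun i => hb _ (by omega) (by omega)

/-- The parameters of the group and of the algorithm that are kept in memory. -/
structure Params (p m d n : ℕ) (M : Mem) : Prop where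
  hp : M .p 0 = p
  hm : M .m 0 = m
  hd : M .d 0 = d
  hn : M .n 0 = n
  hN : M .N 0 = 2 ^ n

theorem Params.agree {p m d n : ℕ} {l : List Name} {M M' : Mem} (h : Params p m d n M)
    (ha : Mem.Agree l M M') (hl : ∀ x ∈ [Name.p, .m, .d, .n, .N], x ∉ l) : Params p m d n M' := by
  constructor
  · rw [ha _ (hl _ (by simp)), h.hp]
  · rw [ha _ (hl _ (by simp)), h.hm]
  · rw [ha _ (hl _ (by simp)), h.hd]
  · rw [ha _ (hl _ (by simp)), h.hn]
  · rw [ha _ (hl _ (by simp)), h.hN]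

/-- The bounds that the parameters satisfy. -/
class Sizes (F : Frame) (p m d n : ℕ) : Prop where
  two_le : 2 ≤ p
  large : 100 * (m + d + 6) ^ 2 * p ^ 2 ≤ 2 ^ n
  width : 4 * n ≤ F.bound
  loops : m + d + 6 ≤ F.bound

namespace Frame

variable {F : Frame} {p m d n : ℕ}

namespace Sizes

variable (F) (p m d n) [hS : Sizes F p m d n]

include hS

theorem mul_lt : 100 * ((m + d + 6) * p) < 2 ^ n := by
  have h1 := hS.large
  have h2 := hS.two_le
  have h3 : 12 ≤ (m + d + 6) * p := by nlinarith
  have h4 : (m + d + 6) ^ 2 * p ^ 2 = ((m + d + 6) * p) * ((m + d + 6) * p) := by ring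
  rw [mul_assoc, h4] at h1
  nlinarith

theorem p_lt : 600 * p < 2 ^ n := by
  have h1 := mul_lt F p m d n
  nlinarith [hS.two_le]

theorem len_lt : 200 * (m + d + 6) < 2 ^ n := by
  have h1 := mul_lt F p m d n
  nlinarith [hS.two_le]

theorem pow_le_width : 2 ^ (4 * n) ≤ 2 ^ F.bound := Nat.pow_le_pow_right (by omega) hS.width

omit hS in
theorem pow_eq : 2 ^ (4 * n) = 2 ^ n * 2 ^ n * 2 ^ n * 2 ^ n := by
  rw [← pow_add, ← pow_add, ← pow_add]; congr 1; omega

theorem n_le : n ≤ F.bound := by have := hS.width; omega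

theorem sq_lt : 2 ^ n * 2 ^ n * 600 < 2 ^ F.bound := by
  have h1 := pow_le_width F p m d n
  have h2 := p_lt F p m d n
  rw [pow_eq] at h1
  have h3 := hS.two_le
  have h5 : 1200 < 2 ^ n := by omega
  have h6 : 2 ^ n * 2 ^ n * 2 ^ n * 1200 ≤ 2 ^ n * 2 ^ n * 2 ^ n * 2 ^ n :=
    Nat.mul_le_mul_left _ h5.le
  nlinarith [Nat.mul_le_mul_left (2 ^ n * 2 ^ n) h5.le]

/-- Numbers below `600 * 4 ^ n` fit into the registers. -/
theorem lt_of_lt_sq {x : ℕ} (h : x < 2 ^ n * 2 ^ n * 600) : x < 2 ^ F.bound :=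
  h.trans (sq_lt F p m d n)

theorem lt_of_le {x : ℕ} (h : x ≤ 2 ^ n * 2 ^ n) : x < 2 ^ F.bound := by
  refine lt_of_lt_sq F p m d n (lt_of_le_of_lt h ?_)
  have := p_lt F p m d n
  nlinarith

theorem lt_of_le' {x : ℕ} (h : x ≤ 2 ^ n) : x < 2 ^ F.bound := by
  refine lt_of_le F p m d n (h.trans (Nat.le_mul_of_pos_right _ (by positivity)))

end Sizes

variable [F.Valid]

/-- Each letter depends on the coordinates only, and these lie before the cells that are written.
Hence the order of the letters is immaterial, and the invariant records that the letters from `i` on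
have been added. -/
theorem Det.wordLoop {e : Expr} {c : Com} {M : Mem} {ψ : Ket} {κ β k t len : ℕ}
    (h : (Fin k → ℕ) → ℕ → ℕ) (he : e.val (F.enc M) = len) (hlen : len ≤ F.bound)
    (ht : β + 1 + k + 7 ≤ t) (hψ : Within (Ready β k n) ψ)
    (hc : ∀ i < len, ∀ M' ψ', Mem.Agree [.i] M M' → M' .i 0 = i → Within (Ready β k n) ψ' →
      F.Det c M' ψ' κ fun M'' ψ'' κ' => M'' = M' ∧ κ' = κ ∧ ψ'' = extend (fun b =>
        Finsupp.single (b.update (t + i) (b (t + i) ^^^ h (coords β k b) i)) 1) ψ') :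
    F.Det (QRam.forDown .i e c) M ψ κ fun M' ψ' κ' => Mem.Agree [.i] M M' ∧ κ' = κ ∧
      ψ' = extend (fun b => Finsupp.single (xorWords t len (h (coords β k b)) b) 1) ψ := by
  refine (Det.forDown (x := .i) (n := len) (fun i M' ψ' κ' => Mem.Agree [.i] M M' ∧ κ' = κ ∧ ψ' = extend
    (fun b => Finsupp.single (xorWords (t + i) (len - i) (fun j => h (coords β k b) (i + j)) b) 1) ψ)
    he hlen ⟨(Mem.Agree.refl _ _).set (by simp) _ _, rfl, ?_⟩ ?_).mono ?_
  · simp only [Nat.sub_self, xorWords_zero, extend_self]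
  · rintro i hi M' ψ' κ' hM' ⟨hag, rfl, rfl⟩
    refine (hc i hi _ _ (hag.set (by simp) 0 i) (by simp) ?_).mono ?_
    · refine hψ.extend fun b hb => Within.single (hb.congr fun a h1 h2 => ?_) _
      rw [xorWords_apply, if_neg (by omega)]
    · rintro M'' ψ'' κ' ⟨rfl, rfl, rfl⟩
      refine ⟨by simp, hag.set (by simp) 0 i, rfl, ?_⟩
      rw [extend_extend]
      congr 1
      funext b
      rw [extend_single, one_smul]
      congr 1
      rw [coords_congr (b := b) (b' := xorWords (t + (i + 1)) _ _ b) fun a h1 h2 => by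
        rw [xorWords_apply, if_neg (by omega)]]
      ext a
      simp only [Finsupp.coe_update, Function.update_apply, xorWords_apply]
      by_cases ha : a = t + i
      · subst ha
        rw [if_pos rfl, if_neg (by omega), if_pos (by omega)]
        simp
      · rw [if_neg ha]
        by_cases h' : t + i ≤ a ∧ a < t + i + (len - i)
        · rw [if_pos h', if_pos (by omega)]
          congr 2; omega
        · rw [if_neg h', if_neg (by omega)]
  · rintro M' ψ' κ' ⟨-, h1, h2, h3⟩
    refine ⟨h1, h2, ?_⟩
    rw [h3]; simp

end Frame

/-- Invoke an oracle for a word that is computed and afterwards erased. -/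
def withWord (compute oracle : Com) : Com := .seq compute (.seq oracle compute)

namespace Frame

variable {F : Frame} {p m d n : ℕ} [F.Valid]

omit [F.Valid] in
-- The second computation adds the same word modulo 2 and thereby erases it; a word left behind
-- would be entangled with the coordinates and spoil the interference. The assumption on `compute`
-- is made for `Ready` and not for `Prepared`, since at the second call the cell `β` and the cells
-- of the word are occupied.
theorem Det.withWord {compute oracle : Com} {M : Mem} {ψ : Ket} {κ κ₁ β k len : ℕ}
    (h : (Fin k → ℕ) → ℕ → ℕ) (hψ : Within (Prepared β k n) ψ) {vec : (ℕ → ℕ) → ℕ →₀ ℂ}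
    (K : Basis → Ket)
    (hK : ∀ b, Prepared β k n b → K (xorWords (β + 1 + k + 7) len (h (coords β k b)) b) =
      (vec (h (coords β k b))).mapDomain
        ((xorWords (β + 1 + k + 7) len (h (coords β k b)) b).update β))
    (hcompute : ∀ M' ψ' κ', Mem.Agree [.i] M M' → Within (Ready β k n) ψ' →
      F.Det compute M' ψ' κ' fun M'' ψ'' κ'' => Mem.Agree [.i] M' M'' ∧ κ'' = κ' ∧
        ψ'' = extend (fun b => Finsupp.single
          (xorWords (β + 1 + k + 7) len (h (coords β k b)) b) 1) ψ')
    (horacle : ∀ M' ψ', Mem.Agree [.i] M M' →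
      F.Det oracle M' ψ' κ fun M'' ψ'' κ' => M'' = M' ∧ κ' = κ₁ ∧ ψ'' = extend K ψ') :
    F.Det (QRam.withWord compute oracle) M ψ κ fun M' ψ' κ' => Mem.Agree [.i] M M' ∧ κ' = κ₁ ∧
      ψ' = extend (oracleOp β k fun x => vec (h x)) ψ := by
  refine (hcompute M ψ κ (Mem.Agree.refl _ _) (hψ.mono fun b hb => hb.ready)).seq ?_
  rintro M₁ ψ₁ κ' ⟨ha, rfl, h₁⟩
  refine (horacle M₁ ψ₁ ha).seq ?_
  rintro M₂ ψ₂ κ'' ⟨rfl, rfl, h₂⟩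
  have h₃ : ψ₂ = extend (fun b => (vec (h (coords β k b))).mapDomain
      ((xorWords (β + 1 + k + 7) len (h (coords β k b)) b).update β)) ψ := by
    rw [h₂, h₁, extend_extend]
    refine extend_congr hψ fun b hb => ?_
    rw [extend_single, one_smul, hK b hb]
  have hup (b : Basis) (z : ℕ) (f : ℕ → ℕ) (a : ℕ) (h1 : β < a) (h2 : a < β + 1 + k + 7) :
      (xorWords (β + 1 + k + 7) len f b).update β z a = b a := by
    rw [Finsupp.coe_update, Function.update_of_ne h1.ne', xorWords_apply, if_neg (by omega)]
  refine (hcompute M₂ ψ₂ κ'' ha ?_).mono ?_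
  · rw [h₃]
    exact hψ.extend fun b hb => Within.sum fun z _ =>
      Within.single (hb.ready.congr fun a h1 h2 => hup _ _ _ _ h1 h2) _
  · rintro M₃ ψ₃ κ₃ ⟨ha', rfl, h₄⟩
    refine ⟨ha.trans ha' (by simp), rfl, ?_⟩
    rw [h₄, h₃, extend_extend]
    refine extend_congr hψ fun b hb => ?_
    rw [extend_mapDomain, oracleOp]
    refine Finset.sum_congr rfl fun z _ => ?_
    dsimp only
    rw [Finsupp.smul_single, smul_eq_mul, mul_one, coords_congr (b := b) (hup _ _ _)]
    congr 1
    ext a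
    simp only [xorWords_apply, Finsupp.coe_update, Function.update_apply]
    by_cases ha : a = β
    · rw [if_pos ha, if_pos ha, if_neg (by omega)]
    · rw [if_neg ha, if_neg ha]
      split_ifs
      · rw [Nat.xor_assoc, Nat.xor_self, Nat.xor_zero]
      · rfl

end Frame

/-! ## The words of the two oracles -/

/-- The word `x_1^{a_1} ⋯ x_m^{a_m}`. -/
def abelianWord (p m : ℕ) (x : Fin m → ℕ) (i : ℕ) : ℕ := if h : i < m then x ⟨i, h⟩ % p else 0

/-- The word with the letters `t v_i` and `t ^ 2 v_i + a_i`. -/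
def quadraticWord (p m d : ℕ) (v : ℕ → ℕ) (x : Fin (d + 1) → ℕ) (i : ℕ) : ℕ :=
  if i < m then x 0 * v i % p else
    if h : i - m < d then (x 0 * x 0 * v i + x ⟨i - m + 1, by omega⟩) % p else 0

/-- Compute `abelianWord`. -/
def computeAbelian : Com :=
  forDown .i (var .m) (wordStep (cellX (var .i)) (cellAux 1) (cellAux 6) 1 (cellW (var .i)))

/-- Compute `quadraticWord`. -/
def computeQuadratic : Com :=
  .seq
    (forDown .i (var .m)
      (wordStep (cellX 0) (cellAux 1) (cellAux 6) (ix .V (var .i)) (cellW (var .i))))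
    (forDown .i (var .d)
      (wordStep (cellX 0) (cellX 0) (cellX (var .i + 1)) (ix .V (var .m + var .i))
        (cellW (var .m + var .i))))

namespace Frame

variable {F : Frame} {p m d n : ℕ} [F.Valid] [hS : Sizes F p m d n]

theorem Det.computeAbelian {M : Mem} {ψ : Ket} {κ β : ℕ} (hM : Params p m d n M)
    (hβ : M .base 0 = β) (hk : M .k 0 = m) (hψ : Within (Ready β m n) ψ) :
    F.Det QRam.computeAbelian M ψ κ fun M' ψ' κ' => Mem.Agree [.i] M M' ∧ κ' = κ ∧
      ψ' = extend (fun b => Finsupp.single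
        (xorWords (β + 1 + m + 7) m (abelianWord p m (coords β m b)) b) 1) ψ := by
  have h1 := Sizes.p_lt F p m d n
  have h2 := Sizes.pow_eq n
  have h3 := hS.loops
  have h0 := hS.two_le
  have h4 : 2 ^ n ≤ 2 ^ (4 * n) := Nat.pow_le_pow_right (by omega) (by omega)
  refine Det.wordLoop (n := n) (len := m) (fun x => abelianWord p m x) (by simp [hM.hm]) (by omega) le_rfl hψ ?_
  intro i hi M' ψ' ha hi' hψ'
  have hM' := hM.agree ha (by decide)
  have hβ' : M' .base 0 = β := by rw [ha _ (by decide), hβ]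
  have hk' : M' .k 0 = m := by rw [ha _ (by decide), hk]
  -- The general step with second factor 1, multiplier 1 and summand 0 just reduces a coordinate
  -- modulo `p`.
  refine (Det.wordStep (σ := β + 1 + m) (a₁ := β + 1 + i) (a₂ := β + 1 + m + 1)
    (f := β + 1 + m + 6) (q := 1) (t := β + 1 + m + 7 + i) (w := 4 * n) (by rw [hβ', hk'])
    (by rw [hM'.hn]) (by simp [hβ', hi']) (by simp [hβ', hk']) (by simp [hβ', hk']) (by simp)
    (by simp [hβ', hk', hi']) ⟨by omega, by omega, by omega, by omega⟩ hS.width hψ' ?_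
    (by rw [hM'.hp]; omega) (by omega) (by omega)).mono ?_
  · intro b hb
    have h5 := hb.lt i hi
    have h6 := hb.zero 1 (by omega)
    have h7 := hb.zero 6 (by omega)
    refine ⟨fun j hj => hb.zero j (by omega), by omega, by omega, ?_, ?_⟩
    · simp; omega
    · simp [h7]; omega
  · rintro M'' ψ'' κ' ⟨rfl, rfl, rfl⟩
    refine ⟨rfl, rfl, extend_congr hψ' fun b hb => ?_⟩
    have h7 := hb.zero 6 (by omega)
    rw [if_pos rfl, mul_one, mul_one, h7, add_zero, hM'.hp, abelianWord, dif_pos hi]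
    rfl

theorem Det.computeQuadratic {M : Mem} {ψ : Ket} {κ β : ℕ} {v : ℕ → ℕ} (hM : Params p m d n M)
    (hβ : M .base 0 = β) (hk : M .k 0 = d + 1) (hv : ∀ i < m + d, v i < p)
    (hV : ∀ i < m + d, M .V i = v i) (hψ : Within (Ready β (d + 1) n) ψ) :
    F.Det QRam.computeQuadratic M ψ κ fun M' ψ' κ' => Mem.Agree [.i] M M' ∧ κ' = κ ∧
      ψ' = extend (fun b => Finsupp.single (xorWords (β + 1 + (d + 1) + 7) (m + d)
        (quadraticWord p m d v (coords β (d + 1) b)) b) 1) ψ := by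
  have h1 := Sizes.p_lt F p m d n
  have h2 := Sizes.pow_eq n
  have h3 := hS.loops
  have h0 := hS.two_le
  have h4 : 2 ^ n * 2 ^ n ≤ 2 ^ (4 * n) := by
    rw [← pow_add]; exact Nat.pow_le_pow_right (by omega) (by omega)
  have h4' : 2 ^ n * 2 ^ n * 2 ^ n + 2 ^ n ≤ 2 ^ (4 * n) := by
    have e1 : 2 ^ n * 2 ^ n * 2 ^ n * 2 ≤ 2 ^ n * 2 ^ n * 2 ^ n * 2 ^ n :=
      Nat.mul_le_mul_left _ (by omega)
    have e2 : 2 ^ n ≤ 2 ^ n * (2 ^ n * 2 ^ n) := Nat.le_mul_of_pos_right _ (by positivity)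
    rw [h2]; nlinarith
  have h4'' : 2 ^ n ≤ 2 ^ (4 * n) := Nat.pow_le_pow_right (by omega) (by omega)
  have key₁ : F.Det (QRam.forDown .i (var .m)
      (QRam.wordStep (cellX 0) (cellAux 1) (cellAux 6) (ix .V (var .i)) (cellW (var .i)))) M ψ κ
      fun M' ψ' κ' => Mem.Agree [.i] M M' ∧ κ' = κ ∧
      ψ' = extend (fun b => Finsupp.single (xorWords (β + 1 + (d + 1) + 7) m
        (quadraticWord p m d v (coords β (d + 1) b)) b) 1) ψ := by
    refine Det.wordLoop (n := n) (len := m) (fun x => quadraticWord p m d v x) (by simp [hM.hm]) (by omega)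
      le_rfl hψ ?_
    intro i hi M' ψ' ha hi' hψ'
    have hM' := hM.agree ha (by decide)
    have hβ' : M' .base 0 = β := by rw [ha _ (by decide), hβ]
    have hk' : M' .k 0 = d + 1 := by rw [ha _ (by decide), hk]
    have hVi : M' .V i = v i := by rw [ha _ (by decide), hV i (by omega)]
    have hvi := hv i (by omega)
    refine (Det.wordStep (σ := β + 1 + (d + 1)) (a₁ := β + 1 + 0) (a₂ := β + 1 + (d + 1) + 1)
      (f := β + 1 + (d + 1) + 6) (q := v i) (t := β + 1 + (d + 1) + 7 + i) (w := 4 * n)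
      (by rw [hβ', hk']) (by rw [hM'.hn]) (by simp [hβ']) (by simp [hβ', hk']) (by simp [hβ', hk'])
      (by simp [hi', hVi]) (by simp [hβ', hk', hi']) ⟨by omega, by omega, by omega, by omega⟩
      hS.width hψ' ?_ (by rw [hM'.hp]; omega) (by omega) (by omega)).mono ?_
    · intro b hb
      have h5 := hb.lt 0 (by omega)
      have h6 := hb.zero 1 (by omega)
      have h7 := hb.zero 6 (by omega)
      refine ⟨fun j hj => hb.zero j (by omega), by omega, by omega, ?_, ?_⟩
      · rw [if_pos rfl]; omega
      · rw [if_pos rfl, h7, add_zero, mul_one]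
        exact lt_of_lt_of_le (Nat.mul_lt_mul'' h5 (hvi.trans (by omega))) h4
    · rintro M'' ψ'' κ' ⟨rfl, rfl, rfl⟩
      refine ⟨rfl, rfl, extend_congr hψ' fun b hb => ?_⟩
      have h7 := hb.zero 6 (by omega)
      rw [if_pos rfl, mul_one, h7, add_zero, hM'.hp, quadraticWord, if_pos hi]
      rfl
  refine key₁.seq ?_
  rintro M₁ ψ₁ κ' ⟨ha₁, rfl, h₁⟩
  have hM₁ := hM.agree ha₁ (by decide)
  have hβ₁ : M₁ .base 0 = β := by rw [ha₁ _ (by decide), hβ]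
  have hk₁ : M₁ .k 0 = d + 1 := by rw [ha₁ _ (by decide), hk]
  have hψ₁ : Within (Ready β (d + 1) n) ψ₁ := by
    rw [h₁]
    refine hψ.extend fun b hb => Within.single (hb.congr fun a h1 h2 => ?_) _
    rw [xorWords_apply, if_neg (by omega)]
  refine (Det.wordLoop (n := n) (len := d) (t := β + 1 + (d + 1) + 7 + m)
    (fun x i => quadraticWord p m d v x (m + i)) (by simp [hM₁.hd]) (by omega) (by omega) hψ₁
    (κ := κ') ?_).mono ?_
  · intro i hi M' ψ' ha hi' hψ'
    have hM' := hM₁.agree ha (by decide)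
    have hβ' : M' .base 0 = β := by rw [ha _ (by decide), hβ₁]
    have hk' : M' .k 0 = d + 1 := by rw [ha _ (by decide), hk₁]
    have hVi : M' .V (m + i) = v (m + i) := by
      rw [ha _ (by decide), ha₁ _ (by decide), hV _ (by omega)]
    have hvi := hv (m + i) (by omega)
    have hne : β + 1 + 0 ≠ β + 1 + (d + 1) + 1 := by omega
    -- Using the coordinate 0 for both factors produces the square of `t`; coordinate `i + 1` is the
    -- summand `a_i`.
    refine (Det.wordStep (σ := β + 1 + (d + 1)) (a₁ := β + 1 + 0) (a₂ := β + 1 + 0)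
      (f := β + 1 + (i + 1)) (q := v (m + i)) (t := β + 1 + (d + 1) + 7 + m + i) (w := 4 * n)
      (by rw [hβ', hk']) (by rw [hM'.hn]) (by simp [hβ']) (by simp [hβ']) (by simp [hβ', hi'])
      (by simp [hi', hVi, hM'.hm]) (by simp [hβ', hk', hi', hM'.hm, add_assoc])
      ⟨by omega, by omega, by omega, by omega⟩
      hS.width hψ' ?_ (by rw [hM'.hp]; omega) (by omega) (by omega)).mono ?_
    · intro b hb
      have h5 := hb.lt 0 (by omega)
      have h6 := hb.lt (i + 1) (by omega)
      have h7 := Nat.mul_lt_mul'' h5 h5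
      refine ⟨fun j hj => hb.zero j (by omega), by omega, by omega, ?_, ?_⟩
      · rw [if_neg hne]; omega
      · rw [if_neg hne]
        have := Nat.mul_lt_mul'' h7 (show v (m + i) < 2 ^ n by omega)
        omega
    · rintro M'' ψ'' κ' ⟨rfl, rfl, rfl⟩
      refine ⟨rfl, rfl, extend_congr hψ' fun b hb => ?_⟩
      rw [if_neg hne, hM'.hp, quadraticWord, if_neg (by omega), dif_pos (by omega)]
      simp [coords]
  · rintro M' ψ' κ'' ⟨ha, rfl, h₂⟩
    refine ⟨ha₁.trans ha (by simp), rfl, ?_⟩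
    rw [h₂, h₁, extend_extend]
    congr 1
    funext b
    rw [extend_single, one_smul]
    congr 1
    rw [coords_congr (b := b) (b' := xorWords _ _ _ b) fun a h1 h2 => by
      rw [xorWords_apply, if_neg (by omega)]]
    ext a
    simp only [xorWords_apply]
    by_cases h' : β + 1 + (d + 1) + 7 + m ≤ a ∧ a < β + 1 + (d + 1) + 7 + m + d
    · rw [if_pos h', if_neg (by omega), if_pos (by omega)]
      congr 2; omega
    · rw [if_neg h']
      congr 1
      simp only [eq_iff_iff]; omega

end Frame
end QRam

namespace QRam

theorem Mem.Agree.weaken {l l' : List Name} {M M' : Mem} (h : Agree l M M') (hl : l ⊆ l') :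
    Agree l' M M' := fun x hx => h x fun h => hx (hl h)

/-! ## Fourier sampling -/

/-- Prepare the uniform superposition of the coordinates. -/
def hadamards : Com :=
  forDown .i (var .k) (forDown .j (var .n)
    (.hadamard (cellX (var .k - 1 - var .i)) (var .n - 1 - var .j)))

/-- Correct the phases after the outcome `1`. -/
def correct : Com :=
  .seq (.load (cellX (var .i)) (var .N / (2 * var .e)))
    (.seq (put .y 0 (var .y + var .e))
      (forDown .l (var .j) (.phase (cellX (var .i)) (var .l) (var .j - var .l + 1))))

/-- Measure one coordinate in the Fourier basis. -/
def measureCell : Com :=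
  .seq (put .y 0 0) (.seq (put .e 0 1) (forDown .j (var .n)
    (.seq (.hadamard (cellX (var .i)) (var .j))
      (.seq (.measure (cellX (var .i)) (var .j) (adr .bit 0))
        (.seq (.ite (var .bit) correct .skip) (put .e 0 (2 * var .e)))))))

/-- Measure the coordinates in the Fourier basis. -/
def measureCells : Com :=
  forDown .i (var .k) (.seq measureCell (put .U (var .i) (var .y)))

/-- Round the outcomes to multiples of `2 ^ n / p`. -/
def roundOutcomes : Com :=
  forDown .i (var .k) (put .U (var .i)
    (((2 * var .p * ix .U (var .i) + var .N) / (2 * var .N)) % var .p))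

/-- One round of Fourier sampling. -/
def sample (word : Com) : Com :=
  .seq hadamards (.seq word (.seq measureCells (.seq roundOutcomes
    (put .base 0 (var .base + 1)))))

theorem within_hadCells {β n k : ℕ} {b : Basis} (hb : Fresh β b) :
    Within (Prepared β k n) (hadCells (β + 1) n k b) := by
  refine Within.smul (Within.sum fun x _ => Within.single ⟨fun i hi => ?_, ?_, fun a ha => ?_⟩ _) _
  · rw [setCells_apply, if_pos (by omega), Nat.add_sub_cancel_left, padded, dif_pos hi]
    exact (x ⟨i, hi⟩).isLt
  · rw [setCells_apply, if_neg (by omega)]; exact hb _ le_rfl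
  · rw [setCells_apply, if_neg (by omega)]; exact hb _ (by omega)

theorem sum_range_two_mul (a : ℕ) (f : ℕ → ℝ) :
    ∑ i ∈ Finset.range (2 * a), f i = ∑ i ∈ Finset.range a, (f (2 * i) + f (2 * i + 1)) := by
  induction a with
  | zero => simp
  | succ a ih => rw [mul_add, Finset.sum_range_succ, Finset.sum_range_succ, ih,
      Finset.sum_range_succ]; ring

/-! ### Correctness of one round of Fourier sampling -/

namespace Frame

variable {F : Frame} {p m d n : ℕ} [F.Valid]

theorem Det.hadamardCell {M : Mem} {ψ : Ket} {κ c : ℕ} {e : Expr} (hn : M .n 0 = n)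
    (hb : n ≤ F.bound) (he : ∀ M', Mem.Agree [.j] M M' → e.val (F.enc M') = c)
    (hψ : Within (fun b => b c = 0) ψ) :
    F.Det (QRam.forDown .j (var .n) (.hadamard e (var .n - 1 - var .j))) M ψ κ
      fun M' ψ' κ' => Mem.Agree [.j] M M' ∧ κ' = κ ∧ ψ' = extend (hadOp c n) ψ := by
  refine (Det.forDown (n := n) (fun i M' ψ' κ' => Mem.Agree [.j] M M' ∧ κ' = κ ∧
    ψ' = extend (hadOp c (n - i)) ψ) (by simp [hn]) hb
    ⟨(Mem.Agree.refl _ _).set (by simp) _ _, rfl, ?_⟩ ?_).mono ?_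
  · rw [Nat.sub_self, extend_congr hψ fun b hb => hadOp_zero hb, extend_self]
  · rintro i hi M' ψ' κ' - ⟨ha, rfl, rfl⟩
    have ha' : Mem.Agree [.j] M (M'.set .j 0 i) := ha.set (by simp) _ _
    have hn' : M' .n 0 = n := by rw [ha _ (by decide), hn]
    refine Det.hadamard ⟨by simp, ha', rfl, ?_⟩
    rw [he _ ha', extend_extend]
    congr 1
    funext b
    have h1 : (var .n - 1 - var .j).val (F.enc (M'.set .j 0 i)) = n - (i + 1) := by
      simp [hn']; omega
    rw [h1, extend_hadamardK_hadOp]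
    congr 1; omega
  · rintro M' ψ' κ' ⟨-, h1, h2, h3⟩
    exact ⟨h1, h2, by rw [h3, Nat.sub_zero]⟩

theorem Det.hadamards {M : Mem} {ψ : Ket} {κ β k : ℕ} (hn : M .n 0 = n) (hbn : n ≤ F.bound)
    (hk : M .k 0 = k) (hbk : k ≤ F.bound) (hβ : M .base 0 = β) (hψ : Within (Fresh β) ψ) :
    F.Det QRam.hadamards M ψ κ fun M' ψ' κ' => Mem.Agree [.i, .j] M M' ∧ κ' = κ ∧
      ψ' = extend (hadCells (β + 1) n k) ψ := by
  refine (Det.forDown (n := k) (fun i M' ψ' κ' => Mem.Agree [.i, .j] M M' ∧ κ' = κ ∧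
    ψ' = extend (hadCells (β + 1) n (k - i)) ψ) (by simp [hk]) hbk
    ⟨(Mem.Agree.refl _ _).set (by simp) _ _, rfl, ?_⟩ ?_).mono ?_
  · rw [Nat.sub_self, show hadCells (β + 1) n 0 = fun b => Finsupp.single b 1 from
      funext (hadCells_zero _ _), extend_self]
  · rintro i hi M' ψ' κ' - ⟨ha, rfl, rfl⟩
    have ha' : Mem.Agree [.i, .j] M (M'.set .i 0 i) := ha.set (by simp) _ _
    refine (Det.hadamardCell (n := n) (c := β + 1 + (k - (i + 1)))
      (by rw [ha' _ (by decide), hn]) hbn (fun M'' ha'' => ?_) ?_).mono ?_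
    · rw [val_cellX, ha'' _ (by decide), ha' _ (by decide), hβ]
      simp only [Expr.val_sub, val_var, Expr.val_ofNat]
      rw [ha'' _ (by decide), ha' _ (by decide), hk, ha'' _ (by decide)]
      simp; omega
    · refine hψ.extend fun b hb => Within.smul (Within.sum fun x _ => Within.single ?_ _) _
      rw [setCells_apply, if_neg (by omega)]; exact hb _ (by omega)
    · rintro M'' ψ'' κ'' ⟨h1, rfl, rfl⟩
      refine ⟨by rw [h1 _ (by decide)]; simp, ha'.trans h1 (by simp), rfl, ?_⟩
      rw [extend_extend]
      congr 1
      funext b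
      rw [extend_hadOp_hadCells]
      congr 1; omega
  · rintro M' ψ' κ' ⟨-, h1, h2, h3⟩
    exact ⟨h1, h2, by rw [h3, Nat.sub_zero]⟩

theorem Det.correct {M : Mem} {ψ : Ket} {κ c l j y : ℕ} (hj : l + j + 1 = n)
    (hb : n ≤ F.bound) (hN : M .N 0 = 2 ^ n) (he : M .e 0 = 2 ^ l) (hj' : M .j 0 = j)
    (hc : (cellX (var .i)).val (F.enc M) = c) (hy : M .y 0 = y) (hlt : y < 2 ^ l) :
    F.Det QRam.correct M (extend (measureK c j true) (extend (hadamardK c j)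
      (extend (measOp n c l y) ψ))) κ fun M' ψ' κ' => Mem.Agree [.y, .l] M M' ∧ κ' = κ ∧
        M' .y 0 = y + 2 ^ l ∧ ψ' = extend (measOp n c (l + 1) (y + 2 ^ l)) ψ := by
  set φ := extend (measureK c j true) (extend (hadamardK c j) (extend (measOp n c l y) ψ)) with hφ
  rw [extend_extend (hadamardK c j), extend_extend (measOp n c l y)] at hφ
  have h1 : (var .N / (2 * var .e)).val (F.enc M) = 2 ^ j := by
    simp only [Expr.val_div, val_var, Expr.val_mul, Expr.val_ofNat, hN, he]
    rw [← hj, ← pow_succ', Nat.pow_div (by omega) (by norm_num)]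
    congr 1; omega
  refine (Det.load (Q := fun M' ψ' κ' => M' = M ∧ κ' = κ ∧ ψ' = extend (loadK c (2 ^ j)) φ)
    ⟨rfl, rfl, by rw [hc, h1]⟩).seq ?_
  rintro M₁ ψ₁ κ₁ ⟨rfl, rfl, rfl⟩
  have h2 : (var .y + var .e).val (F.enc M₁) = y + 2 ^ l := by simp [hy, he]
  have h3 : y + 2 ^ l < 2 ^ F.bound := by
    have : 2 ^ (l + 1) ≤ 2 ^ F.bound := Nat.pow_le_pow_right (by norm_num) (by omega)
    rw [pow_succ] at this; omega
  refine ((Cl.put (P := fun M' => M' = M₁.set .y 0 (y + 2 ^ l)) (by rwa [h2])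
    (by rw [h2]; rfl)) _ _).seq ?_
  rintro M₂ ψ₂ κ₂ ⟨rfl, rfl, rfl⟩
  set M₂ := M₁.set .y 0 (y + 2 ^ l) with hM₂
  refine (Det.forDown (n := j) (fun i M' ψ' κ' => Mem.Agree [.l] M₂ M' ∧ κ' = κ₂ ∧
    ψ' = extend (phaseOp c j i) (extend (loadK c (2 ^ j)) φ)) (by simp [hM₂, hj']) (by omega)
    ⟨(Mem.Agree.refl _ _).set (by simp) _ _, rfl, ?_⟩ ?_).mono ?_
  -- After the reset no bit from `j` upwards is set, so the operator `phaseOp` for the empty range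
  -- of bits is the identity.
  · have : Within (fun b => b c < 2 ^ j) (extend (loadK c (2 ^ j)) φ) := by
      rw [hφ, extend_extend]
      refine Within.extend (X := fun _ => True) (fun _ _ => trivial) fun b _ => ?_
      rw [measOp, extend_single, extend_smul, extend_measureK_hadamardK _ (by simp; rfl)
        (by rw [show n - l = j + 1 by omega]; exact Nat.mod_lt _ (by positivity)), extend_single]
      refine ((Within.single ?_ _).smul _).smul _
      simp only [Finsupp.coe_update, Function.update_self, Bool.toNat_true, one_mul]
      rw [add_two_pow_xor (Nat.mod_lt _ (by positivity))]
      exact Nat.mod_lt _ (by positivity)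
    rw [extend_congr this fun b hb => phaseOp_self hb, extend_self]
  · rintro i hi M' ψ' κ' - ⟨ha, rfl, rfl⟩
    have ha' : Mem.Agree [.l] M₂ (M'.set .l 0 i) := ha.set (by simp) _ _
    have h4 : (cellX (var .i)).val (F.enc (M'.set .l 0 i)) = c := by
      rw [← hc, val_cellX, val_cellX, val_var, val_var, ha' _ (by decide), ha' _ (by decide)]
      simp [hM₂]
    have h5 : (var .j - var .l + 1).val (F.enc (M'.set .l 0 i)) = j - i + 1 := by
      simp only [Expr.val_add, Expr.val_sub, val_var, Expr.val_ofNat]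
      rw [ha' .j (by decide)]; simp [hM₂, hj']
    refine Det.phase (by rw [h5]; omega) ⟨by simp, ha', rfl, ?_⟩
    rw [h4, h5, extend_extend]
    congr 1
    funext b
    rw [val_var, Mem.set_same, Function.update_self, extend_phaseK_phaseOp _ hi]
  · rintro M' ψ' κ' ⟨-, h4, rfl, rfl⟩
    refine ⟨?_, rfl, ?_, ?_⟩
    · exact ((Mem.Agree.refl _ _).set (by simp) _ _).trans h4 (by simp)
    · rw [h4 _ (by decide)]; simp [hM₂]
    · rw [hφ, extend_extend, extend_extend]
      congr 1
      funext b
      rw [← measOp_succ_true b hj, extend_extend (loadK c (2 ^ j))]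

/-- The bits of the cell are treated from the highest down, which yields the bits of `y` from the
lowest up. When `i` bits remain, the low `n - i` bits of `y` are known, and the guaranteed
expectation is the sum of `G` over the `2 ^ i` possible completions. -/
theorem Tr.measureCell {M : Mem} {ψ : Ket} {κ β i : ℕ} (hn : M .n 0 = n) (hN : M .N 0 = 2 ^ n)
    (hb : n < F.bound) (hβ : M .base 0 = β) (hi : M .i 0 = i)
    (hψ : Within (fun b => b (β + 1 + i) < 2 ^ n) ψ) (G : ℕ → ℝ) :
    F.Tr QRam.measureCell M ψ κ
      (fun M' ψ' κ' => Mem.Agree [.j, .l, .y, .e, .bit] M M' ∧ κ' = κ ∧ M' .y 0 < 2 ^ n ∧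
        ψ' = extend (measOp n (β + 1 + i) n (M' .y 0)) ψ)
      (fun M' _ _ => G (M' .y 0)) (∑ y ∈ Finset.range (2 ^ n), G y) := by
  set c := β + 1 + i with hc
  have hpos : 1 < 2 ^ F.bound := Nat.one_lt_two_pow (by have := Valid.bound_pos (F := F); omega)
  refine Tr.put_seq (by simp) (Tr.put_seq (by simpa using hpos) ?_)
  simp only [Expr.val_ofNat]
  set M₀ := (M.set .y 0 0).set .e 0 1 with hM₀
  have ha₀ : Mem.Agree [.j, .l, .y, .e, .bit] M M₀ :=
    ((Mem.Agree.refl _ _).set (by simp) _ _).set (by simp) _ _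
  refine (Tr.forDown (n := n) (fun i M' ψ' κ' => Mem.Agree [.j, .l, .y, .e, .bit] M M' ∧ κ' = κ ∧
    M' .e 0 = 2 ^ (n - i) ∧ M' .y 0 < 2 ^ (n - i) ∧
      ψ' = extend (measOp n c (n - i) (M' .y 0)) ψ)
    (fun i M' _ _ => ∑ z ∈ Finset.range (2 ^ i), G (M' .y 0 + z * 2 ^ (n - i)))
    (by simp [hM₀, hn]) hb.le ⟨ha₀.set (by simp) _ _, rfl, by simp [hM₀], by simp [hM₀], ?_⟩
    ?_).mono ?_ (le_of_eq ?_)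
  · simp only [Nat.sub_self]
    have : (M₀.set .j 0 n) .y 0 = 0 := by simp [hM₀]
    rw [this, extend_congr hψ fun b hb => measOp_zero hb, extend_self]
  · rintro j hj M' ψ' κ' - ⟨ha, rfl, he, hy, rfl⟩
    set M₁ := M'.set .j 0 j with hM₁
    have ha₁ : Mem.Agree [.j, .l, .y, .e, .bit] M M₁ := ha.set (by simp) _ _
    have hcell : ∀ M', Mem.Agree [.j, .l, .y, .e, .bit] M M' →
        (cellX (var .i)).val (F.enc M') = c := fun M' h => by
      rw [val_cellX, val_var, h _ (by decide), h _ (by decide), hβ, hi]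
    obtain ⟨l, hl⟩ : ∃ l, l + j + 1 = n := ⟨n - (j + 1), by omega⟩
    have e1 : n - (j + 1) = l := by omega
    have e2 : n - j = l + 1 := by omega
    rw [e1] at he hy
    simp only [e1, e2]
    set y := M' .y 0 with hy'
    refine Tr.seq (Q₁ := fun M'' ψ'' κ'' => M'' = M₁ ∧ κ'' = κ' ∧
      ψ'' = extend (hadamardK c j) (extend (measOp n c l y) ψ))
      (Det.hadamard ⟨rfl, rfl, ?_⟩ _) ?_
    swap
    · rw [hcell _ ha₁]; simp [hM₁]
    rintro _ _ κ₁ ⟨rfl, rfl, rfl⟩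
    refine Tr.seq ((Tr.measure (Q := fun M'' ψ'' κ'' => κ'' = κ₁ ∧ ∃ b : Bool,
      M'' = M₁.set .bit 0 b.toNat ∧ ψ'' = extend (measureK c j b)
        (extend (hadamardK c j) (extend (measOp n c l y) ψ)))
      (g := fun M'' _ _ => ∑ z ∈ Finset.range (2 ^ j),
        G (y + M'' .bit 0 * 2 ^ l + z * 2 ^ (l + 1))) ?_).mono (fun _ _ _ h => ⟨h, le_rfl⟩) ?_) ?_
    · intro b
      refine ⟨rfl, b, rfl, ?_⟩
      rw [hcell _ ha₁]; simp [hM₁]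
    -- The completions with even and odd `z` are those compatible with the outcomes 0 and 1 of the
    -- present measurement.
    · rw [← Finset.sum_add_distrib, pow_succ, mul_comm (2 ^ j), sum_range_two_mul]
      refine Finset.sum_le_sum fun z _ => le_of_eq ?_
      simp only [Mem.set_same, Function.update_self]
      congr 2 <;> ring
    rintro _ _ κ₂ ⟨rfl, b, rfl, rfl⟩
    set M₂ := M₁.set .bit 0 b.toNat with hM₂
    have ha₂ : Mem.Agree [.j, .l, .y, .e, .bit] M M₂ := ha₁.set (by simp) _ _
    refine Tr.seq (Q₁ := fun M'' ψ'' κ'' => Mem.Agree [.y, .l] M₂ M'' ∧ κ'' = κ₂ ∧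
      M'' .y 0 = y + b.toNat * 2 ^ l ∧
        ψ'' = extend (measOp n c (l + 1) (y + b.toNat * 2 ^ l)) ψ) (Det.ite ?_ ?_ _) ?_
    · intro h
      have hb' : b = true := by
        cases b
        · simp [hM₂] at h
        · rfl
      subst hb'
      refine (Det.correct hl (by omega) (by rw [ha₂ _ (by decide), hN]) (by simp [hM₂, hM₁, he])
        (by simp [hM₂, hM₁]) (hcell _ ha₂) (by simp [hM₂, hM₁, hy']) hy).mono ?_
      simp
    · intro h
      have hb' : b = false := by
        cases b
        · rfl
        · simp [hM₂] at h
      subst hb'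
      refine Det.skip ⟨Mem.Agree.refl _ _, rfl, by simp [hM₂, hM₁, hy'], ?_⟩
      simp only [Bool.toNat_false, zero_mul, add_zero]
      rw [extend_extend, extend_extend]
      congr 1
      funext b
      rw [← measOp_succ_false b hl]
    rintro M₃ ψ₃ κ₃ ⟨ha₃, rfl, h3, rfl⟩
    have he₃ : M₃ .e 0 = 2 ^ l := by rw [ha₃ _ (by decide)]; simp [hM₂, hM₁, he]
    have h4 : (2 * var .e).val (F.enc M₃) = 2 ^ (l + 1) := by simp [he₃, pow_succ']
    have h5 : 2 ^ (l + 1) < 2 ^ F.bound := Nat.pow_lt_pow_right (by norm_num) (by omega)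
    have ha₃' : Mem.Agree [.j, .l, .y, .e, .bit] M M₃ := ha₂.trans ha₃ (by simp)
    refine (Cl.put (P := fun M' => M' = M₃.set .e 0 (2 ^ (l + 1))) (by rwa [h4])
      (by rw [h4]; rfl) _ _).tr ?_
    rintro _ _ _ ⟨rfl, rfl, rfl⟩
    refine ⟨⟨?_, ha₃'.set (by simp) _ _, rfl, by simp, ?_, ?_⟩, ?_⟩
    · simp [ha₃ .j (by decide), hM₂, hM₁]
    · rw [Mem.set_ne _ _ _ (by decide), h3, pow_succ]
      cases b <;> simp <;> omega
    · rw [Mem.set_ne _ _ _ (by decide), h3]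
    · rw [Mem.set_ne _ _ _ (by decide), h3]
      simp [hM₂]
  · rintro M' ψ' κ' ⟨-, h1, h2, h3, h4, h5⟩
    rw [Nat.sub_zero] at h4 h5
    exact ⟨⟨h1, h2, h4, h5⟩, by simp⟩
  · simp [hM₀]

theorem Tr.measureCells {M : Mem} {ψ : Ket} {κ β k : ℕ} (hn : M .n 0 = n) (hN : M .N 0 = 2 ^ n)
    (hb : n < F.bound) (hβ : M .base 0 = β) (hk : M .k 0 = k) (hbk : k ≤ F.bound)
    (hψ : Within (fun b => ∀ i < k, b (β + 1 + i) < 2 ^ n) ψ) {G : (ℕ → ℕ) → ℝ}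
    (hG : ∀ w w', (∀ i < k, w i = w' i) → G w = G w') :
    F.Tr QRam.measureCells M ψ κ
      (fun M' ψ' κ' => Mem.Agree [.i, .j, .l, .y, .e, .bit, .U] M M' ∧ κ' = κ ∧
        (∀ i < k, M' .U i < 2 ^ n) ∧ ψ' = extend (measCells (β + 1) n k 0 (M' .U)) ψ)
      (fun M' _ _ => G (M' .U)) (∑ y : Fin k → Fin (2 ^ n), G (padded y)) := by
  refine (Tr.forDown (n := k) (fun i M' ψ' κ' =>
      Mem.Agree [.i, .j, .l, .y, .e, .bit, .U] M M' ∧ κ' = κ ∧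
      (∀ t, i ≤ t → t < k → M' .U t < 2 ^ n) ∧
        ψ' = extend (measCells (β + 1) n k i (M' .U)) ψ)
    (fun i M' _ _ => ∑ x : Fin i → Fin (2 ^ n), G fun t => if t < i then padded x t else M' .U t)
    (by simp [hk]) hbk ⟨(Mem.Agree.refl _ _).set (by simp) _ _, rfl, fun _ _ _ => by omega, ?_⟩
    ?_).mono ?_ (le_of_eq ?_)
  · rw [show measCells (β + 1) n k k _ = fun b => Finsupp.single b 1 from
      funext (measCells_self _ _ _ _), extend_self]
  · rintro i hi M' ψ' κ' - ⟨ha, rfl, hU, rfl⟩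
    have ha' : Mem.Agree [.i, .j, .l, .y, .e, .bit, .U] M (M'.set .i 0 i) := ha.set (by simp) _ _
    refine Tr.seq ((Tr.measureCell (n := n) (β := β) (i := i) (by rw [ha' _ (by decide), hn])
      (by rw [ha' _ (by decide), hN]) hb (by rw [ha' _ (by decide), hβ]) (by simp) ?_
      fun v => ∑ x : Fin i → Fin (2 ^ n), G fun t =>
        if t < i then padded x t else Function.update (M' .U) i v t).mono
      (fun _ _ _ h => ⟨h, le_rfl⟩) (le_of_eq ?_)) ?_
    · refine hψ.extend fun b hb => Within.single ?_ _
      rw [setCells_apply, if_neg (by omega)]; exact hb i hi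
    · rw [sum_padded_succ (f := fun w => G fun t => if t < i + 1 then w t else M' .U t),
        Finset.sum_comm]
      refine Finset.sum_congr rfl fun v _ => Finset.sum_congr rfl fun x _ => ?_
      congr 1
      funext t
      simp only [Function.update_apply]
      split_ifs <;> first | rfl | omega
    · rintro M₁ ψ₁ κ₁ ⟨ha₁, rfl, hy, rfl⟩
      have hU₁ : M₁ .U = M' .U := by rw [ha₁ _ (by decide)]; simp
      have hi₁ : M₁ .i 0 = i := by rw [ha₁ _ (by decide)]; simp
      refine (Cl.put (P := fun M'' => M'' = M₁.set .U i (M₁ .y 0)) ?_ ?_ _ _).tr ?_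
      · rw [val_var]
        exact hy.trans_le (Nat.pow_le_pow_right (by norm_num) hb.le)
      · rw [val_var, val_var, hi₁]
      · rintro _ _ _ ⟨rfl, rfl, rfl⟩
        refine ⟨⟨by simp [hi₁], (ha'.trans ha₁ (by simp)).set (by simp) _ _, rfl, ?_, ?_⟩, ?_⟩
        · intro t ht htk
          simp only [Mem.set_same, Function.update_apply, hU₁]
          split_ifs with h
          · exact hy
          · exact hU t (by omega) htk
        · rw [Mem.set_same, hU₁, extend_extend]
          congr 1
          funext b
          rw [extend_measOp_measCells _ _ _ _ _ _ _ hi]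
        · simp [hU₁]
  · rintro M' ψ' κ' ⟨-, h1, h2, h3, h4⟩
    refine ⟨⟨h1, h2, fun i hi => h3 i (by omega) hi, h4⟩, ?_⟩
    simp
  · refine Finset.sum_congr rfl fun x _ => hG _ _ fun i hi => ?_
    simp [hi]

theorem Cl.roundOutcomes [hS : Sizes F p m d n] {M : Mem} {k : ℕ} (hM : Params p m d n M)
    (hk : M .k 0 = k) (hbk : k ≤ F.bound) :
    F.Cl QRam.roundOutcomes M fun M' => Mem.Agree [.i, .U] M M' ∧
      ∀ i < k, M' .U i = rounded p (2 ^ n) (M .U i) % p := by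
  have h1 := Sizes.p_lt F p m d n
  have h2 := hS.two_le
  refine (Cl.forDown (n := k) (fun i M' => Mem.Agree [.i, .U] M M' ∧
    (∀ t < i, M' .U t = M .U t) ∧ ∀ t, i ≤ t → t < k → M' .U t = rounded p (2 ^ n) (M .U t) % p)
    (by simp [hk]) hbk ⟨(Mem.Agree.refl _ _).set (by simp) _ _, by simp, by omega⟩ ?_).mono ?_
  · rintro i hi M' - ⟨ha, h3, h4⟩
    have hM' := hM.agree (ha.set (by simp : Name.i ∈ _) 0 i) (by decide)
    have h5 : (((2 * var .p * ix .U (var .i) + var .N) / (2 * var .N)) % var .p).val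
        (F.enc (M'.set .i 0 i)) = rounded p (2 ^ n) (M .U i) % p := by
      simp only [Expr.val_mod, Expr.val_div, Expr.val_add, Expr.val_mul, Expr.val_ofNat, val_var,
        val_ix, hM'.hp, hM'.hN, rounded]
      simp [h3 i (by omega)]
    refine Cl.put ?_ ⟨?_, (ha.set (by simp) _ _).set (by simp) _ _, ?_, ?_⟩
    · rw [h5]
      exact Sizes.lt_of_le' F p m d n ((Nat.mod_lt _ (by omega)).le.trans (by omega))
    · simp
    · intro t ht
      rw [Mem.set_same, val_var]
      simp [Function.update_of_ne ht.ne, h3 t (by omega)]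
    · intro t ht htk
      rw [h5, Mem.set_same, val_var]
      simp only [Mem.set_same, Function.update_self, Function.update_apply]
      split_ifs with h
      · rw [h]
      · simp [h4 t (by omega) htk]
  · rintro M' ⟨-, h3, -, h5⟩
    exact ⟨h3, fun i hi => h5 i (by omega) hi⟩

/-- By `weight_round` an outcome multiplies the weight by its probability, whatever the state left
by earlier rounds. The expectation of `weight * V` therefore equals the old weight times the mean of
`V` over the rounded outcomes, and no separate argument about independence of rounds is needed. -/
theorem Tr.sample [hp : Fact p.Prime] [hS : Sizes F p m d n] {M : Mem} {ψ : Ket} {κ κ₁ β k : ℕ}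
    {word : Com} (hM : Params p m d n M) (hk : M .k 0 = k) (hbk : k ≤ F.bound)
    (hβ : M .base 0 = β) (hbβ : β + 1 < 2 ^ F.bound) (hψ : Within (Fresh β) ψ)
    {Φ : (Fin k → ℕ) → ℕ →₀ ℂ} {K : Submodule (ZMod p) (Fin k → ZMod p)} (hΦ : HidesSpace K Φ)
    (hword : ∀ M' ψ', Mem.Agree [.i, .j] M M' → Within (Prepared β k n) ψ' →
      F.Det word M' ψ' κ fun M'' ψ'' κ'' => Mem.Agree [.i] M' M'' ∧ κ'' = κ₁ ∧
        ψ'' = extend (oracleOp β k Φ) ψ')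
    {V : (Fin k → ZMod p) → ℝ} (hV : ∀ u, 0 ≤ V u) :
    F.Tr (QRam.sample word) M ψ κ
      (fun M' ψ' κ' => Mem.Agree [.i, .j, .l, .y, .e, .bit, .U, .base] M M' ∧ κ' = κ₁ ∧
        (∀ i < k, M' .U i < p) ∧ M' .base 0 = β + 1 ∧ Within (Fresh (β + 1)) ψ')
      (fun M' ψ' _ => weight ψ' * V fun i => M' .U i)
      (weight ψ * ((1 - k * (p ^ 2 / 2 ^ n)) *
        ((1 / Fintype.card (perp K)) * ∑ u : perp K, V u))) := by
  have h1 := Sizes.p_lt F p m d n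
  have h2 := hS.two_le
  have hn := Sizes.n_le F p m d n
  have hnlt : n < F.bound := by
    have := hS.width
    have : n ≠ 0 := by rintro rfl; simp at h1; omega
    omega
  set v := weight ψ * ((1 - k * (p ^ 2 / 2 ^ n)) *
    ((1 / Fintype.card (perp K)) * ∑ u : perp K, V u)) with hv
  refine Tr.seq (Det.hadamards hM.hn hn hk hbk hβ hψ v) ?_
  rintro M₁ ψ₁ κ' ⟨ha₁, rfl, hψ₁⟩
  have hM₁ := hM.agree ha₁ (by decide)
  refine Tr.seq (hword M₁ ψ₁ ha₁ ?_ v) ?_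
  · rw [hψ₁]; exact hψ.extend fun b hb => within_hadCells hb
  rintro M₂ ψ₂ κ₂ ⟨ha₂, rfl, hψ₂⟩
  have hM₂ := hM₁.agree ha₂ (by decide)
  have hβ₂ : M₂ .base 0 = β := by rw [ha₂ _ (by decide), ha₁ _ (by decide), hβ]
  have hk₂ : M₂ .k 0 = k := by rw [ha₂ _ (by decide), ha₁ _ (by decide), hk]
  refine Tr.seq ((Tr.measureCells (n := n) hM₂.hn hM₂.hN hnlt hβ₂ hk₂ hbk (ψ := ψ₂) ?_
    (G := fun w => weight ψ * (normSq (outcome n k Φ w) *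
      V (reduce p fun i => rounded p (2 ^ n) (w i)))) ?_).mono (fun _ _ _ h => ⟨h, le_rfl⟩) ?_) ?_
  · rw [hψ₂, hψ₁, extend_extend]
    refine hψ.extend fun b hb => (within_hadCells hb).extend fun b' hb' => ?_
    refine Within.sum fun z _ => Within.single (fun i hi => ?_) _
    rw [Finsupp.coe_update, Function.update_of_ne (by omega)]
    exact hb'.lt i hi
  · intro w w' hw
    have e1 : outcome n k Φ w = outcome n k Φ w' := by
      simp only [outcome, hw _ (Fin.isLt _)]
    rw [e1]
    simp only [hw _ (Fin.isLt _)]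
  · rw [hv, ← Finset.mul_sum]
    refine mul_le_mul_of_nonneg_left ?_ (weight_nonneg _)
    have h3 : p ^ 2 ≤ 2 ^ n := le_trans (Nat.le_mul_of_pos_left _ (by positivity)) hS.large
    refine (le_sum_normSq_outcome hΦ h3 V hV).trans (le_of_eq ?_)
    simp only [padded_val]
  rintro M₃ ψ₃ κ₃ ⟨ha₃, rfl, hU₃, hψ₃⟩
  have hM₃ := hM₂.agree ha₃ (by decide)
  have hk₃ : M₃ .k 0 = k := by rw [ha₃ _ (by decide), hk₂]
  refine Tr.seq (Cl.roundOutcomes hM₃ hk₃ hbk _ _ _) ?_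
  rintro M₄ _ _ ⟨⟨ha₄, hU₄⟩, rfl, rfl⟩
  have hβ₄ : M₄ .base 0 = β := by rw [ha₄ _ (by decide), ha₃ _ (by decide), hβ₂]
  refine (Cl.put (P := fun M' => M' = M₄.set .base 0 (β + 1)) (by simpa [hβ₄] using hbβ)
    (by simp [hβ₄]) _ _).tr ?_
  rintro _ _ _ ⟨rfl, rfl, rfl⟩
  refine ⟨⟨?_, rfl, ?_, by simp, ?_⟩, ?_⟩
  · exact ((((ha₁.weaken (by simp)).trans ha₂ (by simp)).trans ha₃ (by simp)).trans ha₄ (by simp)).set (by simp) _ _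
  · intro i hi
    rw [Mem.set_ne _ _ _ (by decide), hU₄ i hi]
    exact Nat.mod_lt _ (by omega)
  · rw [hψ₃, hψ₂, hψ₁]; exact within_round Φ _ hψ
  · rw [Mem.set_ne _ _ _ (by decide), hψ₃, hψ₂, hψ₁, weight_round Φ _ hψ, mul_assoc]
    refine le_of_eq ?_
    congr 3
    funext i
    simp [reduce, hU₄ _ i.isLt]

end Frame
end QRam

namespace QRam

/-! ## Loops that fill arrays -/

namespace Frame

variable {F : Frame} {p m d n : ℕ} [F.Valid]

theorem Cl.fill {M : Mem} {x v : Name} {e a src : Expr} {N : ℕ} (hx : x ≠ v)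
    (he : e.val (F.enc M) = N) (hb : N ≤ F.bound) {f w : ℕ → ℕ} (hf : Set.InjOn f (Set.Iio N))
    (hw : ∀ i < N, w i < 2 ^ F.bound)
    (h : ∀ i < N, ∀ M', Mem.Agree [v, x] M M' → M' v 0 = i → M' x (f i) = M x (f i) →
      a.val (F.enc M') = f i ∧ src.val (F.enc M') = w i) :
    F.Cl (QRam.forDown v e (QRam.put x a src)) M fun M' => Mem.Agree [v, x] M M' ∧
      (∀ i < N, M' x (f i) = w i) ∧ ∀ b, (∀ i < N, b ≠ f i) → M' x b = M x b := by
  refine (Cl.forDown (n := N) (fun i M' => Mem.Agree [v, x] M M' ∧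
    (∀ t, i ≤ t → t < N → M' x (f t) = w t) ∧ ∀ b, (∀ t, i ≤ t → t < N → b ≠ f t) → M' x b = M x b)
    he hb ⟨(Mem.Agree.refl _ _).set (by simp) _ _, by omega, fun b _ => ?_⟩ ?_).mono ?_
  · rw [Mem.set_ne _ _ _ hx]
  · rintro i hi M' - ⟨ha, h1, h2⟩
    have hx' : (M'.set v 0 i) x = M' x := Mem.set_ne _ _ _ hx
    obtain ⟨e1, e2⟩ := h i hi (M'.set v 0 i) (ha.set (by simp) _ _) (by simp)
      (by rw [hx']; exact h2 _ fun t h3 h4 h5 =>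
        absurd (hf (Set.mem_Iio.2 hi) (Set.mem_Iio.2 h4) h5) (by omega))
    refine Cl.put (by rw [e2]; exact hw i hi) ?_
    rw [e1, e2]
    refine ⟨?_, (ha.set (by simp) _ _).set (by simp) _ _, ?_, ?_⟩
    · rw [Mem.set_ne _ _ _ hx.symm]; simp
    · intro t ht htN
      rw [Mem.set_same, Function.update_apply, hx']
      split_ifs with h3
      · rw [hf (Set.mem_Iio.2 htN) (Set.mem_Iio.2 hi) h3]
      · exact h1 t (by have : t ≠ i := fun h => h3 (by rw [h]); omega) htN
    · intro b hb'
      rw [Mem.set_same, Function.update_of_ne (hb' i le_rfl hi), hx']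
      exact h2 b fun t ht => hb' t (by omega)
  · rintro M' ⟨-, h1, h2, h3⟩
    exact ⟨h1, fun i hi => h2 i (by omega) hi, fun b hb' => h3 b fun t _ => hb' t⟩

/-- The loop counts down, so `f i` is the value of the accumulator after the indices from `i` to `N
- 1`. -/
theorem Cl.accumulate {M : Mem} {x v : Name} {e a src : Expr} {N c : ℕ} (hx : x ≠ v)
    (he : e.val (F.enc M) = N) (hb : N ≤ F.bound) {f : ℕ → ℕ} (hf : M x c = f N)
    (hw : ∀ i < N, f i < 2 ^ F.bound)
    (h : ∀ i < N, ∀ M', Mem.Agree [v, x] M M' → M' v 0 = i → M' x c = f (i + 1) →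
      a.val (F.enc M') = c ∧ src.val (F.enc M') = f i) :
    F.Cl (QRam.forDown v e (QRam.put x a src)) M fun M' => Mem.Agree [v, x] M M' ∧
      M' x c = f 0 ∧ ∀ b ≠ c, M' x b = M x b := by
  refine (Cl.forDown (n := N) (fun i M' => Mem.Agree [v, x] M M' ∧ M' x c = f i ∧
    ∀ b ≠ c, M' x b = M x b) he hb ⟨(Mem.Agree.refl _ _).set (by simp) _ _, ?_, fun b _ => ?_⟩
    ?_).mono ?_
  · rw [Mem.set_ne _ _ _ hx, hf]
  · rw [Mem.set_ne _ _ _ hx]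
  · rintro i hi M' - ⟨ha, h1, h2⟩
    have hx' : (M'.set v 0 i) x = M' x := Mem.set_ne _ _ _ hx
    obtain ⟨e1, e2⟩ := h i hi (M'.set v 0 i) (ha.set (by simp) _ _) (by simp) (by rw [hx', h1])
    refine Cl.put (by rw [e2]; exact hw i hi) ?_
    rw [e1, e2]
    refine ⟨?_, (ha.set (by simp) _ _).set (by simp) _ _, by simp, ?_⟩
    · rw [Mem.set_ne _ _ _ hx.symm]; simp
    · intro b hb'
      rw [Mem.set_same, Function.update_of_ne hb', hx']
      exact h2 b hb'
  · rintro M' ⟨-, h1, h2, h3⟩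
    exact ⟨h1, h2, h3⟩

end Frame

theorem rowMajor_inj {k a a' b b' : ℕ} (hb : b < k) (hb' : b' < k)
    (h : a * k + b = a' * k + b') : a = a' ∧ b = b' := by
  have h1 := congrArg (· / k) h
  have h2 := congrArg (· % k) h
  have hk : 0 < k := by omega
  simp only [mul_comm _ k, Nat.mul_add_div hk, Nat.div_eq_of_lt hb, Nat.div_eq_of_lt hb',
    Nat.mul_add_mod, Nat.mod_eq_of_lt hb, Nat.mod_eq_of_lt hb'] at h1 h2
  exact ⟨by omega, h2⟩

/-- Write to all entries of the square matrix `B`. -/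
def putMatrix (src : Expr) : Com :=
  forDown .i (var .k) (forDown .j (var .k) (put .B (var .i * var .k + var .j) src))

theorem Frame.Cl.putMatrix {F : Frame} [F.Valid] {M : Mem} {src : Expr} {k : ℕ} (hk : M .k 0 = k)
    (hb : k ≤ F.bound) {w : ℕ → ℕ → ℕ} (hw : ∀ i < k, ∀ j < k, w i j < 2 ^ F.bound)
    (h : ∀ i < k, ∀ j < k, ∀ M', Mem.Agree [.i, .j, .B] M M' → M' .i 0 = i → M' .j 0 = j →
      M' .B (i * k + j) = M .B (i * k + j) → src.val (F.enc M') = w i j) :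
    F.Cl (QRam.putMatrix src) M fun M' => Mem.Agree [.i, .j, .B] M M' ∧
      ∀ i < k, ∀ j < k, M' .B (i * k + j) = w i j := by
  refine (Cl.forDown (n := k) (fun i M' => Mem.Agree [.i, .j, .B] M M' ∧
    (∀ t, i ≤ t → t < k → ∀ j < k, M' .B (t * k + j) = w t j) ∧
      ∀ t < i, ∀ j < k, M' .B (t * k + j) = M .B (t * k + j))
    (by simp [hk]) hb ⟨(Mem.Agree.refl _ _).set (by simp) _ _, by omega, fun t _ j _ => by simp⟩
      ?_).mono ?_
  · rintro i hi M' - ⟨ha, h1, h2⟩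
    have ha' : Mem.Agree [.i, .j, .B] M (M'.set .i 0 i) := ha.set (by simp) _ _
    have hB : (M'.set .i 0 i) .B = M' .B := by simp
    refine (Cl.fill (N := k) (f := fun j => i * k + j) (w := w i) (by decide)
      (by rw [val_var, ha' _ (by decide), hk]) hb ?_ (hw i hi) ?_).mono ?_
    · intro a _ b _ hab
      simpa using hab
    · intro j hj M'' ha'' hj' hB'
      have hi' : M'' .i 0 = i := by rw [ha'' _ (by decide)]; simp
      refine ⟨?_, h i hi j hj M'' (ha'.trans ha'' (by simp)) hi' hj' ?_⟩
      · simp [hi', hj', ha'' .k (by decide), ha .k (by decide), hk]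
      · rw [hB', hB, h2 i (by omega) j hj]
    · rintro M'' ⟨ha'', h3, h4⟩
      refine ⟨by rw [ha'' _ (by decide)]; simp, ha'.trans ha'' (by simp), ?_, ?_⟩
      · intro t ht htk j hj
        by_cases hti : t = i
        · rw [hti]; exact h3 j hj
        · rw [h4, hB, h1 t (by omega) htk j hj]
          intro j' hj' h5
          exact hti (rowMajor_inj hj hj' h5).1
      · intro t ht j hj
        rw [h4, hB, h2 t (by omega) j hj]
        intro j' hj' h5
        have := (rowMajor_inj hj hj' h5).1
        omega
  · rintro M' ⟨-, h1, h2, -⟩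
    exact ⟨h1, fun i hi => h2 i (by omega) hi⟩

/-! ## Intersection of a row space with a hyperplane -/

/-- Compute the inner products of the rows of `B` and the vector `U`. -/
def innerProducts : Com :=
  forDown .i (var .k) (.seq (put .S (var .i) 0) (forDown .j (var .k)
    (put .S (var .i)
      ((ix .S (var .i) + ix .U (var .j) * ix .B (var .i * var .k + var .j)) % var .p))))

/-- Find a row that is not orthogonal to `U`. -/
def findPivot : Com :=
  .seq (put .piv 0 0) (forDown .i (var .k) (.ite (ix .S (var .i)) (put .piv 0 (var .i)) .skip))

/-- Replace the row space of `B` by its intersection with the hyperplane orthogonal to `U`. -/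
def eliminate : Com :=
  .seq innerProducts (.seq findPivot (.ite (ix .S (var .piv))
    (.seq (forDown .j (var .k) (put .row (var .j) (ix .B (var .piv * var .k + var .j))))
      (putMatrix ((ix .S (var .piv) * ix .B (var .i * var .k + var .j) +
        (var .p - ix .S (var .i)) * ix .row (var .j)) % var .p)))
    .skip))

/-- The rows of the matrix `B`. -/
def rows (p k : ℕ) (M : Mem) (i j : Fin k) : ZMod p := M .B (i * k + j)

/-- The row space of the matrix `B`. -/
def rowSpace (p k : ℕ) (M : Mem) : Submodule (ZMod p) (Fin k → ZMod p) :=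
  Submodule.span _ (Set.range (rows p k M))

/-- The vectors orthogonal to `u`. -/
def hyperplane {p k : ℕ} (u : Fin k → ZMod p) : Submodule (ZMod p) (Fin k → ZMod p) where
  carrier := {w | u ⬝ᵥ w = 0}
  add_mem' := fun ha hb => by
    rw [Set.mem_ofPred_eq] at ha hb ⊢; rw [dotProduct_add, ha, hb, add_zero]
  zero_mem' := dotProduct_zero u
  smul_mem' := fun c w hw => by
    rw [Set.mem_ofPred_eq] at hw ⊢; rw [dotProduct_smul, hw, smul_zero]

theorem mem_hyperplane {p k : ℕ} {u w : Fin k → ZMod p} : w ∈ hyperplane u ↔ u ⬝ᵥ w = 0 := Iff.rfl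

/-- One step of elimination without division. The new rows lie in the hyperplane by construction.
Conversely, in a combination of the old rows that lies there the multiples of `b i₀` that were
subtracted cancel, so it is a multiple of the same combination of new rows. The pivot row becomes
zero, and the number of rows stays `k`. -/
theorem span_inf_hyperplane {p k : ℕ} [Fact p.Prime] (b : Fin k → Fin k → ZMod p)
    (u : Fin k → ZMod p) {i₀ : Fin k} (h : u ⬝ᵥ b i₀ ≠ 0) :
    Submodule.span (ZMod p) (Set.range b) ⊓ hyperplane u =
      Submodule.span (ZMod p) (Set.range fun i => (u ⬝ᵥ b i₀) • b i - (u ⬝ᵥ b i) • b i₀) := by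
  refine le_antisymm ?_ (Submodule.span_le.2 ?_)
  · rintro w ⟨hw, hu⟩
    obtain ⟨c, rfl⟩ := (Submodule.mem_span_range_iff_exists_fun _).1 hw
    have hu' : ∑ i, c i * (u ⬝ᵥ b i) = 0 := by
      have := mem_hyperplane.1 hu
      simpa [dotProduct_sum, dotProduct_smul] using this
    have : ∑ i, c i • b i = (u ⬝ᵥ b i₀)⁻¹ •
        ∑ i, c i • ((u ⬝ᵥ b i₀) • b i - (u ⬝ᵥ b i) • b i₀) := by
      simp only [smul_sub, Finset.sum_sub_distrib, smul_smul]
      rw [← Finset.sum_smul (f := fun i => c i * u ⬝ᵥ b i), hu', zero_smul, smul_zero, sub_zero,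
        Finset.smul_sum]
      refine Finset.sum_congr rfl fun i _ => ?_
      rw [smul_smul, mul_comm (c i), ← mul_assoc, inv_mul_cancel₀ h, one_mul]
    rw [this]
    exact Submodule.smul_mem _ _ (Submodule.sum_mem _ fun i _ =>
      Submodule.smul_mem _ _ (Submodule.subset_span ⟨i, rfl⟩))
  · rintro _ ⟨i, rfl⟩
    refine ⟨Submodule.sub_mem _ (Submodule.smul_mem _ _ (Submodule.subset_span ⟨i, rfl⟩))
      (Submodule.smul_mem _ _ (Submodule.subset_span ⟨i₀, rfl⟩)), ?_⟩
    rw [SetLike.mem_coe, mem_hyperplane, dotProduct_sub, dotProduct_smul, dotProduct_smul,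
      smul_eq_mul, smul_eq_mul, mul_comm, sub_self]

/-- The entries of `B` are reduced. -/
def Reduced (p k : ℕ) (M : Mem) : Prop := ∀ i < k, ∀ j < k, M .B (i * k + j) < p

namespace Frame

variable {F : Frame} {p m d n : ℕ} [F.Valid]

theorem Cl.innerProducts [hS : Sizes F p m d n] {M : Mem} {k : ℕ} (hp : M .p 0 = p)
    (hk : M .k 0 = k) (hb : k ≤ F.bound) :
    F.Cl QRam.innerProducts M fun M' => Mem.Agree [.i, .j, .S] M M' ∧ ∀ i : Fin k,
      M' .S i < p ∧ (M' .S i : ZMod p) = (fun j : Fin k => (M .U j : ZMod p)) ⬝ᵥ rows p k M i := by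
  have h1 := Sizes.p_lt F p m d n
  have h2 := hS.two_le
  refine (Cl.forDown (n := k) (fun i M' => Mem.Agree [.i, .j, .S] M M' ∧ ∀ t, i ≤ t → t < k →
    M' .S t < p ∧ (M' .S t : ZMod p) = ∑ j ∈ Finset.Ico 0 k, (M .U j : ZMod p) * M .B (t * k + j))
    (by simp [hk]) hb ⟨(Mem.Agree.refl _ _).set (by simp) _ _, by omega⟩ ?_).mono ?_
  · rintro i hi M' - ⟨ha, h3⟩
    refine Cl.put_seq (by simp) ?_
    simp only [val_var, Expr.val_ofNat, Mem.set_same, Function.update_self]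
    set M₁ := (M'.set .i 0 i).set .S i 0 with hM₁
    have ha₁ : Mem.Agree [.i, .j, .S] M M₁ := (ha.set (by simp) _ _).set (by simp) _ _
    refine (Cl.accumulate (N := k) (c := i) (f := fun s =>
      (∑ j ∈ Finset.Ico s k, M .U j * M .B (i * k + j)) % p) (by decide)
      (by rw [val_var, ha₁ _ (by decide), hk]) hb (by simp [hM₁]) ?_ ?_).mono ?_
    · intro s _
      exact Sizes.lt_of_le' F p m d n ((Nat.mod_lt _ (by omega)).le.trans (by omega))
    · intro s hs M'' ha'' hj hSi
      have hi' : M'' .i 0 = i := by rw [ha'' _ (by decide)]; simp [hM₁]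
      have ha₂ : Mem.Agree [.i, .j, .S] M M'' := ha₁.trans ha'' (by simp)
      refine ⟨by simp [hi'], ?_⟩
      simp only [Expr.val_mod, Expr.val_add, Expr.val_mul, val_var, val_ix, hi', hj, hSi,
        ha₂ .U (by decide), ha₂ .B (by decide), ha₂ .k (by decide), ha₂ .p (by decide), hk, hp]
      rw [Nat.mod_add_mod, add_comm, Finset.sum_eq_sum_Ico_succ_bot hs]
    · rintro M'' ⟨ha'', h4, h5⟩
      refine ⟨by rw [ha'' _ (by decide)]; simp [hM₁], ha₁.trans ha'' (by simp), ?_⟩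
      intro t ht htk
      by_cases hti : t = i
      · subst hti
        rw [h4]
        exact ⟨Nat.mod_lt _ (by omega), by simp⟩
      · rw [h5 t hti, hM₁, Mem.set_same, Function.update_of_ne hti, Mem.set_ne _ _ _ (by decide)]
        exact h3 t (by omega) htk
  · rintro M' ⟨-, h3, h4⟩
    refine ⟨h3, fun i => ⟨(h4 i (by omega) i.isLt).1, ?_⟩⟩
    rw [(h4 i (by omega) i.isLt).2, ← Finset.range_eq_Ico, Finset.sum_range]
    rfl

theorem Cl.findPivot {M : Mem} {k : ℕ} (hk : M .k 0 = k) (hb : k ≤ F.bound) :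
    F.Cl QRam.findPivot M fun M' => Mem.Agree [.i, .piv] M M' ∧
      (M .S (M' .piv 0) = 0 → ∀ i < k, M .S i = 0) ∧ (0 < k → M' .piv 0 < k) := by
  refine Cl.put_seq (by simp) ?_
  simp only [Expr.val_ofNat]
  set M₁ := M.set .piv 0 0 with hM₁
  have ha₁ : Mem.Agree [.i, .piv] M M₁ := (Mem.Agree.refl _ _).set (by simp) _ _
  refine (Cl.forDown (n := k) (fun i M' => Mem.Agree [.i, .piv] M M' ∧
    (M .S (M' .piv 0) = 0 → ∀ t, i ≤ t → t < k → M .S t = 0) ∧ (0 < k → M' .piv 0 < k))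
    (by rw [val_var, ha₁ _ (by decide), hk]) hb ⟨ha₁.set (by simp) _ _, by omega, by simp [hM₁]⟩
    ?_).mono ?_
  · rintro i hi M' - ⟨ha, h1, h2⟩
    have ha' : Mem.Agree [.i, .piv] M (M'.set .i 0 i) := ha.set (by simp) _ _
    have hSi : (ix .S (var .i)).val (F.enc (M'.set .i 0 i)) = M .S i := by
      simp [ha .S (by decide)]
    refine Cl.ite (fun h => Cl.put ?_ ?_) fun h => Cl.skip ?_
    · simp only [val_var, Mem.set_same, Function.update_self]
      exact (hi.trans_le hb).trans Nat.lt_two_pow_self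
    · rw [hSi] at h
      simp only [val_var, Expr.val_ofNat, Mem.set_same, Function.update_self]
      exact ⟨by simp, ha'.set (by simp) _ _, by simp [h], by simpa using fun _ => hi⟩
    · rw [hSi] at h
      refine ⟨by simp, ha', ?_, by simpa using h2⟩
      intro h3 t ht htk
      by_cases hti : t = i
      · rw [hti, h]
      · exact h1 (by simpa using h3) t (by omega) htk
  · rintro M' ⟨-, h1, h2, h3⟩
    exact ⟨h1, fun h i hi => h2 h i (by omega) hi, h3⟩

/-- Registers hold natural numbers, so `p - S i` replaces the negative of an inner product. The
pivot row is copied to `row` first because the loop over the matrix overwrites it as well. -/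
theorem Cl.eliminate [Fact p.Prime] [hS : Sizes F p m d n] {M : Mem} {k : ℕ} (hp : M .p 0 = p)
    (hk : M .k 0 = k) (hb : k ≤ F.bound) (hB : Reduced p k M) :
    F.Cl QRam.eliminate M fun M' => Mem.Agree [.i, .j, .S, .piv, .row, .B] M M' ∧
      Reduced p k M' ∧
      rowSpace p k M' = rowSpace p k M ⊓ hyperplane fun j : Fin k => (M .U j : ZMod p) := by
  have h1 := Sizes.p_lt F p m d n
  have h2 := hS.two_le
  have hlt {x : ℕ} (h : x < p) : x < 2 ^ F.bound :=
    Sizes.lt_of_le' F p m d n (h.le.trans (by omega))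
  refine (Cl.innerProducts (m := m) (d := d) (n := n) hp hk hb).seq ?_
  rintro M₁ ⟨ha₁, hS₁⟩
  refine (Cl.findPivot (by rw [ha₁ _ (by decide), hk]) hb).seq ?_
  rintro M₂ ⟨ha₂, hpiv, hpiv'⟩
  have ha₂' : Mem.Agree [.i, .j, .S, .piv, .row, .B] M M₂ :=
    (ha₁.weaken (by simp)).trans ha₂ (by simp)
  have hB₂ : M₂ .B = M .B := by rw [ha₂ _ (by decide), ha₁ _ (by decide)]
  have hS₂ : M₂ .S = M₁ .S := by rw [ha₂ _ (by decide)]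
  have hpv : (ix .S (var .piv)).val (F.enc M₂) = M₁ .S (M₂ .piv 0) := by simp [hS₂]
  set u : Fin k → ZMod p := fun j => (M .U j : ZMod p)
  refine Cl.ite (fun h => ?_) fun h => Cl.skip ⟨ha₂', ?_, ?_⟩
  · rw [hpv] at h
    -- For `k = 0` the pivot test reads an entry of `S` that was never computed, so this branch can
    -- be entered although there is no pivot row.
    rcases Nat.eq_zero_or_pos k with h0 | hpos
    · subst h0
      refine (Cl.fill (N := 0) (f := id) (w := id) (by decide) (by simp [ha₂' .k (by decide), hk])
        hb (by simp [Set.InjOn]) (by simp) (by simp)).seq fun M₃ ⟨ha₃, _⟩ => ?_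
      refine (Cl.putMatrix (k := 0) (w := fun _ _ => 0)
        (by rw [ha₃ _ (by decide), ha₂' _ (by decide), hk]) hb (by simp) (by simp)).mono ?_
      rintro M' ⟨ha, -⟩
      exact ⟨(ha₂'.trans ha₃ (by simp)).trans ha (by simp), fun i hi => by omega,
        Subsingleton.elim _ _⟩
    set i₀ : Fin k := ⟨M₂ .piv 0, hpiv' hpos⟩ with hi₀
    refine (Cl.fill (N := k) (f := id) (w := fun j => M .B (i₀ * k + j)) (by decide)
      (by simp [ha₂' .k (by decide), hk]) hb (fun _ _ _ _ h => h) (fun j hj => hlt (hB _ i₀.isLt j hj))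
      ?_).seq ?_
    · intro j hj M' ha hj' _
      refine ⟨by simp [hj'], ?_⟩
      simp [hj', ha .B (by decide), ha .piv (by decide), ha .k (by decide), hB₂, hi₀,
        ha₂' .k (by decide), hk]
    · rintro M₃ ⟨ha₃, hrow, -⟩
      have ha₃' := ha₂'.trans ha₃ (by simp)
      refine (Cl.putMatrix (k := k) (w := fun i j => (M₁ .S i₀ * M .B (i * k + j) +
        (p - M₁ .S i) * M .B (i₀ * k + j)) % p)
        (by rw [ha₃' _ (by decide), hk]) hb (fun i _ j _ => hlt (Nat.mod_lt _ (by omega))) ?_).mono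
        ?_
      · intro i hi j hj M' ha hi' hj' hBij
        simp only [Expr.val_mod, Expr.val_add, Expr.val_sub, Expr.val_mul, val_var, val_ix, hi', hj',
          ha .S (by decide), ha .row (by decide), ha .piv (by decide), ha .p (by decide),
          ha .k (by decide), ha₃ .S (by decide), ha₃ .piv (by decide),
          ha₃' .p (by decide), ha₃' .k (by decide), hk, hp, hBij, hS₂, ha₃ .B (by decide), hB₂]
        rw [show M₃ .row j = _ from hrow j hj]
      · rintro M' ⟨ha, hB'⟩
        refine ⟨ha₃'.trans ha (by simp), fun i hi j hj => ?_, ?_⟩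
        · rw [hB' i hi j hj]; exact Nat.mod_lt _ (by omega)
        · have hne : u ⬝ᵥ rows p k M i₀ ≠ 0 := by
            rw [← (hS₁ i₀).2]
            intro h0
            rw [ZMod.natCast_eq_zero_iff] at h0
            exact h (Nat.eq_zero_of_dvd_of_lt h0 (hS₁ i₀).1)
          rw [rowSpace, rowSpace, span_inf_hyperplane _ _ hne]
          congr 2
          funext i j
          rw [rows, hB' i i.isLt j j.isLt]
          simp only [Pi.sub_apply, Pi.smul_apply, smul_eq_mul]
          rw [← (hS₁ i₀).2, ← (hS₁ i).2, ZMod.natCast_mod]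
          push_cast [Nat.cast_sub (hS₁ i).1.le]
          simp [rows]; ring
  · rw [Reduced, hB₂]; exact hB
  · rw [hpv] at h
    have : rows p k M₂ = rows p k M := by
      funext i j; simp [rows, hB₂]
    rw [rowSpace, this, ← rowSpace, eq_comm, inf_eq_left]
    refine Submodule.span_le.2 ?_
    rintro _ ⟨i, rfl⟩
    rw [SetLike.mem_coe, mem_hyperplane, ← (hS₁ i).2, hpiv h i i.isLt, Nat.cast_zero]

end Frame
end QRam

namespace QRam

/-! ## Convergence of the sampled hyperplanes -/

section potential

variable {p k : ℕ} [hp : Fact p.Prime] {K X : Submodule (ZMod p) (Fin k → ZMod p)}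

open Classical in
-- Pairing with `w` is a nonzero functional on `perp K`, so its kernel has index `p`.
theorem card_perp_filter (w : Fin k → ZMod p) (hw : w ∉ K) :
    (p : ℝ) * (Finset.univ.filter fun u : perp K => u.1 ⬝ᵥ w = 0).card = Fintype.card (perp K) := by
  let f : perp K →ₗ[ZMod p] ZMod p :=
    { toFun := fun u => u.1 ⬝ᵥ w
      map_add' := fun a b => add_dotProduct _ _ _
      map_smul' := fun c a => smul_dotProduct _ _ _ }
  have hf : Function.Surjective f := by
    obtain ⟨u, hu, h⟩ := exists_perp_of_notMem hw
    intro c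
    refine ⟨(c * (u ⬝ᵥ w)⁻¹) • ⟨u, hu⟩, ?_⟩
    rw [map_smul, smul_eq_mul]
    exact inv_mul_cancel_right₀ h c
  have h1 := Submodule.card_eq_card_quotient_mul_card (LinearMap.ker f)
  rw [Nat.card_congr (f.quotKerEquivOfSurjective hf).toEquiv, Nat.card_zmod] at h1
  rw [← Nat.card_eq_fintype_card (α := perp K), h1]
  have h2 : Nat.card (LinearMap.ker f) =
      (Finset.univ.filter fun u : perp K => u.1 ⬝ᵥ w = 0).card := by
    rw [← Fintype.card_subtype, ← Nat.card_eq_fintype_card]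
    exact Nat.card_congr (Equiv.subtypeEquivRight fun u => LinearMap.mem_ker)
  rw [h2]
  push_cast; ring

/-- Double counting: all of `K` survives every cut, and each vector of `X` outside `K` survives for
exactly one in `p` elements of `perp K`. -/
theorem sum_card_inf_hyperplane (h : K ≤ X) :
    ∑ u : perp K, ((Nat.card (X ⊓ hyperplane u.1 : Submodule _ _) : ℝ) - Nat.card K) =
      Fintype.card (perp K) * (((Nat.card X : ℝ) - Nat.card K) / p) := by
  classical
  have hp0 : (p : ℝ) ≠ 0 := by exact_mod_cast hp.out.ne_zero
  have h1 (Y : Submodule (ZMod p) (Fin k → ZMod p)) :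
      (Nat.card Y : ℝ) = ∑ w, if w ∈ Y then 1 else 0 := by
    rw [Finset.sum_boole, ← Fintype.card_subtype, Nat.card_eq_fintype_card]
  have h2 (Y : Submodule (ZMod p) (Fin k → ZMod p)) (hY : K ≤ Y) :
      (Nat.card Y : ℝ) - Nat.card K = ∑ w, if w ∈ Y ∧ w ∉ K then 1 else 0 := by
    rw [h1, h1, ← Finset.sum_sub_distrib]
    refine Finset.sum_congr rfl fun w _ => ?_
    by_cases h3 : w ∈ K
    · simp [h3, hY h3]
    · simp [h3]
  have h3 (u : perp K) : K ≤ X ⊓ hyperplane u.1 := le_inf h fun w hw => u.2 w hw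
  rw [Finset.sum_congr rfl fun u _ => h2 _ (h3 u), h2 X h, Finset.sum_comm, Finset.sum_div,
    Finset.mul_sum]
  refine Finset.sum_congr rfl fun w _ => ?_
  by_cases hw : w ∈ X ∧ w ∉ K
  · rw [if_pos hw, ← card_perp_filter w hw.2, mul_one_div, mul_div_cancel_left₀ _ hp0,
      ← Finset.sum_boole]
    refine Finset.sum_congr rfl fun u _ => ?_
    simp [Submodule.mem_inf, mem_hyperplane, hw.1, hw.2]
  · rw [if_neg hw, zero_div, mul_zero]
    refine Finset.sum_eq_zero fun u _ => if_neg fun h4 => hw ⟨h4.1.1, h4.2⟩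

open Classical in
/-- A lower bound for the probability that `i` rounds reduce the space `X` to `K`, if the error
probability of one round is `ε`. -/
noncomputable def potential (ε : ℝ) (K : Submodule (ZMod p) (Fin k → ZMod p)) (i : ℕ)
    (X : Submodule (ZMod p) (Fin k → ZMod p)) : ℝ :=
  if K ≤ X then max 0 (1 - ε * i - ((Nat.card X : ℝ) - Nat.card K) / p ^ i) else 0

theorem card_le_card (h : K ≤ X) : (Nat.card K : ℝ) ≤ Nat.card X := by
  exact_mod_cast Nat.card_le_card_of_injective _ (Submodule.inclusion_injective h)

theorem potential_nonneg (ε : ℝ) (i : ℕ) : 0 ≤ potential ε K i X := by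
  unfold potential
  split_ifs
  · exact le_max_left _ _
  · exact le_rfl

theorem potential_le_one {ε : ℝ} (hε : 0 ≤ ε) (i : ℕ) : potential ε K i X ≤ 1 := by
  unfold potential
  split_ifs with h
  · refine max_le zero_le_one ?_
    have h1 := sub_nonneg.2 (card_le_card h)
    have h2 : 0 ≤ ε * i := by positivity
    have h3 : 0 ≤ ((Nat.card X : ℝ) - Nat.card K) / p ^ i := by positivity
    linarith
  · exact zero_le_one

/-- On average a cut divides the excess over `K` by `p`, which is absorbed by the next power of `p`
in the denominator. The mean is at most 1, so the factor `1 - ε` costs at most `ε`. Truncation at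
zero keeps the potential nonnegative, as is required of `V` in `le_sum_normSq_outcome`. -/
theorem potential_succ_le {ε : ℝ} (hε : 0 ≤ ε) (hε' : ε ≤ 1) (i : ℕ) :
    potential ε K (i + 1) X ≤
      (1 - ε) * ((1 / Fintype.card (perp K)) * ∑ u : perp K, potential ε K i (X ⊓ hyperplane u.1)) := by
  set c : ℝ := (Fintype.card (perp K) : ℝ) with hc
  have hc0 : 0 < c := by rw [hc]; exact_mod_cast Fintype.card_pos
  set s := (1 / c) * ∑ u : perp K, potential ε K i (X ⊓ hyperplane u.1) with hs
  have h0 : 0 ≤ s :=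
    mul_nonneg (by positivity) (Finset.sum_nonneg fun u _ => potential_nonneg _ _)
  have h1 : s ≤ 1 := by
    rw [hs, one_div, inv_mul_le_iff₀ hc0, mul_one]
    refine (Finset.sum_le_sum fun u _ => potential_le_one hε i).trans ?_
    rw [Finset.sum_const, Finset.card_univ, nsmul_eq_mul, mul_one]
  by_cases h : K ≤ X
  · rw [potential, if_pos h]
    refine max_le (mul_nonneg (by linarith) h0) ?_
    have h2 : 1 - ε * i - ((Nat.card X : ℝ) - Nat.card K) / p ^ (i + 1) ≤ s := by
      have h3 (u : perp K) : 1 - ε * i -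
          ((Nat.card (X ⊓ hyperplane u.1 : Submodule _ _) : ℝ) - Nat.card K) / p ^ i ≤
            potential ε K i (X ⊓ hyperplane u.1) := by
        rw [potential, if_pos (le_inf h fun w hw => u.2 w hw)]
        exact le_max_right _ _
      rw [hs, one_div, le_inv_mul_iff₀ hc0]
      refine le_trans (le_of_eq ?_) (Finset.sum_le_sum fun u _ => h3 u)
      rw [Finset.sum_sub_distrib, ← Finset.sum_div, sum_card_inf_hyperplane h, Finset.sum_const,
        Finset.card_univ, nsmul_eq_mul, ← hc, pow_succ', mul_sub, mul_div_assoc c, div_div]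
    have h4 : ε * s ≤ ε := mul_le_of_le_one_right hε h1
    push_cast
    nlinarith
  · rw [potential, if_neg h]
    exact mul_nonneg (by linarith) h0

open Classical in
-- Cardinalities are integers: if `X` is strictly larger than `K`, the excess is at least 1 and the
-- bound drops to zero.
theorem potential_zero_le (ε : ℝ) : potential ε K 0 X ≤ if X = K then 1 else 0 := by
  unfold potential
  split_ifs with h h' h'
  · subst h'; simp
  · refine max_le le_rfl ?_
    have h1 : Nat.card K < Nat.card X := by
      have := Set.ncard_lt_ncard (SetLike.coe_ssubset_coe.2 (lt_of_le_of_ne h (Ne.symm h')))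
        (Set.toFinite _)
      exact this
    have h2 : (Nat.card K : ℝ) + 1 ≤ Nat.card X := by exact_mod_cast h1
    rw [pow_zero, div_one, Nat.cast_zero, mul_zero]
    linarith
  · exact zero_le_one
  · exact le_rfl

theorem le_potential_top (ε : ℝ) (i : ℕ) :
    1 - ε * (k + i : ℕ) - 1 / p ^ i ≤ potential ε K (k + i) (⊤ : Submodule (ZMod p) (Fin k → ZMod p)) := by
  have hp0 : (0 : ℝ) < p := by exact_mod_cast hp.out.pos
  rw [potential, if_pos le_top]
  refine le_trans ?_ (le_max_right _ _)
  have h1 : (Nat.card (⊤ : Submodule (ZMod p) (Fin k → ZMod p)) : ℝ) = p ^ k := by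
    rw [Nat.card_congr Submodule.topEquiv.toEquiv, Nat.card_fun]
    simp
  have h2 : ((p : ℝ) ^ k - Nat.card K) / p ^ (k + i) ≤ 1 / p ^ i := by
    rw [div_le_div_iff₀ (by positivity) (by positivity), pow_add]
    have : (0 : ℝ) ≤ Nat.card K := by positivity
    nlinarith [pow_pos hp0 i, mul_nonneg this (pow_pos hp0 i).le]
  rw [h1]
  linarith

end potential

/-- Find a basis of a hidden space. -/
def findSpace (word : Com) : Com :=
  .seq (putMatrix (1 - ((var .i - var .j) + (var .j - var .i))))
    (forDown .r (var .k + 5) (.seq (sample word) eliminate))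

/-- The names of the variables that are used by `findSpace`. -/
def findSpaceNames : List Name := [.r, .i, .j, .l, .y, .e, .bit, .U, .base, .S, .piv, .row, .B]

namespace Frame

variable {F : Frame} {p m d n : ℕ} [F.Valid]

open Classical in
-- The vectors `Φ` may change with the number `κ` of invocations, as long as they hide the same `K`.
-- The factor `a` carries a probability or an indicator that belongs to another phase of the
-- algorithm, so that two searches can be chained.
theorem Tr.findSpace [hp : Fact p.Prime] [hS : Sizes F p m d n] {M : Mem} {ψ : Ket} {κ β k : ℕ}
    {word : Com} (hM : Params p m d n M) (hk : M .k 0 = k) (hbk : k ≤ m + d + 1)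
    (hβ : M .base 0 = β) (hbβ : β + (k + 5) < 2 ^ F.bound) (hψ : Within (Fresh β) ψ)
    {K : Submodule (ZMod p) (Fin k → ZMod p)}
    (hword : ∀ κ, ∃ (Φ : (Fin k → ℕ) → ℕ →₀ ℂ) (κ₁ : ℕ), HidesSpace K Φ ∧
      ∀ M' ψ' β', Mem.Agree findSpaceNames M M' → M' .base 0 = β' → Within (Prepared β' k n) ψ' →
        F.Det word M' ψ' κ fun M'' ψ'' κ'' => Mem.Agree [.i] M' M'' ∧ κ'' = κ₁ ∧
          ψ'' = extend (oracleOp β' k Φ) ψ') {a : ℝ} (ha0 : 0 ≤ a) :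
    F.Tr (QRam.findSpace word) M ψ κ
      (fun M' ψ' _ => Mem.Agree findSpaceNames M M' ∧ Reduced p k M' ∧
        M' .base 0 = β + (k + 5) ∧ Within (Fresh (β + (k + 5))) ψ')
      (fun M' ψ' _ => if rowSpace p k M' = K then a * weight ψ' else 0)
      (a * weight ψ * (9 / 10)) := by
  have h1 := Sizes.p_lt F p m d n
  have h2 := hS.two_le
  have h3 := hS.loops
  have hbk' : k ≤ F.bound := by omega
  set ε : ℝ := k * (p ^ 2 / 2 ^ n) with hε
  have hε0 : 0 ≤ ε := by positivity
  -- Both `k` and `k + 5` are at most `m + d + 6`, which explains the square in `Sizes.large`.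
  have hε1 : ε * (k + 5 : ℕ) ≤ 1 / 100 := by
    have h4 : 100 * (k * (k + 5) * p ^ 2) ≤ 2 ^ n := by
      refine le_trans ?_ hS.large
      rw [← mul_assoc]
      refine Nat.mul_le_mul_right _ (Nat.mul_le_mul_left _ ?_)
      rw [sq]
      exact Nat.mul_le_mul (by omega) (by omega)
    have h5 : (100 : ℝ) * (k * (k + 5) * p ^ 2) ≤ 2 ^ n := by exact_mod_cast h4
    rw [hε, mul_div, div_mul_eq_mul_div, div_le_div_iff₀ (by positivity) (by norm_num)]
    push_cast
    linarith
  have hε2 : ε ≤ 1 := by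
    push_cast at hε1
    nlinarith [mul_nonneg hε0 (Nat.cast_nonneg k : (0 : ℝ) ≤ k)]
  have hlt : 1 < 2 ^ F.bound := Nat.one_lt_two_pow (by have := Valid.bound_pos (F := F); omega)
  refine Tr.seq (Cl.putMatrix (k := k) (w := fun i j => if i = j then 1 else 0) hk hbk' ?_ ?_ _ _ _)
    ?_
  · intro i _ j _
    split_ifs <;> omega
  · intro i hi j hj M' ha hi' hj' _
    simp only [Expr.val_sub, Expr.val_add, val_var, Expr.val_ofNat, hi', hj']
    split_ifs with h
    · omega
    · omega
  rintro M₁ _ κ₁ ⟨⟨ha₁, hB₁⟩, rfl, rfl⟩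
  have hrow₁ : rowSpace p k M₁ = ⊤ := by
    have : rows p k M₁ = fun i => Pi.single i 1 := by
      funext i j
      rw [rows, hB₁ i i.isLt j j.isLt]
      simp only [Pi.single_apply, Fin.ext_iff, eq_comm]
      split_ifs <;> simp
    rw [rowSpace, this, eq_top_iff]
    rintro w -
    rw [Submodule.mem_span_range_iff_exists_fun]
    exact ⟨w, by simpa using (pi_eq_sum_univ' w).symm⟩
  have ha₁' : Mem.Agree findSpaceNames M M₁ := ha₁.weaken (by simp [findSpaceNames])
  refine (Tr.forDown (n := k + 5) (fun i M' ψ' _ => Mem.Agree findSpaceNames M M' ∧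
    Reduced p k M' ∧ M' .base 0 = β + (k + 5 - i) ∧ Within (Fresh (β + (k + 5 - i))) ψ' ∧ i ≤ k + 5)
    (fun i M' ψ' _ => weight ψ' * (a * potential ε K i (rowSpace p k M')))
    (by simp [ha₁ .k (by decide), hk]) (by omega) ⟨ha₁'.set (by simp [findSpaceNames]) _ _, ?_, ?_,
      by simpa using hψ, le_rfl⟩ ?_).mono ?_ ?_
  · intro i hi j hj
    rw [Mem.set_ne _ _ _ (by decide), hB₁ i hi j hj]
    split_ifs <;> omega
  · simp [ha₁ .base (by decide), hβ]
  · rintro i hi M' ψ' κ' - ⟨ha, hred, hbase, hfresh, -⟩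
    have ha' : Mem.Agree findSpaceNames M (M'.set .r 0 i) := ha.set (by simp [findSpaceNames]) _ _
    obtain ⟨Φ, κ₂, hΦ, hdet⟩ := hword κ'
    set X := rowSpace p k M' with hX
    refine Tr.seq ((Tr.sample (hM.agree ha' (by decide)) (by rw [ha' _ (by decide), hk]) hbk'
      (β := β + (k + 5 - (i + 1))) (by simpa using hbase) (by omega) hfresh hΦ (κ₁ := κ₂) ?_
      (V := fun u => a * potential ε K i (X ⊓ hyperplane u))
      (fun u => mul_nonneg ha0 (potential_nonneg _ _))).mono (fun _ _ _ h => ⟨h, le_rfl⟩) ?_) ?_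
    · intro M'' ψ'' ha''
      refine hdet M'' ψ'' _ (ha'.trans ha'' (by simp [findSpaceNames])) ?_
      rw [ha'' _ (by decide)]; simpa using hbase
    · rw [← Finset.mul_sum]
      refine mul_le_mul_of_nonneg_left ((mul_le_mul_of_nonneg_left
        (potential_succ_le hε0 hε2 i) ha0).trans (le_of_eq ?_)) (weight_nonneg _)
      ring
    · rintro M₂ ψ₂ κ₃ ⟨ha₂, rfl, hU, hbase₂, hfresh₂⟩
      have ha₂' : Mem.Agree findSpaceNames M M₂ := ha'.trans ha₂ (by simp [findSpaceNames])
      have hB₂ : M₂ .B = M' .B := by rw [ha₂ _ (by decide)]; simp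
      refine ((Cl.eliminate (m := m) (d := d) (n := n) (p := p) (k := k) (M := M₂)
        (by rw [ha₂' _ (by decide), hM.hp]) (by rw [ha₂' _ (by decide), hk]) hbk' ?_) _ _).tr ?_
      · intro i hi j hj
        rw [hB₂]; exact hred i hi j hj
      · rintro M₃ _ _ ⟨⟨ha₃, hred₃, hspace⟩, rfl, rfl⟩
        have hr₂ : rowSpace p k M₂ = X := by
          rw [hX, rowSpace, rowSpace]
          congr 2
          funext i j
          simp [rows, hB₂]
        have e1 : β + (k + 5 - (i + 1)) + 1 = β + (k + 5 - i) := by omega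
        rw [e1] at hbase₂ hfresh₂
        refine ⟨⟨?_, ha₂'.trans ha₃ (by simp [findSpaceNames]), hred₃, ?_, hfresh₂, by omega⟩, ?_⟩
        · rw [ha₃ _ (by decide), ha₂ _ (by decide)]; simp
        · rw [ha₃ _ (by decide), hbase₂]
        · rw [hspace, hr₂]
  · rintro M' ψ' κ' ⟨-, h4, h5, h6, h7, -⟩
    refine ⟨⟨h4, h5, by simpa using h6, by simpa using h7⟩, ?_⟩
    refine (mul_le_mul_of_nonneg_left (mul_le_mul_of_nonneg_left (potential_zero_le ε) ha0)
      (weight_nonneg _)).trans (le_of_eq ?_)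
    split_ifs <;> ring
  · rw [mul_comm a, mul_assoc]
    refine mul_le_mul_of_nonneg_left (mul_le_mul_of_nonneg_left ?_ ha0) (weight_nonneg _)
    have hr₁ : rowSpace p k (M₁.set .r 0 (k + 5)) = ⊤ := by
      rw [← hrow₁, rowSpace, rowSpace]
      congr 2
    rw [hr₁]
    refine le_trans ?_ (le_potential_top ε 5)
    -- The five extra rounds: `1/100` for rounding and `1/32` for an unlucky choice of hyperplanes
    -- leave more than `9/10`.
    have h6 : (1 : ℝ) / p ^ 5 ≤ 1 / 32 := by
      rw [show (32 : ℝ) = 2 ^ 5 by norm_num]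
      exact one_div_le_one_div_of_le (by positivity)
        (pow_le_pow_left₀ (by norm_num) (by exact_mod_cast h2) _)
    linarith

end Frame
end QRam

/-! ## Words in groups of nilpotency class two -/

section words

variable {G : Type*} [Group G]

/-- The product of the first `n` powers. -/
def powProd (g : ℕ → G) (w : ℕ → ℕ) : ℕ → G
  | 0 => 1
  | n + 1 => powProd g w n * g n ^ w n

theorem powProd_congr {g g' : ℕ → G} {w w' : ℕ → ℕ} {n : ℕ}
    (h : ∀ i < n, g i ^ w i = g' i ^ w' i) : powProd g w n = powProd g' w' n := by
  induction n with
  | zero => rfl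
  | succ n ih => rw [powProd, powProd, ih fun i hi => h i (by omega), h n (by omega)]

theorem normalWord_eq_powProd {n : ℕ} {g : Fin n → G} {w : Fin n → ℕ} {g' : ℕ → G} {w' : ℕ → ℕ}
    (h : ∀ i : Fin n, g i ^ w i = g' i ^ w' i) : normalWord g w = powProd g' w' n := by
  induction n with
  | zero => simp [normalWord, powProd]
  | succ n ih =>
    have := ih (g := fun i => g i.castSucc) (w := fun i => w i.castSucc) fun i => h i.castSucc
    rw [powProd, ← this, normalWord, List.ofFn_succ', List.concat_eq_append, List.prod_append,
      List.prod_singleton, h]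
    rfl

theorem powProd_add (g : ℕ → G) (w : ℕ → ℕ) (m d : ℕ) : powProd g w (m + d) =
    powProd g w m * powProd (fun i => g (m + i)) (fun i => w (m + i)) d := by
  induction d with
  | zero => simp [powProd]
  | succ d ih => rw [← add_assoc, powProd, powProd, ih, mul_assoc]

theorem powProd_modEq {p : ℕ} (hexp : ∀ g : G, g ^ p = 1) {g : ℕ → G} {w w' : ℕ → ℕ} {n : ℕ}
    (h : ∀ i < n, w i ≡ w' i [MOD p]) : powProd g w n = powProd g w' n :=
  powProd_congr fun i hi => by
    rw [pow_eq_pow_mod _ (hexp (g i)), h i hi, ← pow_eq_pow_mod _ (hexp (g i))]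

theorem powProd_zero (g : ℕ → G) (n : ℕ) : powProd g (fun _ => 0) n = 1 := by
  induction n with
  | zero => rfl
  | succ n ih => simp [powProd, ih]

theorem powProd_single (g : ℕ → G) {i n : ℕ} (hi : i < n) : powProd g (Pi.single i 1) n = g i := by
  induction n with
  | zero => omega
  | succ n ih =>
    by_cases h : i = n
    · subst h
      rw [powProd, Pi.single_eq_same, pow_one,
        powProd_congr (g' := g) (w' := fun _ => 0) fun j hj => by rw [Pi.single_eq_of_ne hj.ne],
        powProd_zero, one_mul]
    · rw [powProd, Pi.single_eq_of_ne (Ne.symm h), pow_zero, mul_one, ih (by omega)]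

theorem map_powProd {A : Type*} [Group A] (f : G →* A) (g : ℕ → G) (w : ℕ → ℕ) (n : ℕ) :
    f (powProd g w n) = powProd (fun i => f (g i)) w n := by
  induction n with
  | zero => simp [powProd]
  | succ n ih => simp [powProd, ih]

theorem powProd_mem {S : Subgroup G} {g : ℕ → G} (hg : ∀ i, g i ∈ S) (w : ℕ → ℕ) (n : ℕ) :
    powProd g w n ∈ S := by
  induction n with
  | zero => exact S.one_mem
  | succ n ih => exact S.mul_mem ih (S.pow_mem (hg n) _)

theorem powProd_mul {z : ℕ → G} (hz : ∀ i, z i ∈ Subgroup.center G) (w w' : ℕ → ℕ) (n : ℕ) :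
    powProd z w n * powProd z w' n = powProd z (fun i => w i + w' i) n := by
  induction n with
  | zero => simp [powProd]
  | succ n ih =>
    have h : z n ^ w n * powProd z w' n = powProd z w' n * z n ^ w n :=
      (Subgroup.mem_center_iff.1 (powProd_mem hz w' n) _)
    simp only [powProd, pow_add, ← ih]
    rw [mul_assoc, ← mul_assoc (z n ^ w n), h]
    simp only [mul_assoc]

theorem powProd_smul {z : ℕ → G} (hz : ∀ i, z i ∈ Subgroup.center G) (w : ℕ → ℕ) (t n : ℕ) :
    powProd z (fun i => t * w i) n = powProd z w n ^ t := by
  induction t with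
  | zero => simpa using powProd_zero z n
  | succ t ih => rw [pow_succ, ← ih, powProd_mul hz]; simp only [add_mul, one_mul]

/-- The element `c` is central and measures how far `g` and `h` are from commuting. -/
def IsComm (g h c : G) : Prop := c ∈ Subgroup.center G ∧ g * h = h * g * c

theorem IsComm.mul {g h h' c c' : G} (h₁ : IsComm g h c) (h₂ : IsComm g h' c') :
    IsComm g (h * h') (c * c') := by
  refine ⟨mul_mem h₁.1 h₂.1, ?_⟩
  have hc := Subgroup.mem_center_iff.1 h₁.1
  have hc' := Subgroup.mem_center_iff.1 h₂.1
  calc g * (h * h') = (g * h) * h' := by group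
    _ = h * g * (c * h') := by rw [h₁.2]; group
    _ = h * (g * h') * c := by rw [← hc h']; group
    _ = h * h' * g * (c' * c) := by rw [h₂.2]; group
    _ = h * h' * g * (c * c') := by rw [hc' c]

theorem IsComm.one (g : G) : IsComm g 1 1 := ⟨one_mem _, by simp⟩

theorem IsComm.inv {g h c : G} (h₁ : IsComm g h c) : IsComm h g c⁻¹ :=
  ⟨inv_mem h₁.1, by rw [h₁.2]; group⟩

theorem IsComm.pow {g h c : G} (h₁ : IsComm g h c) (n : ℕ) : IsComm g (h ^ n) (c ^ n) := by
  induction n with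
  | zero => simpa using IsComm.one g
  | succ n ih => rw [pow_succ, pow_succ]; exact ih.mul h₁

theorem IsComm.pow_left {g h c : G} (h₁ : IsComm g h c) (n : ℕ) : IsComm (g ^ n) h (c ^ n) := by
  simpa using (h₁.inv.pow n).inv

/-- In class two the commutator is bilinear, so the exponents of commutators add up. -/
theorem IsComm.powProd {x z : ℕ → G} (hz : ∀ i, z i ∈ Subgroup.center G) {g : G} {d n : ℕ}
    {c : ℕ → ℕ → ℕ} (hc : ∀ i < n, IsComm g (x i) (powProd z (c i) d)) (w : ℕ → ℕ) :
    IsComm g (powProd x w n) (_root_.powProd z (fun l => ∑ i ∈ Finset.range n, w i * c i l) d) := by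
  induction n with
  | zero => simpa [_root_.powProd, powProd_zero] using IsComm.one g
  | succ n ih =>
    simp only [_root_.powProd, Finset.sum_range_succ]
    rw [← powProd_mul hz, powProd_smul hz]
    exact (ih fun i hi => hc i (by omega)).mul ((hc n (by omega)).pow _)

/-- The product of two words whose exponents are multiples of the same vector. -/
theorem powProd_mul_powProd {x z : ℕ → G} (hz : ∀ i, z i ∈ Subgroup.center G) {d n : ℕ}
    {c : ℕ → ℕ → ℕ → ℕ} (hc : ∀ j < n, ∀ i < n, IsComm (x j) (x i) (powProd z (c j i) d))
    (v : ℕ → ℕ) (t s : ℕ) :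
    powProd x (fun i => t * v i) n * powProd x (fun i => s * v i) n =
      powProd x (fun i => (t + s) * v i) n * powProd z (fun l => t * s *
        ∑ j ∈ Finset.range n, ∑ i ∈ Finset.range j, v j * v i * c j i l) d := by
  induction n with
  | zero => simpa [powProd] using (powProd_zero z d).symm
  | succ n ih =>
    specialize ih fun j hj i hi => hc j (by omega) i (by omega)
    -- To append the last letter, `x n ^ (t v_n)` has to move past the first `n` letters of the
    -- second word. The central element that arises contains the factor `t s`, because one exponent
    -- is a multiple of `t` and the other of `s`.
    have h1 := (IsComm.powProd hz (g := x n ^ (t * v n)) (x := x) (n := n)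
      (c := fun i l => t * v n * c n i l) (fun i hi => by
        rw [powProd_smul hz]; exact (hc n (by omega) i (by omega)).pow_left _) fun i => s * v i)
    simp only [Finset.sum_range_succ, mul_add]
    rw [← powProd_mul hz]
    have h2 : powProd z (fun l => ∑ i ∈ Finset.range n, s * v i * (t * v n * c n i l)) d =
        powProd z (fun l => t * s * ∑ i ∈ Finset.range n, v n * v i * c n i l) d :=
      powProd_congr fun l _ => by
        rw [Finset.mul_sum]
        congr 1
        exact Finset.sum_congr rfl fun i _ => by ring
    rw [h2] at h1
    set E := powProd z (fun l => t * s * ∑ i ∈ Finset.range n, v n * v i * c n i l) d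
    set W := powProd z (fun l => t * s *
      ∑ j ∈ Finset.range n, ∑ i ∈ Finset.range j, v j * v i * c j i l) d
    have hE := Subgroup.mem_center_iff.1 h1.1
    have hW : ∀ g, g * W = W * g := Subgroup.mem_center_iff.1 (powProd_mem hz _ _)
    simp only [powProd]
    set P := powProd x (fun i => t * v i) n
    set Q := powProd x (fun i => s * v i) n
    set R := powProd x (fun i => (t + s) * v i) n
    calc P * x n ^ (t * v n) * (Q * x n ^ (s * v n))
        = P * (x n ^ (t * v n) * Q) * x n ^ (s * v n) := by group
      _ = (P * Q) * x n ^ (t * v n) * (E * x n ^ (s * v n)) := by rw [h1.2]; group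
      _ = R * (W * x n ^ (t * v n)) * (E * x n ^ (s * v n)) := by rw [ih]; group
      _ = R * (x n ^ (t * v n) * x n ^ (s * v n)) * (W * E) := by
        rw [← hE, ← hW]
        rw [mul_assoc R, mul_assoc (x n ^ (t * v n)), ← mul_assoc W, ← hW (x n ^ (s * v n))]
        group
      _ = R * x n ^ ((t + s) * v n) * (W * E) := by rw [← pow_add, ← Nat.add_mul]

end words

/-! ## Presentations with generators indexed by natural numbers -/

namespace Presentation

variable {G : Type*} [Group G] {p m d : ℕ} (B : Presentation G p m d)

/-- The generators `x i`. -/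
def gen (i : ℕ) : G := if h : i < m then B.x ⟨i, h⟩ else 1

/-- The generators `z i` of the commutator subgroup. -/
def cgen (i : ℕ) : G := if h : i < d then B.z ⟨i, h⟩ else 1

/-- The table of commutators. -/
def table (i j k : ℕ) : ℕ :=
  if h : i < m ∧ j < m ∧ k < d then B.c ⟨i, h.1⟩ ⟨j, h.2.1⟩ ⟨k, h.2.2⟩ else 0

/-- The element with the given word. -/
def elem (w : ℕ → ℕ) : G := powProd B.gen w m * powProd B.cgen (fun l => w (m + l)) d

theorem normalWord_append (w : ℕ → ℕ) :
    normalWord (Fin.append B.x B.z) (fun i => w i) = B.elem w := by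
  rw [normalWord_eq_powProd (g' := fun i => if i < m then B.gen i else B.cgen (i - m)) (w' := w),
    powProd_add, elem]
  · congr 1
    · exact powProd_congr fun i hi => by rw [if_pos hi]
    · exact powProd_congr fun i hi => by
        rw [if_neg (by omega), Nat.add_sub_cancel_left]
  · intro i
    congr 1
    refine Fin.addCases (fun i => ?_) (fun i => ?_) i
    · simp [gen]
    · simp [cgen]

theorem decode_eq {w : ℕ → ℕ} (hw : ∀ i < m + d, w i < p) :
    B.decode (fun i => w i) = some (B.elem w) := by
  rw [decode, if_pos fun i : Fin (m + d) => hw i i.isLt, normalWord_append]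

theorem elem_injective {w w' : ℕ → ℕ} (hw : ∀ i < m + d, w i < p) (hw' : ∀ i < m + d, w' i < p)
    (h : B.elem w = B.elem w') : ∀ i < m + d, w i = w' i := by
  rw [← normalWord_append, ← normalWord_append] at h
  have := B.normalForm.1 (a₁ := fun i => ⟨w i, hw i i.isLt⟩) (a₂ := fun i => ⟨w' i, hw' i i.isLt⟩) h
  intro i hi
  exact congrArg Fin.val (congrFun this ⟨i, hi⟩)

theorem elem_surjective (g : G) : ∃ w : ℕ → ℕ, (∀ i < m + d, w i < p) ∧ B.elem w = g := by
  obtain ⟨w, rfl⟩ := B.normalForm.2 g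
  refine ⟨fun i => if h : i < m + d then w ⟨i, h⟩ else 0, fun i hi => ?_, ?_⟩
  · simp only [dif_pos hi]; exact Fin.isLt _
  · rw [← normalWord_append]; simp

theorem cgen_mem (i : ℕ) : B.cgen i ∈ commutator G := by
  unfold cgen
  split_ifs with h
  · rw [← B.closure_z]; exact Subgroup.subset_closure ⟨_, rfl⟩
  · exact one_mem _

theorem elem_modEq (hexp : ∀ g : G, g ^ p = 1) {w w' : ℕ → ℕ}
    (h : ∀ i < m + d, w i ≡ w' i [MOD p]) : B.elem w = B.elem w' := by
  rw [elem, elem, powProd_modEq hexp fun i hi => h i (by omega),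
    powProd_modEq hexp (w' := fun l => w' (m + l)) fun i hi => h (m + i) (by omega)]

variable (hcen : commutator G ≤ Subgroup.center G)

include hcen

theorem isComm (i j : ℕ) (hi : i < m) (hj : j < m) :
    IsComm (B.gen i) (B.gen j) (powProd B.cgen (B.table i j) d) := by
  have h1 : powProd B.cgen (B.table i j) d =
      (B.gen i)⁻¹ * (B.gen j)⁻¹ * B.gen i * B.gen j := by
    rw [gen, gen, dif_pos hi, dif_pos hj, B.comm_eq]
    symm
    apply normalWord_eq_powProd
    intro l
    simp [cgen, table, hi, hj]
  refine ⟨powProd_mem (fun i => hcen (B.cgen_mem i)) _ _, ?_⟩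
  rw [h1]; group

/-- The `z_l` are central and have exponent `p`, so words in them are closed under products, and
inverses are powers with exponent `p - 1`. -/
theorem exists_powProd_cgen {g : G} (hexp : ∀ g : G, g ^ p = 1) (hp : 0 < p)
    (hg : g ∈ commutator G) : ∃ f : ℕ → ℕ, powProd B.cgen f d = g := by
  have hz := fun i => hcen (B.cgen_mem i)
  rw [← B.closure_z] at hg
  induction hg using Subgroup.closure_induction with
  | mem g hg =>
    obtain ⟨l, rfl⟩ := hg
    exact ⟨Pi.single l 1, by rw [powProd_single _ l.isLt]; simp [cgen]⟩
  | one => exact ⟨fun _ => 0, powProd_zero _ _⟩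
  | mul a b _ _ ha hb =>
    obtain ⟨f, rfl⟩ := ha
    obtain ⟨f', rfl⟩ := hb
    exact ⟨_, (powProd_mul hz f f' d).symm⟩
  | inv a _ ha =>
    obtain ⟨f, rfl⟩ := ha
    refine ⟨fun i => (p - 1) * f i, ?_⟩
    rw [powProd_smul hz, eq_inv_iff_mul_eq_one, ← pow_succ, Nat.sub_add_cancel hp, hexp]

/-- An element of the commutator subgroup has no letters `x i` in its word. -/
theorem eq_zero_of_elem_mem (hexp : ∀ g : G, g ^ p = 1) (hp : 0 < p) {w : ℕ → ℕ}
    (hw : ∀ i < m + d, w i < p) (h : B.elem w ∈ commutator G) : ∀ i < m, w i = 0 := by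
  obtain ⟨f, hf⟩ := B.exists_powProd_cgen hcen hexp hp h
  have h1 : B.elem (fun i => if i < m then 0 else f (i - m) % p) = B.elem w := by
    rw [← hf, elem, powProd_congr (g' := B.gen) (w' := fun _ => 0) fun i hi => by simp [hi], powProd_zero,
      one_mul]
    exact powProd_modEq hexp fun i _ => by simp [Nat.ModEq]
  intro i hi
  have := B.elem_injective (fun i _ => ?_) hw h1 i (by omega)
  · simpa [hi] using this.symm
  · split_ifs
    · exact hp
    · exact Nat.mod_lt _ hp

omit hcen in
include B in
-- A group of exponent 2 is abelian, so all `z_l` would be trivial; a single one would already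
-- contradict the uniqueness of normal words. Hence 2 is never to be inverted modulo 2.
theorem d_eq_zero (hexp : ∀ g : G, g ^ p = 1) (hp : p = 2) : d = 0 := by
  by_contra hd
  have hcomm (a b : G) : a * b = b * a := by
    have h1 (g : G) : g⁻¹ = g := by
      have := hexp g
      rw [hp, sq] at this
      exact inv_eq_of_mul_eq_one_left this
    calc a * b = (a * b)⁻¹ := (h1 _).symm
      _ = b * a := by rw [mul_inv_rev, h1, h1]
  have hbot : commutator G = ⊥ := by
    rw [commutator_eq_bot_iff_center_eq_top, eq_top_iff]
    exact fun a _ => Subgroup.mem_center_iff.2 fun b => hcomm b a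
  have hz (i : ℕ) : B.cgen i = 1 := by
    have := B.cgen_mem i
    rwa [hbot, Subgroup.mem_bot] at this
  have h1 : B.elem (Pi.single m 1) = B.elem 0 := by
    rw [elem, elem]
    congr 1
    · exact powProd_congr fun i hi => by rw [Pi.single_eq_of_ne hi.ne]; rfl
    · exact powProd_congr fun i _ => by rw [hz, one_pow, one_pow]
  have h2 := B.elem_injective (fun i _ => ?_) (fun i _ => by simp; omega) h1 m (by omega)
  · simp at h2
  · by_cases h : i = m
    · subst h; simp; omega
    · rw [Pi.single_eq_of_ne h]; omega

end Presentation

namespace QRam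

/-! ## Hidden subspaces -/

section hidden

variable {G : Type*} [Group G] {p k : ℕ} [hp : Fact p.Prime]

/-- The map `θ` is a homomorphism up to elements of `S`. -/
def HomMod (p : ℕ) (S : Subgroup G) (θ : (Fin k → ℕ) → G) : Prop :=
  ∀ x y z, reduce p z = reduce p x + reduce p y → (θ x * θ y)⁻¹ * θ z ∈ S

theorem reduce_val (e : Fin k → ZMod p) : reduce p (fun i => (e i).val) = e := by
  funext i; simp [reduce]

theorem HomMod.zero {S : Subgroup G} {θ : (Fin k → ℕ) → G} (h : HomMod p S θ) {x : Fin k → ℕ}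
    (hx : reduce p x = 0) : θ x ∈ S := by
  have := h x x x (by rw [hx, add_zero])
  rwa [mul_inv_rev, mul_assoc, inv_mul_cancel, mul_one, inv_mem_iff] at this

theorem HomMod.mem_iff {S : Subgroup G} {θ : (Fin k → ℕ) → G} (h : HomMod p S θ)
    {x y z : Fin k → ℕ} (hz : reduce p z = reduce p x + reduce p y) :
    (θ x)⁻¹ * θ z ∈ S ↔ θ y ∈ S := by
  have h1 := h x y z hz
  have h2 : (θ x)⁻¹ * θ z = θ y * ((θ x * θ y)⁻¹ * θ z) := by group
  rw [h2, Subgroup.mul_mem_cancel_right _ h1]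

/-- The map is fed with numbers up to `2 ^ n` and not with residues. Comparing with the argument 0
shows that membership in `S` depends on the residues only. -/
theorem HomMod.mem_congr {S : Subgroup G} {θ : (Fin k → ℕ) → G} (h : HomMod p S θ)
    {x y : Fin k → ℕ} (hxy : reduce p x = reduce p y) : θ x ∈ S ↔ θ y ∈ S := by
  have h0 : reduce p (fun _ : Fin k => 0) = 0 := by funext i; simp [reduce]
  rw [← h.mem_iff (x := fun _ => 0) (y := y) (z := x) (by rw [h0, hxy, zero_add]),
    Subgroup.mul_mem_cancel_left _ (inv_mem (h.zero h0))]

/-- The preimage of `S`. -/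
def hiddenSpace (S : Subgroup G) (θ : (Fin k → ℕ) → G) (h : HomMod p S θ) :
    Submodule (ZMod p) (Fin k → ZMod p) :=
  AddSubgroup.toZModSubmodule p
    { carrier := {e | θ (fun i => (e i).val) ∈ S}
      add_mem' := fun {a b} ha hb => by
        have h1 := h.mem_iff (x := fun i => (a i).val) (y := fun i => (b i).val)
          (z := fun i => ((a + b) i).val) (by simp only [reduce_val])
        exact (Subgroup.mul_mem_cancel_left _ (inv_mem ha)).1 (h1.2 hb)
      zero_mem' := h.zero (reduce_val _)
      neg_mem' := fun {a} ha => by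
        have h1 := h.mem_iff (x := fun i => (a i).val) (y := fun i => ((-a) i).val)
          (z := fun i => ((0 : Fin k → ZMod p) i).val)
          (by simp only [reduce_val, add_neg_cancel])
        exact h1.1 (mul_mem (inv_mem ha) (h.zero (reduce_val _))) }

theorem mem_hiddenSpace {S : Subgroup G} {θ : (Fin k → ℕ) → G} (h : HomMod p S θ)
    {x : Fin k → ℕ} : reduce p x ∈ hiddenSpace S θ h ↔ θ x ∈ S := by
  change θ (fun i => (reduce p x i).val) ∈ S ↔ _
  exact h.mem_congr (reduce_val _)

theorem sub_mem_hiddenSpace {S : Subgroup G} {θ : (Fin k → ℕ) → G} (h : HomMod p S θ)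
    {x x' : Fin k → ℕ} :
    reduce p x' - reduce p x ∈ hiddenSpace S θ h ↔ (θ x)⁻¹ * θ x' ∈ S := by
  rw [h.mem_iff (y := fun i => ((reduce p x' - reduce p x) i).val)
    (by rw [reduce_val, add_sub_cancel]), ← mem_hiddenSpace h, reduce_val]

/-- A vector of a Hilbert space as a state of one cell. -/
noncomputable def cellState {D : ℕ} (Ψ : EuclideanSpace ℂ (Fin D)) : ℕ →₀ ℂ :=
  ∑ y : Fin D, Finsupp.single (y : ℕ) (Ψ y)

theorem dot_cellState {D : ℕ} (Ψ Ψ' : EuclideanSpace ℂ (Fin D)) :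
    dot (cellState Ψ) (cellState Ψ') = inner ℂ Ψ Ψ' := by
  have h1 (Ψ : EuclideanSpace ℂ (Fin D)) (y : Fin D) : cellState Ψ y = Ψ y := by
    simp [cellState, Finsupp.finsetSum_apply, Finsupp.single_apply, Fin.val_inj]
  have h2 : (cellState Ψ).support ⊆ Finset.range D := fun a ha => by
    by_contra h
    rw [Finset.mem_range] at h
    refine Finsupp.mem_support_iff.1 ha ?_
    rw [cellState, Finsupp.finsetSum_apply]
    exact Finset.sum_eq_zero fun y _ => Finsupp.single_eq_of_ne (by omega)
  rw [dot, Finsupp.sum_of_support_subset _ h2 _ (by simp), Finset.sum_range, PiLp.inner_apply]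
  refine Finset.sum_congr rfl fun y _ => ?_
  rw [h1, h1, RCLike.inner_apply, mul_comm]

theorem hidesSpace_of_isHidingSet {S : Subgroup G} {θ : (Fin k → ℕ) → G} (h : HomMod p S θ)
    {D : ℕ} {Ψ : G → EuclideanSpace ℂ (Fin D)} (hΨ : IsHidingSet S Ψ) :
    HidesSpace (hiddenSpace S θ h) fun x => cellState (Ψ (θ x)) := by
  intro x x'
  rw [sub_mem_hiddenSpace h, dot_cellState]
  refine ⟨fun hx => ?_, hΨ.inner_eq_zero _ _⟩
  rw [hΨ.eq_of_mem _ _ hx, inner_self_eq_norm_sq_to_K, hΨ.norm_eq_one]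
  simp

theorem hidesSpace_of_hides {S : Subgroup G} {θ : (Fin k → ℕ) → G} (h : HomMod p S θ)
    {f : G → ℕ} (hf : Hides f S) :
    HidesSpace (hiddenSpace S θ h) fun x => Finsupp.single (f (θ x)) 1 := by
  intro x x'
  rw [sub_mem_hiddenSpace h, ← hf]
  constructor
  · intro hx
    simp [dot, hx]
  · intro hx
    simp [dot, hx]

end hidden
end QRam

/-! ### The abelian and the quadratic parametrization -/

namespace Presentation

open QRam

variable {G : Type*} [Group G] {p m d : ℕ} (B : Presentation G p m d)

theorem add_pred_mul_modEq {p : ℕ} (hp : 0 < p) (a : ℕ) : a + (p - 1) * a ≡ 0 [MOD p] := by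
  have : a + (p - 1) * a = p * a := by
    obtain ⟨q, rfl⟩ : ∃ q, p = q + 1 := ⟨p - 1, by omega⟩
    simp; ring
  rw [this]
  exact (Nat.modEq_zero_iff_dvd.2 (dvd_mul_right p a))

/-- The element with the exponents `x` of the generators outside of the commutator subgroup. -/
def abelianElem (x : Fin m → ℕ) : G := B.elem (abelianWord p m x)

/-- The element with the word `quadraticWord`. -/
def quadraticElem (v : ℕ → ℕ) (x : Fin (d + 1) → ℕ) : G := B.elem (quadraticWord p m d v x)

/-- The exponents of the commutator part of the square of the word `v`. -/
def squareForm (v : ℕ → ℕ) (l : ℕ) : ℕ :=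
  ∑ j ∈ Finset.range m, ∑ i ∈ Finset.range j, v j * v i * B.table j i l

variable (hexp : ∀ g : G, g ^ p = 1)

include hexp

theorem abelianElem_eq (x : Fin m → ℕ) :
    B.abelianElem x = powProd B.gen (fun i => if h : i < m then x ⟨i, h⟩ else 0) m := by
  rw [abelianElem, elem, powProd_congr (g := B.cgen) (g' := B.cgen) (w' := fun _ => 0) fun i _ => by
    rw [abelianWord, dif_neg (by omega)], powProd_zero, mul_one]
  exact powProd_modEq hexp fun i hi => by simp [abelianWord, hi, Nat.ModEq]

theorem quadraticElem_eq (v : ℕ → ℕ) (x : Fin (d + 1) → ℕ) :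
    B.quadraticElem v x = powProd B.gen (fun i => x 0 * v i) m * powProd B.cgen
      (fun l => x 0 * x 0 * v (m + l) + if h : l < d then x ⟨l + 1, by omega⟩ else 0) d := by
  rw [quadraticElem, elem]
  congr 1
  · exact powProd_modEq hexp fun i hi => by simp [quadraticWord, hi, Nat.ModEq]
  · exact powProd_modEq hexp fun i hi => by simp [quadraticWord, hi, Nat.ModEq]

/-- In the abelianization all letters commute and exponents may be added modulo `p`. -/
theorem homMod_abelianElem {S : Subgroup G} (hS : commutator G ≤ S) :
    HomMod p S B.abelianElem := by
  intro x y z hz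
  refine hS ?_
  rw [← Abelianization.ker_of, MonoidHom.mem_ker, map_mul, map_inv, map_mul, inv_mul_eq_one]
  simp only [B.abelianElem_eq hexp, map_powProd]
  have hexp' (a : Abelianization G) : a ^ p = 1 := by
    obtain ⟨g, rfl⟩ := QuotientGroup.mk_surjective a
    change Abelianization.of g ^ p = 1
    rw [← map_pow, hexp, map_one]
  rw [powProd_mul fun i => by rw [CommGroup.center_eq_top]; trivial]
  refine powProd_modEq hexp' fun i hi => ?_
  have := congrFun hz ⟨i, hi⟩
  simp only [reduce, Pi.add_apply, ← Nat.cast_add] at this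
  simpa [hi] using ((ZMod.natCast_eq_natCast_iff _ _ _).1 this).symm

variable (hcen : commutator G ≤ Subgroup.center G)

include hcen

/-- The product of the values at `t` and `s` has the commutator defect `t s` times `squareForm`, and
by `hv` this is exactly what completes `t² + s²` to `(t + s)²` in the exponents of the `z_l`. The
map is thus an honest homomorphism, so `S` can be arbitrary, in particular trivial. -/
theorem homMod_quadraticElem {v : ℕ → ℕ} (hv : ∀ l < d, 2 * v (m + l) ≡ B.squareForm v l [MOD p])
    (S : Subgroup G) : HomMod p S (B.quadraticElem v) := by
  intro x y z hz
  have hcg := fun i => hcen (B.cgen_mem i)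
  have hz' (i : Fin (d + 1)) : x i + y i ≡ z i [MOD p] := by
    have := congrFun hz i
    simp only [reduce, Pi.add_apply, ← Nat.cast_add] at this
    exact ((ZMod.natCast_eq_natCast_iff _ _ _).1 this).symm
  have h1 : B.quadraticElem v x * B.quadraticElem v y = B.quadraticElem v z := by
    simp only [B.quadraticElem_eq hexp]
    set P := powProd B.gen (fun i => x 0 * v i) m
    set Q := powProd B.gen (fun i => y 0 * v i) m
    set E := powProd B.cgen
      (fun l => x 0 * x 0 * v (m + l) + if h : l < d then x ⟨l + 1, by omega⟩ else 0) d with hE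
    set E' := powProd B.cgen
      (fun l => y 0 * y 0 * v (m + l) + if h : l < d then y ⟨l + 1, by omega⟩ else 0) d with hE'
    have hc : Q * E = E * Q := Subgroup.mem_center_iff.1 (powProd_mem hcg _ _) Q
    calc P * E * (Q * E') = P * (E * Q) * E' := by group
      _ = (P * Q) * (E * E') := by rw [← hc]; group
      _ = _ := by
        rw [powProd_mul_powProd hcg fun j hj i hi => B.isComm hcen j i hj hi, hE, hE',
          powProd_mul hcg, mul_assoc, powProd_mul hcg]
        congr 1
        · exact powProd_modEq hexp fun i _ => (hz' 0).mul_right _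
        · refine powProd_modEq hexp fun l hl => ?_
          have h2 := hz' ⟨l + 1, by omega⟩
          simp only [hl, dite_true]
          change x 0 * y 0 * B.squareForm v l + _ ≡ _ [MOD p]
          calc _ ≡ x 0 * y 0 * (2 * v (m + l)) +
                (x 0 * x 0 * v (m + l) + x ⟨l + 1, by omega⟩ +
                  (y 0 * y 0 * v (m + l) + y ⟨l + 1, by omega⟩)) [MOD p] :=
                (((hv l hl).symm.mul_left _).add_right _)
            _ = (x 0 + y 0) * (x 0 + y 0) * v (m + l) +
                (x ⟨l + 1, by omega⟩ + y ⟨l + 1, by omega⟩) := by ring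
            _ ≡ _ [MOD p] := (((hz' 0).mul (hz' 0)).mul_right _).add h2
  rw [h1, inv_mul_cancel]
  exact one_mem _

variable [hp : Fact p.Prime]

/-- Every element of the subgroup generated by the word `v` and the commutator subgroup is the value
of `quadraticElem`. -/
theorem exists_quadraticElem {v : ℕ → ℕ}
    (hv : ∀ l < d, 2 * v (m + l) ≡ B.squareForm v l [MOD p])
    {g : G} (hg : g ∈ Subgroup.zpowers (powProd B.gen v m) ⊔ commutator G) :
    ∃ x, B.quadraticElem v x = g := by
  have hom := B.homMod_quadraticElem hexp hcen hv ⊥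
  have hmul (x y : Fin (d + 1) → ℕ) :
      B.quadraticElem v x * B.quadraticElem v y = B.quadraticElem v (x + y) := by
    have := hom x y (x + y) (by funext i; simp [reduce])
    rwa [Subgroup.mem_bot, inv_mul_eq_one] at this
  let R : Subgroup G :=
    { carrier := Set.range (B.quadraticElem v)
      mul_mem' := by
        rintro _ _ ⟨x, rfl⟩ ⟨y, rfl⟩
        exact ⟨_, (hmul x y).symm⟩
      one_mem' := ⟨0, by
        simpa using hom.zero (x := 0) (by funext i; simp [reduce])⟩
      inv_mem' := by
        rintro _ ⟨x, rfl⟩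
        refine ⟨fun i => (p - 1) * x i, ?_⟩
        rw [eq_inv_iff_mul_eq_one, hmul]
        have := hom.zero (x := (fun i => (p - 1) * x i) + x) (by
          funext i
          have := (ZMod.natCast_eq_natCast_iff _ _ _).2 (add_pred_mul_modEq hp.out.pos (x i))
          simp only [reduce, Pi.add_apply]
          rw [add_comm, this]; simp)
        simpa using this }
  suffices h : Subgroup.zpowers (powProd B.gen v m) ⊔ commutator G ≤ R from h hg
  refine sup_le ?_ ?_
  · rw [Subgroup.zpowers_le]
    -- At `t = 1` the quadratic correction is `v (m + l)`; adding `p - 1` times the same number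
    -- cancels it modulo `p`.
    refine ⟨Fin.cons 1 fun l => (p - 1) * v (m + l), ?_⟩
    rw [B.quadraticElem_eq hexp]
    have : powProd B.cgen (fun l => (Fin.cons 1 fun l : Fin d => (p - 1) * v (m + l) :
        Fin (d + 1) → ℕ) 0 * (Fin.cons 1 fun l : Fin d => (p - 1) * v (m + l) :
        Fin (d + 1) → ℕ) 0 * v (m + l) + if h : l < d then
          (Fin.cons 1 fun l : Fin d => (p - 1) * v (m + l) : Fin (d + 1) → ℕ) ⟨l + 1, by omega⟩
          else 0) d = 1 := by
      rw [← powProd_zero B.cgen d]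
      refine powProd_modEq hexp fun l hl => ?_
      have e : (⟨l + 1, by omega⟩ : Fin (d + 1)) = (⟨l, hl⟩ : Fin d).succ := rfl
      simp only [hl, dite_true, e, Fin.cons_succ, Fin.cons_zero, one_mul]
      exact add_pred_mul_modEq hp.out.pos _
    rw [this, mul_one]
    simp
  · rw [← B.closure_z, Subgroup.closure_le]
    rintro _ ⟨l, rfl⟩
    refine ⟨Pi.single l.succ 1, ?_⟩
    rw [B.quadraticElem_eq hexp, powProd_congr (g' := B.gen) (w' := fun _ => 0) fun i _ => by simp,
      powProd_zero, one_mul, ← show B.cgen l = B.z l by simp [cgen],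
      ← powProd_single B.cgen l.isLt]
    refine powProd_congr fun i hi => ?_
    congr 1
    by_cases h : i = l
    · subst h
      have e : (⟨(l : ℕ) + 1, by omega⟩ : Fin (d + 1)) = l.succ := rfl
      simp [e]
    · have e : (⟨i + 1, by omega⟩ : Fin (d + 1)) ≠ l.succ := by
        intro h'; apply h; simpa [Fin.ext_iff] using h'
      simp [hi, h, Pi.single_eq_of_ne e]

omit hcen hp in
theorem abelianElem_elem (w : ℕ → ℕ) :
    B.elem w = B.abelianElem (fun i : Fin m => w i) * powProd B.cgen (fun l => w (m + l)) d := by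
  rw [B.abelianElem_eq hexp, elem]
  congr 1
  exact powProd_congr fun i hi => by simp [hi]

/-- Up to commutators, the elements of a subgroup of prime order are powers of any nontrivial element
among them. -/
theorem le_zpowers_sup {H : Subgroup G} (hH : Nat.card H = 1 ∨ Nat.card H = p) {v : Fin m → ℕ}
    (hv : ∀ i, v i < p) (hmem : B.abelianElem v ∈ H ⊔ commutator G)
    (hzero : (∀ i, v i = 0) → ∀ x, B.abelianElem x ∈ H ⊔ commutator G → ∀ i, x i ≡ 0 [MOD p]) :
    H ≤ Subgroup.zpowers (B.abelianElem v) ⊔ commutator G := by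
  intro h hh
  have hc (w : ℕ → ℕ) : powProd B.cgen w d ∈ commutator G := powProd_mem B.cgen_mem w d
  -- If `v` vanishes, then `hzero` says that the preimage of `HG'` is zero, so `H` lies in the
  -- commutator subgroup.
  by_cases h0 : ∀ i, v i = 0
  · obtain ⟨w, -, rfl⟩ := B.elem_surjective h
    rw [B.abelianElem_elem hexp] at hh ⊢
    have h1 := hzero h0 (fun i => w i) ((Subgroup.mul_mem_cancel_right _
      (Subgroup.mem_sup_right (hc _))).1 (Subgroup.mem_sup_left hh))
    rw [B.abelianElem_eq hexp (fun i => w i), powProd_modEq hexp (w' := fun _ => 0) fun i hi => by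
      simpa [hi] using h1 ⟨i, hi⟩, powProd_zero, one_mul]
    exact Subgroup.mem_sup_right (hc _)
  · have hy : B.abelianElem v ∉ commutator G := fun h2 => h0 fun i => by
      have := B.eq_zero_of_elem_mem hcen hexp hp.out.pos (w := abelianWord p m v) (fun i _ => ?_) h2
        i i.isLt
      · simpa [abelianWord, Nat.mod_eq_of_lt (hv i)] using this
      · unfold abelianWord
        split_ifs
        · exact Nat.mod_lt _ hp.out.pos
        · exact hp.out.pos
    have hy' : Abelianization.of (B.abelianElem v) ≠ 1 := fun h2 =>
      hy (by rwa [← Abelianization.ker_of, MonoidHom.mem_ker])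
    have hmap : Abelianization.of (B.abelianElem v) ∈ H.map Abelianization.of := by
      have h2 := Subgroup.mem_map_of_mem Abelianization.of hmem
      rwa [Subgroup.map_sup, (Subgroup.map_eq_bot_iff (f := Abelianization.of) (commutator G)).2
        (Abelianization.ker_of G).ge, sup_bot_eq] at h2
    -- The image of `H` has order dividing 1 or `p` and contains a nontrivial element, so this
    -- element generates it.
    have hcard : Nat.card (H.map Abelianization.of) = p := by
      have h2 := Subgroup.card_map_dvd H Abelianization.of
      have h3 : Nat.card (H.map Abelianization.of) ≠ 1 := fun h3 => hy' (by
        rw [Subgroup.card_eq_one.1 h3] at hmap; exact hmap)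
      rcases hH with h4 | h4
      · rw [h4] at h2; exact absurd (Nat.dvd_one.1 h2) h3
      · rw [h4] at h2; exact ((Nat.dvd_prime hp.out).1 h2).resolve_left h3
    obtain ⟨t, ht⟩ := Subgroup.mem_zpowers_iff.1 (mem_zpowers_of_prime_card hcard
      (g := ⟨_, hmap⟩) (g' := ⟨_, Subgroup.mem_map_of_mem _ hh⟩)
      fun h2 => hy' (congrArg Subtype.val h2))
    have ht' : Abelianization.of (B.abelianElem v) ^ t = Abelianization.of h := by
      simpa using congrArg Subtype.val ht
    have h5 : (B.abelianElem v ^ t)⁻¹ * h ∈ commutator G := by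
      rw [← Abelianization.ker_of, MonoidHom.mem_ker, map_mul, map_inv, map_zpow, ht',
        inv_mul_cancel]
    have h6 := Subgroup.mul_mem_sup (Subgroup.zpow_mem_zpowers (B.abelianElem v) t) h5
    rwa [mul_inv_cancel_left] at h6

/-- If the words `quadraticWord` of vectors that span the preimage of `H` vanish, then `H` is
trivial, and otherwise every one that does not vanish is the word of a generator. -/
theorem zpowers_eq {H : Subgroup G} (hH : Nat.card H = 1 ∨ Nat.card H = p) {v : ℕ → ℕ}
    (hv : ∀ l < d, 2 * v (m + l) ≡ B.squareForm v l [MOD p])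
    (hle : H ≤ Subgroup.zpowers (powProd B.gen v m) ⊔ commutator G)
    {ι : Type*} {b : ι → Fin (d + 1) → ℕ}
    (hb : Submodule.span (ZMod p) (Set.range fun i => reduce p (b i)) =
      hiddenSpace H (B.quadraticElem v) (B.homMod_quadraticElem hexp hcen hv H))
    {w : ℕ → ℕ} (hw : (∃ i, ∃ l < m + d, quadraticWord p m d v (b i) l ≠ 0 ∧
        ∀ l < m + d, w l = quadraticWord p m d v (b i) l) ∨
      ((∀ i, ∀ l < m + d, quadraticWord p m d v (b i) l = 0) ∧ ∀ l < m + d, w l = 0)) :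
    ∃ h : G, B.decode (fun i => w i) = some h ∧ Subgroup.zpowers h = H := by
  have hlt (x : Fin (d + 1) → ℕ) (l : ℕ) : quadraticWord p m d v x l < p := by
    unfold quadraticWord
    split_ifs
    · exact Nat.mod_lt _ hp.out.pos
    · exact Nat.mod_lt _ hp.out.pos
    · exact hp.out.pos
  have hone : B.elem (fun _ => 0) = 1 := by rw [elem, powProd_zero, powProd_zero, mul_one]
  have hw' : ∀ l < m + d, w l < p := by
    rcases hw with ⟨i, -, -, -, h2⟩ | ⟨-, h2⟩ <;> intro l hl <;> rw [h2 l hl]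
    · exact hlt _ _
    · exact hp.out.pos
  refine ⟨B.elem w, B.decode_eq hw', ?_⟩
  rcases hw with ⟨i, l, hl, h1, h2⟩ | ⟨h1, h2⟩
  · have e : B.elem w = B.quadraticElem v (b i) :=
      B.elem_modEq hexp fun l hl => by rw [h2 l hl]
    have hmem : B.elem w ∈ H := by
      rw [e, ← mem_hiddenSpace (B.homMod_quadraticElem hexp hcen hv H), ← hb]
      exact Submodule.subset_span ⟨i, rfl⟩
    have hne : B.elem w ≠ 1 := fun h3 => h1 (by
      rw [← h2 l hl]
      exact B.elem_injective hw' (fun _ _ => hp.out.pos) (h3.trans hone.symm) l hl)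
    have hcard : Nat.card H = p := hH.resolve_left fun h3 => hne (by
      rw [Subgroup.card_eq_one.1 h3] at hmem; exact hmem)
    refine le_antisymm (Subgroup.zpowers_le.2 hmem) fun h hh => ?_
    obtain ⟨t, ht⟩ := Subgroup.mem_zpowers_iff.1 (mem_zpowers_of_prime_card hcard
      (g := ⟨_, hmem⟩) (g' := ⟨h, hh⟩) fun h4 => hne (congrArg Subtype.val h4))
    exact Subgroup.mem_zpowers_iff.2 ⟨t, by simpa using congrArg Subtype.val ht⟩
  · have hom := B.homMod_quadraticElem hexp hcen hv ⊥
    -- All vectors of a spanning set map to 1, hence so does the whole preimage of `H`; and every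
    -- element of `H` is a value of the map.
    have hker : hiddenSpace H (B.quadraticElem v) (B.homMod_quadraticElem hexp hcen hv H) ≤
        hiddenSpace ⊥ (B.quadraticElem v) hom := by
      rw [← hb, Submodule.span_le]
      rintro _ ⟨i, rfl⟩
      rw [SetLike.mem_coe, mem_hiddenSpace, Subgroup.mem_bot, ← hone]
      exact B.elem_modEq hexp fun l hl => by rw [h1 i l hl]
    have hbot : H = ⊥ := by
      rw [eq_bot_iff]
      intro h hh
      obtain ⟨x, rfl⟩ := B.exists_quadraticElem hexp hcen hv (hle hh)
      exact (mem_hiddenSpace hom).1 (hker ((mem_hiddenSpace _).2 hh))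
    have : B.elem w = 1 := by
      rw [← hone]
      exact B.elem_modEq hexp fun l hl => by rw [h2 l hl]
    rw [this, hbot, Subgroup.zpowers_one_eq_bot]

end Presentation

namespace QRam

/-! ## The two oracles -/

/-- Apply the hiding procedure to the word given by the coordinates. -/
def hideWord : Com := withWord computeAbelian (.hide (cellW 0) (var .base))

/-- Apply the hiding function to the word given by the coordinates. -/
def queryWord : Com := withWord computeQuadratic (.query (cellW 0) (var .base))

/-- The oracle reads `len'` letters, which may be more than the `len` that were written:
`abelianWord` has `m` letters, and the other `d` come from cells that are still zero. -/
theorem block_xorWords {β k n len len' : ℕ} {b : Basis} (hb : Prepared β k n b) {h : ℕ → ℕ}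
    (hh : ∀ i, len ≤ i → h i = 0) :
    block len' (β + 1 + k + 7) (xorWords (β + 1 + k + 7) len h b) = fun i : Fin len' => h i := by
  funext i
  rw [block, xorWords_apply, hb.zero _ (by omega), Nat.zero_xor, Nat.add_sub_cancel_left]
  split_ifs with h1
  · rfl
  · rw [hh _ (by omega)]

theorem xorWords_base {β k n len : ℕ} {b : Basis} (hb : Prepared β k n b) (h : ℕ → ℕ) :
    xorWords (β + 1 + k + 7) len h b β = 0 := by
  rw [xorWords_apply, if_neg (by omega), hb.base]

theorem hideK_of_eq_some {O : Oracles} {i a c : ℕ} {b : Basis}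
    {Ψ : EuclideanSpace ℂ (Fin (O.dim i))} (h : O.hidden i (block O.len a b) = some Ψ)
    (hc : c < a) (h0 : b c = 0) :
    hideK O i a c b = (cellState Ψ).mapDomain fun y => b.update c y := by
  unfold hideK
  rw [h]
  dsimp only
  rw [if_neg (by omega), cellState, Finsupp.mapDomain_finsetSum]
  exact Finset.sum_congr rfl fun y _ => by rw [Finsupp.mapDomain_single]

theorem queryK_of_eq_some {O : Oracles} {a c : ℕ} {b : Basis} {v : ℕ}
    (h : O.label (block O.len a b) = some v) (hc : c < a) (h0 : b c = 0) :
    queryK O a c b = (Finsupp.single v (1 : ℂ)).mapDomain fun y => b.update c y := by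
  unfold queryK
  rw [h]
  dsimp only
  rw [if_neg (by omega), h0, Nat.zero_xor, Finsupp.mapDomain_single]

theorem abelianWord_lt {p m : ℕ} (hp : 0 < p) (x : Fin m → ℕ) (i : ℕ) : abelianWord p m x i < p := by
  unfold abelianWord
  split_ifs
  · exact Nat.mod_lt _ hp
  · exact hp

theorem quadraticWord_lt {p m d : ℕ} (hp : 0 < p) (v : ℕ → ℕ) (x : Fin (d + 1) → ℕ) (i : ℕ) :
    quadraticWord p m d v x i < p := by
  unfold quadraticWord
  split_ifs
  · exact Nat.mod_lt _ hp
  · exact Nat.mod_lt _ hp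
  · exact hp

namespace Frame

variable {F : Frame} {p m d n : ℕ} [F.Valid] [hS : Sizes F p m d n]
  {G : Type*} [Group G] {B : Presentation G p m d} {f : G → ℕ} {D : ℕ → ℕ}
  {Ψ : (i : ℕ) → G → EuclideanSpace ℂ (Fin (D i))} {τ : ℕ}

theorem Det.hideWord (hF : F.oracles = B.oracles f D Ψ τ) {M : Mem} {ψ : Ket} {κ β : ℕ}
    (hM : Params p m d n M) (hβ : M .base 0 = β) (hk : M .k 0 = m)
    (hψ : Within (Prepared β m n) ψ) :
    F.Det QRam.hideWord M ψ κ fun M' ψ' κ' => Mem.Agree [.i] M M' ∧ κ' = κ + 1 ∧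
      ψ' = extend (oracleOp β m fun x => cellState (Ψ κ (B.abelianElem x))) ψ := by
  have hp : 0 < p := by have := hS.two_le; omega
  refine Det.withWord (n := n) (len := m) (fun x => abelianWord p m x) hψ
    (vec := fun w => cellState (Ψ κ (B.elem w))) (hideK F.oracles κ (β + 1 + m + 7) β) ?_ ?_ ?_
  · intro b hb
    have h1 : (B.oracles f D Ψ τ).hidden κ (block (m + d) (β + 1 + m + 7)
        (xorWords (β + 1 + m + 7) m (abelianWord p m (coords β m b)) b)) =
          some (Ψ κ (B.elem (abelianWord p m (coords β m b)))) := by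
      rw [block_xorWords hb (h := abelianWord p m (coords β m b)) fun i hi => by
        rw [abelianWord, dif_neg (by omega)]]
      change (B.decode _).map _ = _
      rw [B.decode_eq fun i _ => abelianWord_lt hp _ i]
      rfl
    rw [hF]
    exact hideK_of_eq_some h1 (by omega) (xorWords_base hb _)
  · intro M' ψ' κ' ha hψ'
    exact Det.computeAbelian (hM.agree ha (by decide)) (by rw [ha _ (by decide), hβ])
      (by rw [ha _ (by decide), hk]) hψ'
  · intro M' ψ' ha
    refine Det.hide ⟨rfl, rfl, ?_⟩
    simp [ha .base (by decide), hβ, ha .k (by decide), hk]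

theorem Det.queryWord (hF : F.oracles = B.oracles f D Ψ τ) {M : Mem} {ψ : Ket} {κ β : ℕ}
    {v : ℕ → ℕ} (hM : Params p m d n M) (hβ : M .base 0 = β) (hk : M .k 0 = d + 1)
    (hv : ∀ i < m + d, v i < p) (hV : ∀ i < m + d, M .V i = v i)
    (hψ : Within (Prepared β (d + 1) n) ψ) :
    F.Det QRam.queryWord M ψ κ fun M' ψ' κ' => Mem.Agree [.i] M M' ∧ κ' = κ ∧
      ψ' = extend (oracleOp β (d + 1) fun x => Finsupp.single (f (B.quadraticElem v x)) 1) ψ := by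
  have hp : 0 < p := by have := hS.two_le; omega
  refine Det.withWord (n := n) (len := m + d) (fun x => quadraticWord p m d v x) hψ
    (vec := fun w => Finsupp.single (f (B.elem w)) 1)
    (queryK F.oracles (β + 1 + (d + 1) + 7) β) ?_ ?_ ?_
  · intro b hb
    have h1 : (B.oracles f D Ψ τ).label (block (m + d) (β + 1 + (d + 1) + 7)
        (xorWords (β + 1 + (d + 1) + 7) (m + d) (quadraticWord p m d v (coords β (d + 1) b)) b)) =
          some (f (B.elem (quadraticWord p m d v (coords β (d + 1) b)))) := by
      rw [block_xorWords hb (h := quadraticWord p m d v (coords β (d + 1) b)) fun i hi => by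
        rw [quadraticWord, if_neg (by omega), dif_neg (by omega)]]
      change (B.decode _).map _ = _
      rw [B.decode_eq fun i _ => quadraticWord_lt hp _ _ i]
      rfl
    rw [hF]
    exact queryK_of_eq_some h1 (by omega) (xorWords_base hb _)
  · intro M' ψ' κ' ha hψ'
    exact Det.computeQuadratic (hM.agree ha (by decide)) (by rw [ha _ (by decide), hβ])
      (by rw [ha _ (by decide), hk]) hv (fun i hi => by rw [ha _ (by decide), hV i hi]) hψ'
  · intro M' ψ' ha
    refine Det.query ⟨rfl, rfl, ?_⟩
    simp [ha .base (by decide), hβ, ha .k (by decide), hk]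

end Frame

/-! ## Selection of a nonzero word -/

/-- Copy the last nonzero word among those computed by `word` to `dst`. -/
def pick (word : Com) (len : Expr) (dst : Name) : Com :=
  .seq (forDown .j len (put dst (var .j) 0))
    (forDown .i (var .k) (.seq word (.seq (put .t 0 0)
      (.seq (forDown .j len (put .t 0 (var .t + ix .tmp (var .j))))
        (.ite (var .t) (forDown .j len (put dst (var .j) (ix .tmp (var .j)))) .skip)))))

/-- The words of the rows of `B` for the first oracle. -/
def rowWord : Com := forDown .j (var .m) (put .tmp (var .j) (ix .B (var .i * var .k + var .j)))

/-- The words of the rows of `B` for the second oracle. -/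
def rowQuadraticWord : Com :=
  .seq
    (forDown .j (var .m)
      (put .tmp (var .j) (ix .B (var .i * var .k) * ix .V (var .j) % var .p)))
    (forDown .j (var .d)
      (put .tmp (var .m + var .j) ((ix .B (var .i * var .k) * ix .B (var .i * var .k) *
        ix .V (var .m + var .j) + ix .B (var .i * var .k + (var .j + 1))) % var .p)))

/-- The vector `w` is the last nonzero one of the vectors `T i`, or all of them vanish. -/
def Picked (k len : ℕ) (T : ℕ → ℕ → ℕ) (w : ℕ → ℕ) : Prop :=
  (∃ i < k, ∃ l < len, T i l ≠ 0 ∧ ∀ l < len, w l = T i l) ∨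
    ((∀ i < k, ∀ l < len, T i l = 0) ∧ ∀ l < len, w l = 0)

namespace Frame

variable {F : Frame} {p m d n : ℕ} [F.Valid] [hS : Sizes F p m d n]

include hS in
-- A word is tested by the sum of its letters, which are natural numbers below `p`: the sum vanishes
-- only if all of them do, and it is too small to overflow a register.
theorem Cl.pick {M : Mem} {word : Com} {len : Expr} {dst : Name} {k L : ℕ} {T : ℕ → ℕ → ℕ}
    (hdst : dst ∉ [Name.i, .j, .t, .tmp, .k]) (hL : L ≤ m + d) (hk : M .k 0 = k)
    (hb : k ≤ F.bound)
    (hlen : ∀ M', Mem.Agree [.i, .j, .t, .tmp, dst] M M' → len.val (F.enc M') = L)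
    (hT : ∀ i < k, ∀ l < L, T i l < p)
    (hword : ∀ i < k, ∀ M', Mem.Agree [.i, .j, .t, .tmp, dst] M M' → M' .i 0 = i →
      F.Cl word M' fun M'' => Mem.Agree [.j, .tmp] M' M'' ∧ ∀ l < L, M'' .tmp l = T i l) :
    F.Cl (QRam.pick word len dst) M fun M' => Mem.Agree [.i, .j, .t, .tmp, dst] M M' ∧
      Picked k L T (M' dst) := by
  have h1 := Sizes.mul_lt F p m d n
  have h1' := Sizes.p_lt F p m d n
  have h2 := hS.two_le
  have hLb : L ≤ F.bound := by have := hS.loops; omega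
  simp only [List.mem_cons, List.not_mem_nil, or_false, not_or] at hdst
  obtain ⟨hi, hj, ht, htmp, hk'⟩ := hdst
  refine (Cl.fill (N := L) (f := id) (w := fun _ => 0) hj (hlen M (Mem.Agree.refl _ _)) hLb
    (fun _ _ _ _ h => h) (by simp) fun i _ M' _ hi' _ => ⟨by simp [hi'], by simp⟩).seq ?_
  rintro M₁ ⟨ha₁, hz₁, -⟩
  have ha₁' : Mem.Agree [.i, .j, .t, .tmp, dst] M M₁ := ha₁.weaken (by simp)
  refine (Cl.forDown (n := k) (fun i M' => Mem.Agree [.i, .j, .t, .tmp, dst] M M' ∧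
    ((∃ t, i ≤ t ∧ t < k ∧ ∃ l < L, T t l ≠ 0 ∧ ∀ l < L, M' dst l = T t l) ∨
    ((∀ t, i ≤ t → t < k → ∀ l < L, T t l = 0) ∧ ∀ l < L, M' dst l = 0)))
    (by simp [ha₁ .k (by simp [Ne.symm hk']), hk]) hb ⟨ha₁'.set (by simp) _ _, Or.inr ⟨by omega, ?_⟩⟩
    ?_).mono ?_
  · intro l hl
    rw [Mem.set_ne _ _ _ hi]; exact hz₁ l hl
  · rintro i hik M' - ⟨ha, h3⟩
    have ha' : Mem.Agree [.i, .j, .t, .tmp, dst] M (M'.set .i 0 i) := ha.set (by simp) _ _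
    have hdst' : (M'.set .i 0 i) dst = M' dst := Mem.set_ne _ _ _ hi
    refine (hword i hik _ ha' (by simp)).seq ?_
    rintro M₂ ⟨ha₂, htmp₂⟩
    have ha₂' := ha'.trans ha₂ (by simp)
    have hdst₂ : M₂ dst = M' dst := by rw [ha₂ _ (by simp [hj, htmp]), hdst']
    have hi₂ : M₂ .i 0 = i := by rw [ha₂ _ (by decide)]; simp
    refine Cl.put_seq (by simp) ?_
    simp only [Expr.val_ofNat]
    set M₃ := M₂.set .t 0 0 with hM₃
    have ha₃ : Mem.Agree [.t] M₂ M₃ := (Mem.Agree.refl _ _).set (by simp) _ _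
    have ha₃' := ha₂'.trans ha₃ (by simp)
    have hsum (s : ℕ) : ∑ l ∈ Finset.Ico s L, T i l < 2 ^ n := by
      have h4 : ∑ l ∈ Finset.Ico s L, T i l ≤ ∑ l ∈ Finset.Ico s L, p :=
        Finset.sum_le_sum fun l hl => (hT i hik l (Finset.mem_Ico.1 hl).2).le
      have h5 : (L - s) * p ≤ (m + d + 6) * p := Nat.mul_le_mul_right _ (by omega)
      simp only [Finset.sum_const, Nat.card_Ico, smul_eq_mul] at h4
      omega
    refine (Cl.accumulate (N := L) (c := 0) (f := fun s => ∑ l ∈ Finset.Ico s L, T i l) (by decide)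
      (hlen _ ha₃') hLb (by simp [hM₃]) (fun s _ => Sizes.lt_of_le' F p m d n (hsum s).le) ?_).seq ?_
    · intro s hs M'' ha'' hj'' ht''
      refine ⟨by simp, ?_⟩
      have : M'' .tmp = M₂ .tmp := by rw [ha'' _ (by decide), ha₃ _ (by decide)]
      simp only [Expr.val_add, val_var, val_ix, hj'', ht'', this, htmp₂ s hs]
      rw [add_comm, ← Finset.sum_eq_sum_Ico_succ_bot hs]
    rintro M₄ ⟨ha₄, ht₄, -⟩
    have ha₄' := ha₃'.trans ha₄ (by simp)
    have hi₄ : M₄ .i 0 = i := by rw [ha₄ _ (by decide), ha₃ _ (by decide), hi₂]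
    have hdst₄ : M₄ dst = M' dst := by
      rw [ha₄ _ (by simp [hj, ht]), ha₃ _ (by simp [ht]), hdst₂]
    have htmp₄ : ∀ l < L, M₄ .tmp l = T i l := fun l hl => by
      rw [ha₄ _ (by decide), ha₃ _ (by decide), htmp₂ l hl]
    have hzero : M₄ .t 0 = 0 ↔ ∀ l < L, T i l = 0 := by
      rw [ht₄, Finset.sum_eq_zero_iff]
      simp
    refine Cl.ite (fun h4 => ?_) fun h4 => Cl.skip ?_
    · rw [val_var] at h4
      refine (Cl.fill (N := L) (f := id) (w := T i) hj (hlen _ ha₄') hLb (fun _ _ _ _ h => h)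
        (fun l hl => Sizes.lt_of_le' F p m d n ((hT i hik l hl).le.trans (by omega))) ?_).mono ?_
      · intro l hl M'' ha'' hj'' _
        refine ⟨by simp [hj''], ?_⟩
        rw [val_ix, val_var, hj'', ha'' _ (by simp [Ne.symm htmp]), htmp₄ l hl]
      · rintro M'' ⟨ha'', h5, -⟩
        refine ⟨by rw [ha'' _ (by simp [Ne.symm hi]), hi₄], ha₄'.trans ha'' (by simp), Or.inl ?_⟩
        rw [Ne, hzero] at h4
        push Not at h4
        obtain ⟨l, hl, hne⟩ := h4
        exact ⟨i, le_rfl, hik, l, hl, hne, h5⟩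
    · rw [val_var] at h4
      refine ⟨hi₄, ha₄', ?_⟩
      rw [hdst₄]
      rcases h3 with ⟨t, h5, h6⟩ | ⟨h5, h6⟩
      · exact Or.inl ⟨t, by omega, h6⟩
      · refine Or.inr ⟨fun t ht htk => ?_, h6⟩
        by_cases hti : t = i
        · rw [hti]; exact hzero.1 h4
        · exact h5 t (by omega) htk
  · rintro M' ⟨-, h3, h4⟩
    refine ⟨h3, ?_⟩
    rcases h4 with ⟨t, -, htk, h5⟩ | ⟨h5, h6⟩
    · exact Or.inl ⟨t, htk, h5⟩
    · exact Or.inr ⟨fun i hi => h5 i (by omega) hi, h6⟩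

include hS in
theorem Cl.rowWord {M : Mem} {i : ℕ} (hm : M .m 0 = m) (hk : M .k 0 = m) (hi : M .i 0 = i)
    (hB : ∀ j < m, M .B (i * m + j) < p) :
    F.Cl QRam.rowWord M fun M' => Mem.Agree [.j, .tmp] M M' ∧
      ∀ l < m, M' .tmp l = M .B (i * m + l) := by
  have h1 := Sizes.p_lt F p m d n
  have hLb : m ≤ F.bound := by have := hS.loops; omega
  refine (Cl.fill (N := m) (f := id) (w := fun l => M .B (i * m + l)) (by decide) (by simp [hm]) hLb
    (fun _ _ _ _ h => h)
    (fun l hl => Sizes.lt_of_le' F p m d n ((hB l hl).le.trans (by omega))) ?_).mono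
    fun M' h => ⟨h.1, h.2.1⟩
  intro l hl M' ha hj _
  simp [hj, ha .B (by decide), ha .i (by decide), ha .k (by decide), hi, hk]

theorem Cl.rowQuadraticWord {M : Mem} {i : ℕ} {v : ℕ → ℕ} (hM : Params p m d n M)
    (hk : M .k 0 = d + 1) (hi : M .i 0 = i) (hV : ∀ i < m + d, M .V i = v i) :
    F.Cl QRam.rowQuadraticWord M fun M' => Mem.Agree [.j, .tmp] M M' ∧ ∀ l < m + d, M' .tmp l =
      quadraticWord p m d v (fun j => M .B (i * (d + 1) + j)) l := by
  have h1 := Sizes.p_lt F p m d n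
  have h2 := hS.two_le
  have hLb := hS.loops
  have hlt (l : ℕ) : quadraticWord p m d v (fun j => M .B (i * (d + 1) + j)) l < 2 ^ F.bound :=
    Sizes.lt_of_le' F p m d n ((quadraticWord_lt (by omega) _ _ _).le.trans (by omega))
  refine (Cl.fill (N := m) (f := id) (w := quadraticWord p m d v fun j => M .B (i * (d + 1) + j))
    (by decide) (by simp [hM.hm]) (by omega) (fun _ _ _ _ h => h) (fun l _ => hlt l) ?_).seq ?_
  · intro l hl M' ha hj _
    refine ⟨by simp [hj], ?_⟩
    simp [hj, ha .B (by decide), ha .i (by decide), ha .k (by decide), ha .V (by decide),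
      ha .p (by decide), hM.hp, hi, hk, hV l (by omega), quadraticWord, hl]
  rintro M₁ ⟨ha₁, h3, -⟩
  refine (Cl.fill (N := d) (f := fun l => m + l)
    (w := fun l => quadraticWord p m d v (fun j => M .B (i * (d + 1) + j)) (m + l))
    (by decide) (by simp [ha₁ .d (by decide), hM.hd]) (by omega)
    (fun _ _ _ _ h => by simpa using h) (fun l _ => hlt _) ?_).mono ?_
  · intro l hl M' ha hj _
    refine ⟨by simp [hj, ha .m (by decide), ha₁ .m (by decide), hM.hm], ?_⟩
    simp [hj, ha .B (by decide), ha .i (by decide), ha .k (by decide), ha .V (by decide),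
      ha .p (by decide), ha .m (by decide), ha₁ .B (by decide), ha₁ .i (by decide),
      ha₁ .k (by decide), ha₁ .V (by decide), ha₁ .p (by decide), ha₁ .m (by decide),
      hM.hp, hM.hm, hi, hk, hV (m + l) (by omega), quadraticWord, hl]
  · rintro M₂ ⟨ha₂, h4, h5⟩
    refine ⟨ha₁.trans ha₂ (by simp), fun l hl => ?_⟩
    by_cases hlm : l < m
    · rw [h5 l (fun i _ => by omega)]
      exact h3 l hlm
    · have := h4 (l - m) (by omega)
      simpa [Nat.add_sub_cancel' (show m ≤ l by omega)] using this

end Frame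

/-! ## The quadratic part of the words -/

/-- The entry of the table of commutators in the input. -/
def tableEntry : Expr :=
  .reg (3 + ((var .j * var .m + var .i) * var .d + var .l))

/-- Append the halves of `squareForm` to the vector `V`. -/
def squares : Com :=
  forDown .l (var .d) (.seq (put .t 0 0) (.seq
    (forDown .j (var .m) (forDown .i (var .j)
      (put .t 0 ((var .t + ix .V (var .j) * ix .V (var .i) * tableEntry) % var .p))))
    (put .V (var .m + var .l) ((var .t * ((var .p + 1) / 2)) % var .p))))

theorem input_table {G : Type*} [Group G] {p m d : ℕ} (B : Presentation G p m d) {i j l : ℕ}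
    (hi : i < m) (hj : j < m) (hl : l < d) :
    B.input (3 + ((j * m + i) * d + l)) = B.table j i l ∧ (j * m + i) * d + l < m * m * d := by
  have h1 : j * m + i < m * m := by nlinarith
  have h2 : (j * m + i) * d + l < m * m * d := by nlinarith
  refine ⟨?_, h2⟩
  have h3 : (⟨(j * m + i) * d + l, h2⟩ : Fin (m * m * d)) =
      finProdFinEquiv (finProdFinEquiv (⟨j, hj⟩, ⟨i, hi⟩), ⟨l, hl⟩) := by
    ext; simp [finProdFinEquiv]; ring
  rw [add_comm 3, Presentation.input, dif_pos h2, h3, Equiv.symm_apply_apply,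
    Presentation.table, dif_pos ⟨hj, hi, hl⟩]
  dsimp only
  rw [Equiv.symm_apply_apply]

namespace Frame

variable {F : Frame} {p m d n : ℕ} [F.Valid] [hS : Sizes F p m d n]
  {G : Type*} [Group G] {B : Presentation G p m d}

theorem Cl.squares (htbl : F.tbl = B.input) (horg : 3 + m * m * d ≤ F.org) {M : Mem}
    {v : ℕ → ℕ} (hM : Params p m d n M) (hV : ∀ i < m, M .V i = v i) (hp : d ≠ 0 → p % 2 = 1) :
    F.Cl QRam.squares M fun M' => Mem.Agree [.i, .j, .l, .t, .V] M M' ∧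
      (∀ i < m, M' .V i = v i) ∧ ∀ l < d, M' .V (m + l) < p ∧
        2 * M' .V (m + l) ≡ B.squareForm v l [MOD p] := by
  have h1 := Sizes.p_lt F p m d n
  have h2 := hS.two_le
  have hLb := hS.loops
  have hlt (x : ℕ) : x % p < 2 ^ F.bound :=
    Sizes.lt_of_le' F p m d n ((Nat.mod_lt x (by omega)).le.trans (by omega))
  have hV' : ∀ {M' : Mem}, Mem.Agree [.i, .j, .l, .t] M M' → ∀ i < m, M' .V i = v i :=
    fun ha i hi => by rw [ha _ (by decide), hV i hi]
  refine (Cl.forDown (n := d) (fun l M' => Mem.Agree [.i, .j, .l, .t, .V] M M' ∧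
    (∀ i < m, M' .V i = v i) ∧ ∀ t, l ≤ t → t < d → M' .V (m + t) < p ∧
      2 * M' .V (m + t) ≡ B.squareForm v t [MOD p]) (by simp [hM.hd]) (by omega)
    ⟨(Mem.Agree.refl _ _).set (by simp) _ _, fun i hi => by simp [hV i hi], by omega⟩ ?_).mono ?_
  · rintro l hl M' - ⟨ha, h3, h4⟩
    refine Cl.put_seq (by simp) ?_
    simp only [Expr.val_ofNat]
    set M₁ := (M'.set .l 0 l).set .t 0 0 with hM₁
    have ha₁ : Mem.Agree [.i, .j, .l, .t, .V] M M₁ := (ha.set (by simp) _ _).set (by simp) _ _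
    have hV₁ : M₁ .V = M' .V := by simp [hM₁]
    have hl₁ : M₁ .l 0 = l := by simp [hM₁]
    set g : ℕ → ℕ → ℕ := fun j i => v j * v i * B.table j i l with hg
    refine (Cl.forDown (n := m) (fun j M' => Mem.Agree [.i, .j, .t] M₁ M' ∧
      M' .t 0 = (∑ j' ∈ Finset.Ico j m, ∑ i' ∈ Finset.range j', g j' i') % p)
      (by simp [ha₁ .m (by decide), hM.hm]) (by omega)
      ⟨(Mem.Agree.refl _ _).set (by simp) _ _, by simp [hM₁]⟩ ?_).seq ?_
    · rintro j hj M₂ - ⟨ha₂, ht₂⟩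
      set S := ∑ j' ∈ Finset.Ico (j + 1) m, ∑ i' ∈ Finset.range j', g j' i' with hSdef
      have ha₂' : Mem.Agree [.i, .j, .t] M₁ (M₂.set .j 0 j) := ha₂.set (by simp) _ _
      refine (Cl.accumulate (N := j) (c := 0)
        (f := fun s => (S + ∑ i' ∈ Finset.Ico s j, g j i') % p) (by decide) (by simp) (by omega)
        (by simp [ht₂]) (fun s _ => hlt _) ?_).mono ?_
      · intro s hs M₃ ha₃ hi₃ ht₃
        have ha₃' : Mem.Agree [.i, .j, .t] M₁ M₃ := ha₂'.trans ha₃ (by simp)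
        have hj₃ : M₃ .j 0 = j := by rw [ha₃ _ (by decide)]; simp
        obtain ⟨h5, h6⟩ := input_table B (hs.trans hj) hj hl
        have h7 : tableEntry.val (F.enc M₃) = B.table j s l := by
          simp only [tableEntry, Expr.val_reg, Expr.val_add, Expr.val_mul, val_var, Expr.val_ofNat,
            hj₃, hi₃, ha₃' .m (by decide), ha₃' .d (by decide), ha₃' .l (by decide),
            ha₁ .m (by decide), ha₁ .d (by decide), hM.hm, hM.hd, hl₁]
          rw [enc_tbl _ (by omega) (by omega), htbl, h5]
        refine ⟨by simp, ?_⟩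
        simp only [Expr.val_mod, Expr.val_add, Expr.val_mul, val_var, val_ix, hj₃, hi₃, ht₃, h7,
          ha₃' .V (by decide), ha₃' .p (by decide), ha₁ .p (by decide), hM.hp, hV₁,
          h3 j hj, h3 s (by omega)]
        rw [Nat.mod_add_mod, Finset.sum_eq_sum_Ico_succ_bot hs]
        congr 1
        simp only [hg]
        ring
      · rintro M₃ ⟨ha₃, h5, -⟩
        refine ⟨by rw [ha₃ _ (by decide)]; simp, ha₂'.trans ha₃ (by simp), ?_⟩
        rw [h5, Finset.sum_eq_sum_Ico_succ_bot hj, add_comm, ← Finset.range_eq_Ico]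
    rintro M₂ ⟨-, ha₂, ht₂⟩
    have hval : ((var .t * ((var .p + 1) / 2)) % var .p).val (F.enc M₂) =
        M₂ .t 0 * ((p + 1) / 2) % p := by
      simp [ha₂ .p (by decide), ha₁ .p (by decide), hM.hp]
    have hadr : (var .m + var .l).val (F.enc M₂) = m + l := by
      simp [ha₂ .m (by decide), ha₁ .m (by decide), hM.hm, ha₂ .l (by decide), hl₁]
    have hV₂ : M₂ .V = M' .V := by rw [ha₂ _ (by decide), hV₁]
    refine Cl.put (by rw [hval]; exact hlt _) ?_
    rw [hval, hadr]
    refine ⟨by simp [ha₂ .l (by decide), hl₁], (ha₁.trans ha₂ (by simp)).set (by simp) _ _, ?_, ?_⟩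
    · intro i hi
      rw [Mem.set_same, Function.update_of_ne (by omega), hV₂, h3 i hi]
    · intro t ht htd
      rw [Mem.set_same]
      by_cases htl : t = l
      · subst htl
        rw [Function.update_self]
        refine ⟨Nat.mod_lt _ (by omega), ?_⟩
        have h5 : M₂ .t 0 = B.squareForm v t % p := by
          rw [ht₂, Presentation.squareForm, Finset.range_eq_Ico]
        -- For odd `p` the number `(p + 1) / 2` is the inverse of 2; there is an index `t < d`, so
        -- `p` is odd.
        have h6 : (p + 1) / 2 * 2 = 1 * p + 1 := by
          have := hp (by omega)
          omega
        calc 2 * (M₂ .t 0 * ((p + 1) / 2) % p)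
            ≡ 2 * (M₂ .t 0 * ((p + 1) / 2)) [MOD p] := (Nat.mod_modEq _ _).mul_left _
          _ = M₂ .t 0 * (1 * p + 1) := by rw [← h6]; ring
          _ = M₂ .t 0 + p * M₂ .t 0 := by ring
          _ ≡ M₂ .t 0 [MOD p] := by simp [Nat.ModEq]
          _ ≡ B.squareForm v t [MOD p] := by rw [h5]; exact Nat.mod_modEq _ _
      · rw [Function.update_of_ne (by omega), hV₂]
        exact h4 t (by omega) htd
  · rintro M' ⟨-, h3, h4, h5⟩
    exact ⟨h3, h4, fun l hl => h5 l (by omega) hl⟩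

end Frame
end QRam

namespace Presentation

variable {G : Type*} [Group G] {p m d : ℕ} (B : Presentation G p m d)

theorem squareForm_congr {v v' : ℕ → ℕ} (h : ∀ i < m, v' i = v i) (l : ℕ) :
    B.squareForm v' l = B.squareForm v l := by
  refine Finset.sum_congr rfl fun j hj => Finset.sum_congr rfl fun i hi => ?_
  rw [Finset.mem_range] at hi hj
  rw [h j hj, h i (hi.trans hj)]

end Presentation

namespace QRam

/-! ## The search for a generator -/

/-- The required size of the groups in which the samples are taken. -/
def requiredSize (p m d : ℕ) : ℕ := 100 * (m + d + 6) ^ 2 * p ^ 2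

/-- Choose the size of the groups in which the samples are taken. -/
def setSize : Com :=
  .seq (put .n 0 0) (.seq (put .N 0 1)
    (.loop (100 * ((var .m + var .d + 6) * (var .m + var .d + 6)) * (var .p * var .p) - var .N)
      (.seq (put .n 0 (var .n + 1)) (put .N 0 (2 * var .N)))))

/-- Compute the word of a generator. -/
def search : Com :=
  .seq setSize (.seq (put .k 0 (var .m)) (.seq (findSpace hideWord)
    (.seq (pick rowWord (var .m) .V) (.seq squares (.seq (put .k 0 (var .d + 1))
      (.seq (findSpace queryWord) (pick rowQuadraticWord (var .m + var .d) .out)))))))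

namespace Frame

variable {F : Frame} {p m d n : ℕ} [F.Valid]

/-- The loop condition is a truncated difference, which vanishes as soon as the power of two reaches
`requiredSize`. By definition of `Nat.clog` this happens after exactly `n` doublings. -/
theorem Cl.setSize (hn : n = Nat.clog 2 (requiredSize p m d)) (hb : n < F.bound) {M : Mem}
    (hp : M .p 0 = p) (hm : M .m 0 = m) (hd : M .d 0 = d) :
    F.Cl QRam.setSize M fun M' => Mem.Agree [.n, .N] M M' ∧ Params p m d n M' := by
  have hlt : n < 2 ^ F.bound := hb.trans Nat.lt_two_pow_self
  have hlt' : 2 ^ n < 2 ^ F.bound := Nat.pow_lt_pow_right (by omega) hb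
  have h1 : 1 < 2 ^ F.bound := Nat.one_lt_two_pow (by omega)
  refine Cl.put_seq (by simp) (Cl.put_seq (by simpa using h1) fun ψ k v => ?_)
  refine (Tr.loop (n := n) (fun i M' ψ' k' => (Mem.Agree [.n, .N] M M' ∧ M' .n 0 = n - i ∧
    M' .N 0 = 2 ^ (n - i) ∧ i ≤ n) ∧ ψ' = ψ ∧ k' = k) (fun _ _ _ _ => v) ?_ ?_ hb.le ?_).mono ?_ le_rfl
  · rintro i M' - - ⟨⟨ha, h2, h3, h4⟩, -, -⟩
    have h5 := Nat.clog_le_iff_le_pow (b := 2) (by omega) (x := requiredSize p m d) (y := n - i)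
    rw [← hn] at h5
    simp only [Expr.val_sub, Expr.val_mul, Expr.val_add, val_var, Expr.val_ofNat,
      ha .m (by decide), ha .d (by decide), ha .p (by decide), hp, hm, hd, h3]
    rw [← sq, ← sq, Nat.sub_eq_zero_iff_le]
    change requiredSize p m d ≤ _ ↔ _
    rw [← h5]
    omega
  · rintro i M' ψ' k' ⟨⟨ha, h2, h3, h4⟩, rfl, rfl⟩
    have h5 : n - i = n - (i + 1) + 1 := by omega
    have h6 : 2 * 2 ^ (n - (i + 1)) = 2 ^ (n - i) := by rw [h5, pow_succ]; ring
    have h7 : 2 ^ (n - i) ≤ 2 ^ n := Nat.pow_le_pow_right (by omega) (by omega)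
    refine Cl.put_seq (by simp [h2]; omega) (Cl.put ?_ ⟨?_, ?_, ?_, by omega⟩) _ _ _
    · simp [h3, h6]; omega
    · exact (ha.set (by simp) _ _).set (by simp) _ _
    · simp [h2]; omega
    · simp [h3, h6]
  · exact ⟨⟨((Mem.Agree.refl _ _).set (by simp) _ _).set (by simp) _ _, by simp, by simp, le_rfl⟩,
      rfl, rfl⟩
  · rintro M' ψ' k' ⟨⟨ha, h2, h3, -⟩, h4⟩
    refine ⟨⟨⟨ha, ?_⟩, h4⟩, le_rfl⟩
    constructor
    · rw [ha _ (by decide), hp]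
    · rw [ha _ (by decide), hm]
    · rw [ha _ (by decide), hd]
    · exact h2
    · exact h3

variable [hS : Sizes F p m d n] {G : Type*} [Group G] {B : Presentation G p m d} {f : G → ℕ}
  {D : ℕ → ℕ} {Ψ : (i : ℕ) → G → EuclideanSpace ℂ (Fin (D i))} {τ : ℕ} {H : Subgroup G}

/-- A nonzero row lies in the preimage of `HG'`; if all rows vanish, their span, which is this
preimage, is zero. These are the two cases of `le_zpowers_sup`. -/
theorem le_zpowers_of_picked [hp : Fact p.Prime] (hexp : ∀ g : G, g ^ p = 1)
    (hcen : commutator G ≤ Subgroup.center G) (hH : Nat.card H = 1 ∨ Nat.card H = p) {M : Mem}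
    (hM : Reduced p m M)
    (hspan : rowSpace p m M = hiddenSpace (H ⊔ commutator G) B.abelianElem
      (B.homMod_abelianElem hexp le_sup_right)) {v : ℕ → ℕ}
    (hv : Picked m m (fun i l => M .B (i * m + l)) v) :
    H ≤ Subgroup.zpowers (powProd B.gen v m) ⊔ commutator G := by
  have hom := B.homMod_abelianElem hexp (S := H ⊔ commutator G) le_sup_right
  have e : powProd B.gen v m = B.abelianElem (fun i => v i) := by
    rw [B.abelianElem_eq hexp]
    exact powProd_congr fun i hi => by simp [hi]
  rw [e]
  refine B.le_zpowers_sup hexp hcen hH ?_ ?_ ?_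
  · intro l
    rcases hv with ⟨i, hi, -, -, -, h⟩ | ⟨-, h⟩
    · rw [h l l.isLt]; exact hM i hi l l.isLt
    · rw [h l l.isLt]; exact hp.out.pos
  · rw [← mem_hiddenSpace hom, ← hspan]
    rcases hv with ⟨i, hi, -, -, -, h⟩ | ⟨-, h⟩
    · refine Submodule.subset_span ⟨⟨i, hi⟩, ?_⟩
      funext l
      simp [rows, reduce, h l l.isLt]
    · convert Submodule.zero_mem _
      funext l
      simp [reduce, h l l.isLt]
  · intro h0 x hx l
    rw [← mem_hiddenSpace hom, ← hspan] at hx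
    rcases hv with ⟨i, hi, l', hl', hne, h⟩ | ⟨h, -⟩
    · exact absurd ((h l' hl').symm.trans (h0 ⟨l', hl'⟩)) hne
    · have : rowSpace p m M = ⊥ := by
        rw [rowSpace, Submodule.span_eq_bot]
        rintro _ ⟨i, rfl⟩
        funext l
        simp [rows, h i i.isLt l l.isLt]
      rw [this, Submodule.mem_bot] at hx
      have := congrFun hx l
      simpa [reduce, ZMod.natCast_eq_zero_iff, Nat.modEq_zero_iff_dvd] using this

open Classical in
theorem Tr.search [hp : Fact p.Prime] (hF : F.oracles = B.oracles f D Ψ τ)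
    (htbl : F.tbl = B.input) (horg : 3 + m * m * d ≤ F.org)
    (hn : n = Nat.clog 2 (requiredSize p m d)) (hexp : ∀ g : G, g ^ p = 1)
    (hcen : commutator G ≤ Subgroup.center G) (hH : Nat.card H = 1 ∨ Nat.card H = p)
    (hf : Hides f H) (hΨ : ∀ i, IsHidingSet (H ⊔ commutator G) (Ψ i)) {M : Mem} {ψ : Ket} {κ : ℕ}
    (hMp : M .p 0 = p) (hMm : M .m 0 = m) (hMd : M .d 0 = d) (hM : M .base 0 = 0)
    (hψ : Within (Fresh 0) ψ) :
    F.Tr QRam.search M ψ κ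
      (fun M' _ _ => M' .m 0 = m ∧ M' .d 0 = d)
      (fun M' ψ' _ => if B.OutputsGenerator H (M' .out) then weight ψ' else 0)
      (weight ψ * (81 / 100)) := by
  have h1 := Sizes.p_lt F p m d n
  have h2 := hS.two_le
  have h3 := hS.loops
  have hlen : 200 * (m + d + 6) < 2 ^ F.bound :=
    Sizes.lt_of_le' F p m d n (Sizes.len_lt F p m d n).le
  refine Tr.seq (Cl.setSize hn (by have := hS.width; omega) hMp hMm hMd _ _ _) ?_
  rintro M₁ _ κ₁ ⟨⟨ha₁, hM₁⟩, rfl, rfl⟩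
  refine Tr.put_seq (by simp [hM₁.hm]; omega) ?_
  simp only [val_var, hM₁.hm, Expr.val_ofNat]
  have ha₂ : Mem.Agree [.k] M₁ (M₁.set .k 0 m) := (Mem.Agree.refl _ _).set (by simp) _ _
  set M₂ := M₁.set .k 0 m with hM₂def
  have hM₂ : Params p m d n M₂ := hM₁.agree ha₂ (by decide)
  have hk₂ : M₂ .k 0 = m := by simp [hM₂def]
  have hbase₂ : M₂ .base 0 = 0 := by rw [ha₂ _ (by decide), ha₁ _ (by decide), hM]
  -- The value `9/10` of `a` is the success probability that the second search will contribute.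
  refine Tr.seq ((Tr.findSpace hM₂ hk₂ (by omega) hbase₂ (by omega) hψ
    (K := hiddenSpace (H ⊔ commutator G) B.abelianElem (B.homMod_abelianElem hexp le_sup_right))
    (a := 9 / 10) ?_ (by norm_num)).mono (fun _ _ _ h => ⟨h, le_rfl⟩) (by linarith)) ?_
  · intro κ
    refine ⟨fun x => cellState (Ψ κ (B.abelianElem x)), κ + 1,
      hidesSpace_of_isHidingSet _ (hΨ κ), fun M' ψ' β' ha hβ' hψ' => ?_⟩
    exact Det.hideWord hF (hM₂.agree ha (by decide)) hβ' (by rw [ha _ (by decide), hk₂]) hψ'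
  rintro M₃ ψ₃ κ₃ ⟨ha₃, hred₃, hbase₃, hψ₃⟩
  have hM₃ : Params p m d n M₃ := hM₂.agree ha₃ (by decide)
  have hk₃ : M₃ .k 0 = m := by rw [ha₃ _ (by decide), hk₂]
  refine Tr.seq (Cl.pick (p := p) (m := m) (d := d) (n := n) (k := m) (L := m)
    (T := fun i l => M₃ .B (i * m + l)) (by decide) (by omega) hk₃ (by omega) ?_ ?_ ?_ _ _ _) ?_
  · intro M' ha
    simp [ha .m (by decide), hM₃.hm]
  · exact fun i hi l hl => hred₃ i hi l hl
  · intro i hi M' ha hi'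
    have hB : M' .B = M₃ .B := ha _ (by decide)
    refine (Cl.rowWord (p := p) (m := m) (d := d) (n := n) (i := i)
      (by rw [ha _ (by decide), hM₃.hm]) (by rw [ha _ (by decide), hk₃]) hi' fun j hj => ?_).mono ?_
    · rw [hB]; exact hred₃ i hi j hj
    · rw [hB]; exact fun _ h => h
  rintro M₄ _ κ₄ ⟨⟨ha₄, hV₄⟩, rfl, rfl⟩
  have hM₄ : Params p m d n M₄ := hM₃.agree ha₄ (by decide)
  refine Tr.seq (Cl.squares (B := B) htbl horg hM₄ (fun i _ => rfl) (fun hd => ?_) _ _ _) ?_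
  · have := mt (B.d_eq_zero hexp) hd
    exact (hp.out.eq_two_or_odd).resolve_left this
  rintro M₅ _ κ₅ ⟨⟨ha₅, hV₅, hW₅⟩, rfl, rfl⟩
  have hM₅ : Params p m d n M₅ := hM₄.agree ha₅ (by decide)
  set v := M₅ .V with hv
  have hVp : Picked m m (fun i l => M₃ .B (i * m + l)) v := by
    rcases hV₄ with ⟨i, hi, l, hl, hne, h⟩ | ⟨h, h'⟩
    · exact Or.inl ⟨i, hi, l, hl, hne, fun l hl => by rw [hV₅ l hl, h l hl]⟩
    · exact Or.inr ⟨h, fun l hl => by rw [hV₅ l hl, h' l hl]⟩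
  have hvlt : ∀ i < m + d, v i < p := by
    intro i hi
    by_cases him : i < m
    · rcases hVp with ⟨t, ht, -, -, -, h⟩ | ⟨-, h⟩
      · rw [h i him]; exact hred₃ t ht i him
      · rw [h i him]; exact hp.out.pos
    · have := (hW₅ (i - m) (by omega)).1
      rwa [Nat.add_sub_cancel' (by omega)] at this
  have hsq : ∀ l < d, 2 * v (m + l) ≡ B.squareForm v l [MOD p] := by
    intro l hl
    rw [B.squareForm_congr hV₅]
    exact (hW₅ l hl).2
  refine Tr.put_seq (by simp [hM₅.hd]; omega) ?_
  simp only [val_var, hM₅.hd, Expr.val_ofNat, Expr.val_add]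
  have ha₆ : Mem.Agree [.k] M₅ (M₅.set .k 0 (d + 1)) := (Mem.Agree.refl _ _).set (by simp) _ _
  set M₆ := M₅.set .k 0 (d + 1) with hM₆def
  have hM₆ : Params p m d n M₆ := hM₅.agree ha₆ (by decide)
  have hk₆ : M₆ .k 0 = d + 1 := by simp [hM₆def]
  have hV₆ : M₆ .V = v := ha₆ _ (by decide)
  have hbase₆ : M₆ .base 0 = m + 5 := by
    rw [ha₆ _ (by decide), ha₅ _ (by decide), ha₄ _ (by decide), hbase₃, zero_add]
  rw [zero_add] at hψ₃
  have hom := B.homMod_quadraticElem hexp hcen hsq H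
  -- For the second search `a` is the indicator of success of the first. After a failure the search
  -- still runs on a harmless vector `v`, but nothing is claimed about its result.
  set a : ℝ := if rowSpace p m M₃ = hiddenSpace (H ⊔ commutator G) B.abelianElem
    (B.homMod_abelianElem hexp le_sup_right) then 1 else 0 with hadef
  have ha0 : 0 ≤ a := by rw [hadef]; split_ifs <;> norm_num
  refine Tr.seq ((Tr.findSpace hM₆ hk₆ (by omega) hbase₆ (by omega) hψ₃
    (K := hiddenSpace H (B.quadraticElem v) hom) (a := a) ?_ ha0).mono
      (fun _ _ _ h => ⟨h, le_rfl⟩) ?_) ?_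
  · intro κ
    refine ⟨fun x => Finsupp.single (f (B.quadraticElem v x)) 1, κ,
      hidesSpace_of_hides _ hf, fun M' ψ' β' ha hβ' hψ' => ?_⟩
    exact Det.queryWord hF (hM₆.agree ha (by decide)) hβ' (by rw [ha _ (by decide), hk₆]) hvlt
      (fun i _ => by rw [ha _ (by decide), hV₆]) hψ'
  · rw [hadef]
    split_ifs <;> linarith
  rintro M₇ ψ₇ κ₇ ⟨ha₇, hred₇, -, -⟩
  have hM₇ : Params p m d n M₇ := hM₆.agree ha₇ (by decide)
  have hk₇ : M₇ .k 0 = d + 1 := by rw [ha₇ _ (by decide), hk₆]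
  have hV₇ : M₇ .V = v := by rw [ha₇ _ (by decide), hV₆]
  have hqlt (x : Fin (d + 1) → ℕ) (l : ℕ) : quadraticWord p m d v x l < p :=
    quadraticWord_lt hp.out.pos _ _ _
  refine (Cl.pick (p := p) (m := m) (d := d) (n := n) (k := d + 1) (L := m + d)
    (T := fun i l => quadraticWord p m d v (fun j => M₇ .B (i * (d + 1) + j)) l)
    (by decide) le_rfl hk₇ (by omega) ?_ ?_ ?_ _ _ _).mono ?_ le_rfl
  · intro M' ha
    simp [ha .m (by decide), hM₇.hm, ha .d (by decide), hM₇.hd]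
  · exact fun i _ l _ => hqlt _ _
  · intro i hi M' ha hi'
    have hB : M' .B = M₇ .B := ha _ (by decide)
    refine (Cl.rowQuadraticWord (v := v) (i := i) (hM₇.agree ha (by decide))
      (by rw [ha _ (by decide), hk₇]) hi' fun j hj => by rw [ha _ (by decide), hV₇]).mono ?_
    rw [hB]; exact fun _ h => h
  rintro M₈ ψ₈ κ₈ ⟨⟨ha₈, hout⟩, rfl, rfl⟩
  refine ⟨⟨by rw [ha₈ _ (by decide), hM₇.hm], by rw [ha₈ _ (by decide), hM₇.hd]⟩, ?_⟩
  have hw := weight_nonneg ψ₈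
  by_cases hg₁ : rowSpace p m M₃ = hiddenSpace (H ⊔ commutator G) B.abelianElem
    (B.homMod_abelianElem hexp le_sup_right)
  · by_cases hg₂ : rowSpace p (d + 1) M₇ = hiddenSpace H (B.quadraticElem v) hom
    · have hgood : B.OutputsGenerator H (M₈ .out) := by
        refine B.zpowers_eq hexp hcen hH hsq (le_zpowers_of_picked hexp hcen hH hred₃ hg₁ hVp)
          (b := fun (i : Fin (d + 1)) j => M₇ .B (i * (d + 1) + j)) hg₂ ?_
        rcases hout with ⟨i, hi, h⟩ | ⟨h, h'⟩
        · exact Or.inl ⟨⟨i, hi⟩, h⟩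
        · exact Or.inr ⟨fun i => h i i.isLt, h'⟩
      rw [if_pos hg₂, if_pos hgood, hadef, if_pos hg₁, one_mul]
    · rw [if_neg hg₂]
      split_ifs
      · exact hw
      · exact le_rfl
  · rw [hadef, if_neg hg₁, zero_mul, ite_self]
    split_ifs
    · exact hw
    · exact le_rfl

end Frame
end QRam

namespace QRam

/-! ## Input and output -/

/-- The address of the working memory. -/
def origin : Expr := 3 + .reg 1 * .reg 1 * .reg 2 + .reg 1 + .reg 2

/-- Set up the working memory. -/
def loadInput : Com :=
  .seq (.assign (origin + 0) (.reg 0)) (.seq (.assign (origin + 1) (.reg 1))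
    (.seq (.assign (origin + 2) (.reg 2)) (.assign 0 origin)))

/-- Copy the array `out` to the registers from `0` on. -/
def output : Com :=
  .seq (put .i 0 (var .m + var .d - 3))
    (.seq (.loop (var .i)
      (.seq (.assign (var .i + 2) (ix .out (var .i + 2))) (put .i 0 (var .i - 1))))
    (.seq (.assign 2 (.reg 0)) (.seq (.assign 0 (.reg (.reg 2 + 22)))
      (.seq (.assign 1 (.reg (.reg 2 + 45))) (.assign 2 (.reg (.reg 2 + 68)))))))

namespace Frame

variable {F : Frame}

/-- From the given state on, the program `c` leads to a state with the property `Q`. -/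
def Leads (F : Frame) (c : Com) (s : State) (Q : State → Prop) : Prop :=
  ∀ r T v, (∀ s', Q s' → F.Ends r s' T v) → F.Ends (c :: r) s (T + c.steps.eval F.bound) v

theorem Leads.seq {c₁ c₂ : Com} {s : State} {Q₁ Q : State → Prop} (h₁ : F.Leads c₁ s Q₁)
    (h₂ : ∀ s', Q₁ s' → F.Leads c₂ s' Q) : F.Leads (.seq c₁ c₂) s Q := fun r T v hr =>
  (Ends.seq (h₁ _ _ _ fun s' h => h₂ s' h r T v hr)).mono
    (by simp only [Com.steps, Polynomial.eval_add, Polynomial.eval_one]; omega) le_rfl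

theorem Leads.assign {e₁ e₂ : Expr} {s : State} {Q : State → Prop}
    (hb : (∀ a, s.reg a < 2 ^ F.bound) → e₂.val s.reg < 2 ^ F.bound)
    (h : Q ⟨Function.update s.reg (e₁.val s.reg) (e₂.val s.reg), s.ket, s.calls⟩) :
    F.Leads (.assign e₁ e₂) s Q := fun _ _ _ hr h₁ h₂ =>
  ((Ends.assign (hb h₂) (hr _ h)).mono (by simp [Com.steps]) le_rfl) h₁ h₂

/-- Symbolic execution of an assignment. -/
theorem Leads.assign_seq {e₁ e₂ : Expr} {c : Com} {s : State} {Q : State → Prop}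
    (hb : (∀ a, s.reg a < 2 ^ F.bound) → e₂.val s.reg < 2 ^ F.bound)
    (h : F.Leads c ⟨Function.update s.reg (e₁.val s.reg) (e₂.val s.reg), s.ket, s.calls⟩ Q) :
    F.Leads (.seq (.assign e₁ e₂) c) s Q :=
  (Leads.assign (Q := fun s' => s' = _) hb rfl).seq fun s' h' => by rw [h']; exact h

theorem Leads.loop {e : Expr} {c : Com} (I : ℕ → State → Prop)
    (he : ∀ i s, I i s → (e.val s.reg = 0 ↔ i = 0))
    (hc : ∀ i s, I (i + 1) s → F.Leads c s (I i)) {n : ℕ} (hn : n ≤ F.bound) {s : State}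
    (h : I n s) : F.Leads (.loop e c) s (I 0) := fun r T v hr => by
  have key : ∀ n s, I n s → F.Ends (.loop e c :: r) s (T + (n * (c.steps.eval F.bound + 1) + 1)) v := by
    intro n
    induction n with
    | zero =>
      intro s h
      refine (Ends.loop (T := T) ?_).mono (by omega) le_rfl
      simpa [(he _ _ h).2 rfl] using hr s h
    | succ n ih =>
      intro s h
      refine (Ends.loop (T := (T + (n * (c.steps.eval F.bound + 1) + 1)) + c.steps.eval F.bound)
        ?_).mono (by rw [add_mul]; omega) le_rfl
      rw [if_pos fun h' => by simpa using (he _ _ h).1 h']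
      exact hc n s h _ _ _ ih
  refine (key n s h).mono ?_ le_rfl
  have := Nat.mul_le_mul_right (c.steps.eval F.bound + 1) hn
  simp only [Com.steps, Polynomial.eval_mul, Polynomial.eval_add, Polynomial.eval_X,
    Polynomial.eval_one]
  rw [add_mul]; omega

/-- The initial contents of the working memory. -/
def initialMem (p m d : ℕ) : Mem :=
  ((Mem.set (fun _ _ => 0) .p 0 p).set .m 0 m).set .d 0 d

/-- The working memory starts behind the input, where all registers are zero, so that all arrays are
initially zero. Register 0 is overwritten last because `p` is read from it, and the table of
commutators stays readable below the origin. -/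
theorem Leads.loadInput {G : Type*} [Group G] {p m d : ℕ} {B : Presentation G p m d}
    (htbl : F.tbl = B.input) (horg : F.org = 3 + m * m * d + m + d) (hb : F.org < 2 ^ F.bound)
    {ψ : Ket} {κ : ℕ} :
    F.Leads QRam.loadInput ⟨B.input, ψ, κ⟩ fun s => s = F.st (initialMem p m d) ψ κ := by
  have h0 : B.input 0 = p := rfl
  have h1 : B.input 1 = m := rfl
  have h2 : B.input 2 = d := rfl
  have hpos : 0 < F.org := by omega
  have hu (R : ℕ → ℕ) {a : ℕ} (x : ℕ) (ha : F.org ≤ a) (b : ℕ) (hb : b < 3) :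
      Function.update R a x b = R b := Function.update_of_ne (by omega) _ _
  have hval (R : ℕ → ℕ) (h1 : R 1 = m) (h2 : R 2 = d) : origin.val R = F.org := by
    simp [origin, h1, h2, horg]
  unfold QRam.loadInput
  refine Leads.assign_seq (fun h => h _) ?_
  simp only [Expr.val_add, Expr.val_ofNat, hval _ h1 h2, Expr.val_reg, h0]
  refine Leads.assign_seq (fun h => h _) ?_
  simp only [Expr.val_add, Expr.val_ofNat, Expr.val_reg]
  rw [hval _ (by rw [hu _ _ (by omega) _ (by omega), h1])
    (by rw [hu _ _ (by omega) _ (by omega), h2]), hu _ _ (by omega) _ (by omega), h1]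
  refine Leads.assign_seq (fun h => h _) ?_
  simp only [Expr.val_add, Expr.val_ofNat, Expr.val_reg]
  rw [hval _ (by rw [hu _ _ (by omega) _ (by omega), hu _ _ (by omega) _ (by omega), h1])
    (by rw [hu _ _ (by omega) _ (by omega), hu _ _ (by omega) _ (by omega), h2]),
    hu _ _ (by omega) _ (by omega), hu _ _ (by omega) _ (by omega), h2]
  have h3 : origin.val (Function.update (Function.update (Function.update B.input (F.org + 0) p)
      (F.org + 1) m) (F.org + 2) d) = F.org := by
    refine hval _ ?_ ?_
    · rw [hu _ _ (by omega) _ (by omega), hu _ _ (by omega) _ (by omega),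
        hu _ _ (by omega) _ (by omega), h1]
    · rw [hu _ _ (by omega) _ (by omega), hu _ _ (by omega) _ (by omega),
        hu _ _ (by omega) _ (by omega), h2]
  refine Leads.assign (fun _ => by rw [h3]; exact hb) ?_
  simp only [h3, Expr.val_ofNat, st, State.mk.injEq, and_true]
  have h4 : F.enc (fun _ _ => 0) = Function.update B.input 0 F.org := by
    funext a
    rw [enc, htbl]
    split_ifs with h5 h6
    · rw [h5, Function.update_self]
    · rw [Function.update_of_ne h5]
    · rw [Function.update_of_ne h5]
      obtain ⟨a, rfl⟩ : ∃ a', a = a' + 3 := ⟨a - 3, by omega⟩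
      rw [Presentation.input, dif_neg (by omega)]
  rw [initialMem, ← enc_set _ .d 0 _ hpos, ← enc_set _ .m 0 _ hpos, ← enc_set _ .p 0 _ hpos, h4,
    Function.update_comm (show F.org + 2 ≠ 0 by omega),
    Function.update_comm (show F.org + 1 ≠ 0 by omega),
    Function.update_comm (show F.org + 0 ≠ 0 by omega)]
  rfl

/-- All reads go through the origin in register 0. The letters from 3 on are therefore copied first;
then the origin is saved in register 2, which is itself overwritten at the very end. The offsets 22,
45 and 68 are `23 i + 22` for the entries 0, 1 and 2 of `out`. The inequality for `F.org` keeps the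
output from running into the working memory. -/
theorem Leads.output [F.Valid] {m d : ℕ} (horg : 3 + m + d ≤ F.org) (hbound : m + d ≤ F.bound)
    {M : Mem} (hm : M .m 0 = m) (hd : M .d 0 = d) {ψ : Ket} {κ : ℕ} :
    F.Leads QRam.output (F.st M ψ κ) fun s => s.ket = ψ ∧ ∀ i < m + d, s.reg i = M .out i := by
  have hpos : 0 < F.org := by omega
  refine Leads.seq (Q₁ := fun s => s = F.st (M.set .i 0 (m + d - 3)) ψ κ)
    (Leads.assign (fun _ => ?_) ?_) ?_
  · simp only [st, Expr.val_sub, Expr.val_add, val_var, hm, hd, Expr.val_ofNat]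
    have : m + d < 2 ^ F.bound := hbound.trans_lt Nat.lt_two_pow_self
    omega
  · have := enc_set (F := F) M .i 0 (m + d - 3) hpos
    simpa [st, val_adr, hm, hd] using this
  rintro _ rfl
  have hi (R : ℕ → ℕ) : (var .i).val R = R (R 0 + 7) := by simp [var, ix, adr, Name.code]
  refine Leads.seq (Leads.loop (n := m + d - 3) (fun j s => s.ket = ψ ∧ s.reg 0 = F.org ∧
    s.reg (F.org + 7) = j ∧ (∀ i < m + d, s.reg (F.org + (23 * i + 22)) = M .out i) ∧
    j ≤ m + d - 3 ∧ ∀ i, j + 3 ≤ i → i < m + d → s.reg i = M .out i) ?_ ?_ (by omega) ?_) ?_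
  · rintro j s ⟨-, h0, h1, -⟩
    rw [hi, h0, h1]
  · rintro j s ⟨hψ, h0, h1, h2, h3, h4⟩
    have hv : (var .i).val s.reg = j + 1 := by rw [hi, h0, h1]
    have hx : (ix .out (var .i + 2)).val s.reg = M .out (j + 3) := by
      rw [← h2 (j + 3) (by omega)]
      simp [ix, adr, hv, h0, Name.code]
    refine Leads.assign_seq (fun h => by rw [hx, ← h2 (j + 3) (by omega)]; exact h _) ?_
    rw [hx, Expr.val_add, hv, Expr.val_ofNat]
    have hu (a : ℕ) (ha : a = 0 ∨ F.org ≤ a) :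
        Function.update s.reg (j + 1 + 2) (M .out (j + 3)) a = s.reg a :=
      Function.update_of_ne (by omega) _ _
    have hu0 := (hu 0 (by omega)).trans h0
    have hv' : (var .i - 1).val (Function.update s.reg (j + 1 + 2) (M .out (j + 3))) = j := by
      rw [Expr.val_sub, hi, hu0, hu _ (by omega), h1, Expr.val_ofNat]; omega
    have ha' : (adr .i 0).val (Function.update s.reg (j + 1 + 2) (M .out (j + 3))) = F.org + 7 := by
      simp [adr, h0, Name.code]
    refine Leads.assign (fun _ => ?_) ?_
    · rw [hv']
      exact lt_of_lt_of_le (by omega : j < F.bound) Nat.lt_two_pow_self.le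
    · dsimp only
      rw [hv', ha']
      refine ⟨hψ, ?_, Function.update_self _ _ _, fun i hi => ?_, by omega, fun i hi hi' => ?_⟩
      · rw [Function.update_of_ne (by omega), hu0]
      · rw [Function.update_of_ne (by omega), hu _ (by omega), h2 i hi]
      · rw [Function.update_of_ne (by omega)]
        by_cases hij : i = j + 3
        · rw [hij, Function.update_self]
        · rw [Function.update_of_ne (by omega), h4 i (by omega) hi']
  · refine ⟨rfl, enc_zero (M.set .i 0 (m + d - 3)), ?_, fun i _ => ?_, le_rfl, by omega⟩
    · have := enc_adr (F := F) (M.set .i 0 (m + d - 3)) .i 0 hpos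
      simpa [Name.code, st] using this
    · have := enc_adr (F := F) (M.set .i 0 (m + d - 3)) .out i hpos
      simpa [Name.code, st] using this
  · rintro s ⟨hψ, h0, -, h2, -, h3⟩
    have hu (R : ℕ → ℕ) {a : ℕ} (x : ℕ) {b : ℕ} (ha : a < 3) (hb : 3 ≤ b) :
        Function.update R a x b = R b := Function.update_of_ne (by omega) _ _
    refine Leads.assign_seq (fun h => h _) ?_
    simp only [Expr.val_reg, Expr.val_ofNat, h0]
    refine Leads.assign_seq (fun h => h _) ?_
    simp only [Expr.val_reg, Expr.val_ofNat, Expr.val_add, Function.update_self]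
    rw [hu _ _ (by omega) (by omega)]
    refine Leads.assign_seq (fun h => h _) ?_
    simp only [Expr.val_reg, Expr.val_ofNat, Expr.val_add]
    rw [Function.update_of_ne (by omega : 2 ≠ 0), Function.update_self,
      hu _ _ (by omega) (by omega), hu _ _ (by omega) (by omega)]
    refine Leads.assign (fun h => h _) ⟨hψ, fun i hi => ?_⟩
    simp only [Expr.val_reg, Expr.val_ofNat, Expr.val_add]
    rw [Function.update_of_ne (by omega : 2 ≠ 1), Function.update_of_ne (by omega : 2 ≠ 0),
      Function.update_self, hu (b := F.org + 68) _ _ (by omega) (by omega),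
      hu (b := F.org + 68) _ _ (by omega) (by omega),
      hu (b := F.org + 68) _ _ (by omega) (by omega)]
    rcases (by omega : i = 0 ∨ i = 1 ∨ i = 2 ∨ 3 ≤ i) with rfl | rfl | rfl | h
    · simpa [Function.update_apply] using h2 0 hi
    · simpa [Function.update_apply] using h2 1 hi
    · simpa [Function.update_apply] using h2 2 hi
    · rw [hu _ _ (by omega) h, hu _ _ (by omega) h, hu _ _ (by omega) h, hu _ _ (by omega) h,
        h3 i (by omega) hi]

end Frame

/-- The algorithm. -/
def findGenerator : Com := .seq loadInput (.seq search output)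

theorem monotone_eval (q : Polynomial ℕ) : Monotone fun x => q.eval x := by
  induction q using Polynomial.induction_on' with
  | add p q hp hq => simpa only [Polynomial.eval_add] using hp.add hq
  | monomial n a =>
    intro x y h
    simp only [Polynomial.eval_monomial]
    gcongr

open Polynomial in
/-- A bound for the running time of `findGenerator`. -/
noncomputable def timeBound : ℕ[X] :=
  findGenerator.steps.comp (16 * X + 100) *
    (1 + C findGenerator.rate * (16 * X + 101) + (16 * X + 100) + X)

/-! ### Bounds in terms of the order of the group -/

section bounds

variable {G : Type*} [Group G] {p m d : ℕ}

theorem card_eq (B : Presentation G p m d) : Nat.card G = p ^ (m + d) := by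
  rw [← Nat.card_congr (Equiv.ofBijective _ B.normalForm)]
  simp

theorem length_le_log (B : Presentation G p m d) (hp : 2 ≤ p) : m + d ≤ Nat.log 2 (Nat.card G) := by
  have h1 := Nat.lt_pow_succ_log_self (b := 2) (by omega) (Nat.card G)
  have h2 : 2 ^ (m + d) ≤ Nat.card G := by rw [card_eq B]; exact Nat.pow_le_pow_left hp _
  have := (Nat.pow_lt_pow_iff_right (a := 2) (by omega)).1 (h2.trans_lt h1)
  omega

/-- This bounds the input `p` by the order of the group. It could fail only for `m + d = 0`, but
then the group is trivial and its exponent 1 is not prime. -/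
theorem exponent_lt (B : Presentation G p m d) (hp : p.Prime) (hG : Monoid.exponent G = p) :
    p < 2 ^ (Nat.log 2 (Nat.card G) + 1) := by
  refine lt_of_le_of_lt ?_ (Nat.lt_pow_succ_log_self (b := 2) (by omega) (Nat.card G))
  rw [card_eq B]
  refine Nat.le_self_pow (fun h => hp.one_lt.ne' ?_) _
  have h1 := card_eq B
  rw [h, pow_zero] at h1
  have := (Nat.card_eq_one_iff_unique.1 h1).1
  rw [← hG, Monoid.exp_eq_one_iff]
  exact this

theorem requiredSize_le {ℓ : ℕ} (h : m + d ≤ ℓ) (hp : p < 2 ^ (ℓ + 1)) :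
    requiredSize p m d ≤ 2 ^ (4 * ℓ + 15) := by
  have h1 : m + d + 6 ≤ 2 ^ (ℓ + 3) := by
    have : ℓ < 2 ^ ℓ := Nat.lt_two_pow_self
    rw [pow_add]; omega
  calc requiredSize p m d ≤ 2 ^ 7 * (2 ^ (ℓ + 3)) ^ 2 * (2 ^ (ℓ + 1)) ^ 2 := by
        unfold requiredSize; gcongr; norm_num
    _ = 2 ^ (4 * ℓ + 15) := by rw [← pow_mul, ← pow_mul, ← pow_add, ← pow_add]; congr 1; ring

end bounds

theorem computes_findGenerator {G : Type*} [Group G] [Finite G] {p m d : ℕ} (hp : p.Prime)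
    (hG : Monoid.exponent G = p) (hcen : commutator G ≤ Subgroup.center G)
    (B : Presentation G p m d) {H : Subgroup G} (hH : Nat.card H = 1 ∨ Nat.card H = p)
    {f : G → ℕ} (hf : Hides f H) {D : ℕ → ℕ} {Ψ : (i : ℕ) → G → EuclideanSpace ℂ (Fin (D i))}
    (hΨ : ∀ i, IsHidingSet (H ⊔ commutator G) (Ψ i)) (τ : ℕ) :
    Computes (B.oracles f D Ψ τ) findGenerator B.input
      (timeBound.eval (Nat.log 2 (Nat.card G) + τ)) (B.OutputsGenerator H) := by
  classical
  have := Fact.mk hp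
  have hexp (g : G) : g ^ p = 1 := by rw [← hG]; exact Monoid.pow_exponent_eq_one g
  have hlen := length_le_log B hp.two_le
  have hplt := exponent_lt B hp hG
  set ℓ := Nat.log 2 (Nat.card G) with hℓ
  have hsize := requiredSize_le hlen hplt
  have hlog : Nat.clog 2 (requiredSize p m d) ≤ 4 * ℓ + 15 := Nat.clog_le_of_le_pow hsize
  -- The width of the arithmetic gates is `4 n` with `n ≤ 4 ℓ + 15`, so `16 ℓ + 100` bounds it, as
  -- well as the numbers of iterations and the lengths of all addresses. The origin exceeds the
  -- input by `m + d` registers to leave room for the output.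
  let F : Frame := ⟨B.oracles f D Ψ τ, findGenerator.rate, 16 * ℓ + 100,
    fun R ψ => if B.OutputsGenerator H R then weight ψ else 0, 3 + m * m * d + m + d, B.input⟩
  have hF : F.Valid := ⟨by change 0 < 3 + m * m * d + m + d; omega,
    by change 1 ≤ 16 * ℓ + 100; omega⟩
  have hS : Sizes F p m d (Nat.clog 2 (requiredSize p m d)) :=
    ⟨hp.two_le, Nat.le_pow_clog (by omega) _, by change _ ≤ 16 * ℓ + 100; omega,
      by change _ ≤ 16 * ℓ + 100; omega⟩
  have hpow : 2 ^ (ℓ + 100) ≤ 2 ^ F.bound :=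
    Nat.pow_le_pow_right (by omega) (by change _ ≤ 16 * ℓ + 100; omega)
  have hreg : 2 ^ (3 * ℓ + 100) ≤ 2 ^ F.bound :=
    Nat.pow_le_pow_right (by omega) (by change _ ≤ 16 * ℓ + 100; omega)
  have hlt : ℓ < 2 ^ ℓ := Nat.lt_two_pow_self
  have horg : F.org < 2 ^ F.bound := by
    refine lt_of_lt_of_le ?_ hreg
    change 3 + m * m * d + m + d < _
    have h1 : m * m * d ≤ 2 ^ ℓ * 2 ^ ℓ * 2 ^ ℓ := by gcongr <;> omega
    have h2 : 2 ^ ℓ * 2 ^ ℓ * 2 ^ ℓ = 2 ^ (3 * ℓ) := by rw [← pow_add, ← pow_add]; congr 1; ring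
    have h3 : 2 ^ ℓ ≤ 2 ^ (3 * ℓ) := Nat.pow_le_pow_right (by omega) (by omega)
    rw [pow_add 2 (3 * ℓ)]
    omega
  have hinput : ∀ a, B.input a < 2 ^ F.bound := by
    have hp' : p < 2 ^ F.bound := by
      refine (hplt.trans_le ?_).trans_le hpow
      exact Nat.pow_le_pow_right (by omega) (by omega)
    have hl : ℓ < 2 ^ F.bound := by
      refine (hlt.trans_le ?_).trans_le hpow
      exact Nat.pow_le_pow_right (by omega) (by omega)
    rintro (_ | _ | _ | a)
    · exact hp'
    · exact lt_of_le_of_lt (show m ≤ ℓ by omega) hl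
    · exact lt_of_le_of_lt (show d ≤ ℓ by omega) hl
    · rw [Presentation.input]
      split_ifs
      · exact (Fin.is_lt _).trans hp'
      · omega
  have hends : F.Ends [findGenerator] ⟨B.input, Finsupp.single 0 1, 0⟩
      (findGenerator.steps.eval F.bound) (81 / 100) := by
    have hout (M : Mem) (ψ : Ket) (κ : ℕ) (hm : M .m 0 = m) (hd : M .d 0 = d) :
        F.Ends [output] (F.st M ψ κ) (0 + output.steps.eval F.bound)
          (if B.OutputsGenerator H (M .out) then weight ψ else 0) := by
      refine Frame.Leads.output (by change _ ≤ 3 + m * m * d + m + d; omega)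
        (by change _ ≤ 16 * ℓ + 100; omega) hm hd [] 0 _ ?_
      rintro s ⟨rfl, h⟩
      refine Frame.Ends.nil.mono le_rfl (le_of_eq ?_)
      have : (fun i : Fin (m + d) => s.reg i) = fun i : Fin (m + d) => M .out i :=
        funext fun i => h i i.isLt
      have h' : B.OutputsGenerator H s.reg ↔ B.OutputsGenerator H (M .out) := by
        rw [Presentation.OutputsGenerator, this, Presentation.OutputsGenerator]
      exact if_congr h'.symm rfl rfl
    have hmain := Frame.Tr.search (F := F) (M := Frame.initialMem p m d) (ψ := Finsupp.single 0 1)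
      (κ := 0) rfl rfl (by change _ ≤ 3 + m * m * d + m + d; omega) rfl hexp hcen hH hf hΨ
      (by simp [Frame.initialMem]) (by simp [Frame.initialMem]) (by simp [Frame.initialMem]) (by simp [Frame.initialMem])
      (Within.single (fun _ _ => rfl) _) [output] _ fun M' ψ' κ' h => hout M' ψ' κ' h.1 h.2
    have hinit := Frame.Leads.loadInput (F := F) (B := B) (ψ := Finsupp.single 0 1) (κ := 0)
      rfl rfl horg [.seq search output] _ _ fun s hs => by rw [hs]; exact Frame.Ends.seq hmain
    refine (Frame.Ends.seq hinit).mono ?_ ?_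
    · simp only [findGenerator, Com.steps, Polynomial.eval_add, Polynomial.eval_one]
      omega
    · simp [weight]
  obtain ⟨n, hn, hv⟩ := hends (by simp [F]) hinput 0
  have htime : 0 + findGenerator.steps.eval F.bound * F.unit ≤ timeBound.eval (ℓ + τ) := by
    have h1 : findGenerator.steps.eval F.bound ≤ findGenerator.steps.eval (16 * (ℓ + τ) + 100) :=
      monotone_eval _ (by change 16 * ℓ + 100 ≤ _; omega)
    have h2 : F.unit ≤ 1 + findGenerator.rate * (16 * (ℓ + τ) + 101) + (16 * (ℓ + τ) + 100) +
        (ℓ + τ) := by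
      have : findGenerator.rate * (16 * ℓ + 100 + 1) ≤
        findGenerator.rate * (16 * (ℓ + τ) + 101) := Nat.mul_le_mul_left _ (by omega)
      change 1 + findGenerator.rate * (16 * ℓ + 100 + 1) + (16 * ℓ + 100) + τ ≤ _
      omega
    rw [zero_add]
    refine (Nat.mul_le_mul h1 h2).trans (le_of_eq ?_)
    simp [timeBound]
  refine ⟨n, fun σ hσ _ => ⟨(hn σ hσ).1, (hn σ hσ).2.trans htime⟩, ?_⟩
  refine le_trans (by norm_num) (hv.trans (le_of_eq ?_))
  refine congrArg List.sum (List.map_congr_left fun σ hσ => ?_)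
  simp [F, (hn σ hσ).1]

end QRam

theorem mainTheorem3 :
    ∃ (A : QRam.Com) (q : Polynomial ℕ),
      ∀ (G : Type u) [Group G] [Finite G] (p m d : ℕ),
        p.Prime → IsPGroup p G → Monoid.exponent G = p → commutator G ≤ Subgroup.center G →
      ∀ (B : Presentation G p m d) (H : Subgroup G), (Nat.card H = 1 ∨ Nat.card H = p) →
      ∀ f : G → ℕ, Hides f H →
      ∀ (D : ℕ → ℕ) (Ψ : (i : ℕ) → G → EuclideanSpace ℂ (Fin (D i))),
        (∀ i, IsHidingSet (H ⊔ commutator G) (Ψ i)) →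
      ∀ τ : ℕ,
        QRam.Computes (B.oracles f D Ψ τ) A B.input
          (q.eval (Nat.log 2 (Nat.card G) + τ)) (B.OutputsGenerator H) :=
  ⟨QRam.findGenerator, QRam.timeBound, fun _ _ _ _ _ _ hp _ hG hcen B _ hH _ hf _ _ hΨ τ =>
    QRam.computes_findGenerator hp hG hcen B hH hf hΨ τ⟩
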